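/- Let $M=G/K$ be a connected homogeneous space of a unimodular Lie group $G$ ($\operatorname{tr}\operatorname{ad}X=0$ for all $X\in\mathfrak g$), $K$ the isotropy group at $o\in M$, and let $\mathfrak g=\mathfrak k\oplus\mathfrak p$ be a reductive decomposition ($[\mathfrak k,\mathfrak p]\subset\mathfrak p$; for instance any $\mathrm{Ad}(K)$-invariant complement), so that $T_oM\equiv\mathfrak p$. Let $g$ be a $G$-invariant Einstein metric on $M$, $\mathrm{Ric}(g)=\rho g$, and put $\langle\cdot,\cdot\rangle=g_o$ on $\mathfrak p$. Let $\mu$ be the Lie bracket of $\mathfrak g$, $\mu_{\mathfrak p}=\mathrm{pr}_{\mathfrak p}\circ\mu|_{\mathfrak p\times\mathfrak p}$, $\langle B_\mu X,Y\rangle=\operatorname{tr}(\operatorname{ad}X\operatorname{ad}Y)$ for $X,Y\in\mathfrak p$, and, for bilinear $\lambda:\mathfrak p\times\mathfrak p\to\mathfrak p$ and $A\in\mathfrak{gl}(\mathfrak p)$, $$\theta(A)\lambda=A\lambda(\cdot,\cdot)-\lambda(A\cdot,\cdot)-\lambda(\cdot,A\cdot).$$ Put $\langle A,B\rangle=\operatorname{tr}(AB^t)$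 and $|\lambda|^2=\sum_{i,j}|\lambda(X_i,X_j)|^2$ for an orthonormal basis $\{X_i\}$ of $\mathfrak p$. Let $M_{\mu_{\mathfrak p}}$ be the operator with $\langle M_{\mu_{\mathfrak p}},A\rangle=\tfrac14\langle\theta(A)\mu_{\mathfrak p},\mu_{\mathfrak p}\rangle$ for all $A$, let $\delta(A)=-\theta(A)\mu_{\mathfrak p}$ with transpose $\delta^t$, let $S$ denote the symmetric part, and $$L_{\mathfrak p}A=\tfrac12 S(\delta^t\delta(A))+AM_{\mu_{\mathfrak p}}+M_{\mu_{\mathfrak p}}A .$$ Let $T$ be a $G$-invariant symmetric $2$-tensor on $M$, $T_o=\langle A\cdot,\cdot\rangle$. For a symmetric positive definite $\mathrm{Ad}(K)$-invariant operator $h$ of $\mathfrak p$ let $g_h$ be the $G$-invariant metric with $(g_h)_o=\langle h\cdot,h\cdot\rangle$, and let $\overline{\mathrm{Sc}}(h)=\mathrm{Sc}(g_h)$ be its (constant) scalar curvature. Then, for every $C^2$ curve $h(t)$ of such operators with $h(0)=I$, $h'(0)=A$ and $\det h(t)=e^{t\operatorname{tr}A}$ (for example $h(t)=e^{tA}$,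 or, if $\operatorname{tr}A=0$, any such curve with $\det h(t)=1$), the second variation $\mathrm{Sc}''_g(T,T):=\tfrac12\left.\tfrac{d^2}{dt^2}\right|_0\overline{\mathrm{Sc}}(h(t))$ exists and $$\mathrm{Sc}''_g(T,T)=-\langle L_{\mathfrak p}A,A\rangle+2\rho\operatorname{tr}A^2=\langle(2\rho\,\mathrm{id}-L_{\mathfrak p})A,A\rangle=-\tfrac12|\theta(A)\mu_{\mathfrak p}|^2-\operatorname{tr}(B_\mu A^2).$$ In terms of the line $g+tT$, $$\left.\tfrac{d^2}{dt^2}\right|_0\mathrm{Sc}(g+tT)=\tfrac12\langle(2\rho\,\mathrm{id}-L_{\mathfrak p})A,A\rangle+\rho\operatorname{tr}A^2 .$$ -/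

import Mathlib

open scoped Manifold ContDiff Topology

noncomputable section

/-! ### Curvature of a metric written in a chart

`Q : E → E →L[ℝ] E →L[ℝ] ℝ` is a field of bilinear forms on (an open subset of) the
finite-dimensional space `E`; at the points of interest it is smooth, symmetric and positive
definite.  `(Q y).inverse` raises an index: it sends a covector to the vector representing it. -/

section Local

variable {E : Type*} [NormedAddCommGroup E] [NormedSpace ℝ E]

/-- Christoffel symbols:
`Q(Γ(v, w), u) = (1/2) * (∂_v Q(w, u) + ∂_w Q(v, u) - ∂_u Q(v, w))` for all constant `u`. -/
def localChristoffel (Q : E → E →L[ℝ] E →L[ℝ] ℝ) (y v w : E) : E :=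
  (Q y).inverse ((1 / 2 : ℝ) •
    (fderiv ℝ Q y v w + fderiv ℝ Q y w v - ((fderiv ℝ Q y).flip v).flip w))

/-- The curvature `R(u, v) w = ∇_u ∇_v w - ∇_v ∇_u w` for constant vector fields `u`, `v`, `w`,
where `∇` is the Levi-Civita connection given by the Christoffel symbols. -/
def localRiemann (Q : E → E →L[ℝ] E →L[ℝ] ℝ) (y u v w : E) : E :=
  fderiv ℝ (fun z => localChristoffel Q z v w) y u
    - fderiv ℝ (fun z => localChristoffel Q z u w) y v
    + localChristoffel Q y u (localChristoffel Q y v w)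
    - localChristoffel Q y v (localChristoffel Q y u w)

variable [FiniteDimensional ℝ E]

/-- The Ricci curvature `Ric(v, w) = tr (u ↦ R(u, v) w)`. -/
def localRicci (Q : E → E →L[ℝ] E →L[ℝ] ℝ) (y v w : E) : ℝ :=
  ∑ i, (Module.finBasis ℝ E).coord i (localRiemann Q y (Module.finBasis ℝ E i) v w)

/-- The scalar curvature, the trace of the Ricci curvature with respect to `Q y`. -/
def localScal (Q : E → E →L[ℝ] E →L[ℝ] ℝ) (y : E) : ℝ :=
  ∑ i, localRicci Q y (Module.finBasis ℝ E i)
    ((Q y).inverse (LinearMap.toContinuousLinearMap ((Module.finBasis ℝ E).coord i)))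

end Local

/-! ### Tensor fields and curvature on a manifold -/

section Manifold

variable {E : Type*} [NormedAddCommGroup E] [NormedSpace ℝ E]
  {M : Type*} [TopologicalSpace M] [ChartedSpace E M]

variable (E M) in
/-- Fields of bilinear forms on the tangent spaces of `M` (no regularity is required here). -/
abbrev TwoTensorField : Type _ :=
  ∀ x : M, TangentSpace 𝓘(ℝ, E) x →L[ℝ] TangentSpace 𝓘(ℝ, E) x →L[ℝ] ℝ

/-- The expression of a field of bilinear forms in the preferred chart at `x`, i.e. its pull-back
by the inverse of that chart. -/
def TwoTensorField.inChart (γ : TwoTensorField E M) (x : M) (y : E) : E →L[ℝ] E →L[ℝ] ℝ :=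
  let D : E →L[ℝ] E := mfderiv 𝓘(ℝ, E) 𝓘(ℝ, E) (extChartAt 𝓘(ℝ, E) x).symm y
  let b : E →L[ℝ] E →L[ℝ] ℝ := γ ((extChartAt 𝓘(ℝ, E) x).symm y)
  b.bilinearComp D D

variable [FiniteDimensional ℝ E]

/-- The Ricci tensor at `x` of a Riemannian metric, computed in the preferred chart at `x`. -/
def ricciTensor (γ : TwoTensorField E M) (x : M) (v w : TangentSpace 𝓘(ℝ, E) x) : ℝ :=
  localRicci (γ.inChart x) (extChartAt 𝓘(ℝ, E) x x)
    (mfderiv 𝓘(ℝ, E) 𝓘(ℝ, E) (extChartAt 𝓘(ℝ, E) x) x v)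
    (mfderiv 𝓘(ℝ, E) 𝓘(ℝ, E) (extChartAt 𝓘(ℝ, E) x) x w)

/-- The scalar curvature at `x` of a Riemannian metric, computed in the preferred chart at `x`. -/
def scalarCurvature (γ : TwoTensorField E M) (x : M) : ℝ :=
  localScal (γ.inChart x) (extChartAt 𝓘(ℝ, E) x x)

variable [IsManifold 𝓘(ℝ, E) ∞ M] (G : Type*) [Group G] [MulAction G M]

/-- `γ` is a smooth `G`-invariant symmetric 2-tensor on `M`. -/
structure IsInvariantSymmTensor (γ : TwoTensorField E M) : Prop where
  smooth : ContMDiff 𝓘(ℝ, E) (𝓘(ℝ, E).prod 𝓘(ℝ, E →L[ℝ] E →L[ℝ] ℝ)) ∞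
    (fun x : M => Bundle.TotalSpace.mk' (E →L[ℝ] E →L[ℝ] ℝ)
      (E := fun x : M => TangentSpace 𝓘(ℝ, E) x →L[ℝ] TangentSpace 𝓘(ℝ, E) x →L[ℝ] ℝ)
      x (γ x))
  symm : ∀ (x : M) (v w : TangentSpace 𝓘(ℝ, E) x), γ x v w = γ x w v
  invariant : ∀ (a : G) (x : M) (v w : TangentSpace 𝓘(ℝ, E) x),
    γ (a • x) (mfderiv 𝓘(ℝ, E) 𝓘(ℝ, E) (fun z : M => a • z) x v)
      (mfderiv 𝓘(ℝ, E) 𝓘(ℝ, E) (fun z : M => a • z) x w) = γ x v w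

/-- `γ` is a `G`-invariant Riemannian metric on `M`. -/
structure IsInvariantMetric (γ : TwoTensorField E M) : Prop extends
    IsInvariantSymmTensor G γ where
  pos : ∀ (x : M) (v : TangentSpace 𝓘(ℝ, E) x), v ≠ 0 → 0 < γ x v v

end Manifold

/-! ### Homogeneous spaces: isotropy subalgebra and reductive complements -/

/-- A smooth Lie group is regular enough for the Lie algebra structure on its tangent space at the
identity. -/
instance instLieGroupMinSmoothness {F : Type*} [NormedAddCommGroup F] [NormedSpace ℝ F]
    {G : Type*} [TopologicalSpace G] [ChartedSpace F G] [Group G] [LieGroup 𝓘(ℝ, F) ∞ G] :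
    LieGroup 𝓘(ℝ, F) (minSmoothness ℝ 3) G := by
  rw [minSmoothness_of_isRCLikeNormedField]
  infer_instance

section Homogeneous

variable {F : Type*} [NormedAddCommGroup F] [NormedSpace ℝ F]
  {G : Type*} [TopologicalSpace G] [ChartedSpace F G] [Group G]
  {E : Type*} [NormedAddCommGroup E] [NormedSpace ℝ E]
  {M : Type*} [TopologicalSpace M] [ChartedSpace E M] [MulAction G M]

variable (F G E) in
/-- The derivative at the identity of the orbit map `a ↦ a • o`, from the Lie algebra of `G` to the
tangent space of `M` at `o = 1 • o`.  Restricted to a complement of the isotropy subalgebra it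
is the usual identification of that complement with `T_o M`. -/
def orbitDeriv (o : M) : GroupLieAlgebra 𝓘(ℝ, F) G →ₗ[ℝ] TangentSpace 𝓘(ℝ, E) o :=
  (mfderiv 𝓘(ℝ, F) 𝓘(ℝ, E) (fun a : G => a • o) (1 : G)).toLinearMap

variable (F G E) in
/-- The Lie algebra `𝔨` of the isotropy group of `o`, i.e. the vectors whose
fundamental vector field vanishes at `o`. -/
def isotropySubalgebra (o : M) : Submodule ℝ (GroupLieAlgebra 𝓘(ℝ, F) G) :=
  LinearMap.ker (orbitDeriv F G E o)

variable (E) in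
/-- `𝔤 = 𝔨 ⊕ 𝔭` is a reductive decomposition at the Lie algebra level: `[𝔨, 𝔭] ⊆ 𝔭`.  Every
`Ad(K)`-invariant complement `𝔭` of `𝔨` has this property. -/
structure IsReductiveComplement (o : M) (p : Submodule ℝ (GroupLieAlgebra 𝓘(ℝ, F) G)) : Prop where
  isCompl : IsCompl p (isotropySubalgebra F G E o)
  bracket_mem : ∀ Z ∈ isotropySubalgebra F G E o, ∀ X ∈ p, ⁅Z, X⁆ ∈ p

/-- The bilinear form on `𝔭` which corresponds to a bilinear form `b` on `T_o M`. -/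
def formOn (o : M) (p : Submodule ℝ (GroupLieAlgebra 𝓘(ℝ, F) G)) (γ : TwoTensorField E M)
    (X Y : p) : ℝ :=
  γ o (orbitDeriv F G E o X) (orbitDeriv F G E o Y)

variable [LieGroup 𝓘(ℝ, F) ∞ G] [CompleteSpace F]

/-- The algebra product `μ_𝔭(X, Y) = pr_𝔭 [X, Y]` on `𝔭`. -/
def bracketOn {o : M} {p : Submodule ℝ (GroupLieAlgebra 𝓘(ℝ, F) G)}
    (hp : IsReductiveComplement E o p) : p →ₗ[ℝ] p →ₗ[ℝ] p :=
  LinearMap.mk₂ ℝ (fun X Y : p => p.projectionOnto _ hp.isCompl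
      ⁅(X : GroupLieAlgebra 𝓘(ℝ, F) G), (Y : GroupLieAlgebra 𝓘(ℝ, F) G)⁆)
    (fun _ _ _ => by simp [add_lie]) (fun _ _ _ => by simp)
    (fun _ _ _ => by simp) (fun _ _ _ => by simp)

/-- The operator `B_μ` of `𝔭` with `⟨B_μ X, Y⟩ = tr (ad X ad Y)`, the Killing form of `𝔤`, where
`⟨·, ·⟩` is the inner product on `𝔭` for which the basis `e` is orthonormal. -/
def killingOp {p : Submodule ℝ (GroupLieAlgebra 𝓘(ℝ, F) G)} {ι : Type*} [Fintype ι]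
    [DecidableEq ι] (e : Module.Basis ι ℝ p) : Module.End ℝ p :=
  Matrix.toLin e e (Matrix.of fun i j =>
    killingForm ℝ (GroupLieAlgebra 𝓘(ℝ, F) G) (e j : GroupLieAlgebra 𝓘(ℝ, F) G) (e i))

end Homogeneous

/-! ### Algebra products on a Euclidean space

`e` is a basis of the real vector space `V`, and `V` carries the inner product for which `e` is
orthonormal.  None of the notions depends on the choice of the orthonormal basis. -/

section Algebra

variable {V : Type*} [AddCommGroup V] [Module ℝ V]

/-- The representation `θ(A)λ = A λ(·, ·) - λ(A ·, ·) - λ(·, A ·)` of `𝔤𝔩(V)`. -/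
def theta (A : Module.End ℝ V) (l : V →ₗ[ℝ] V →ₗ[ℝ] V) : V →ₗ[ℝ] V →ₗ[ℝ] V :=
  l.compr₂ A - l.comp A - l.compl₂ A

variable {ι : Type*} [Fintype ι] [DecidableEq ι] (e : Module.Basis ι ℝ V)

/-- The transpose of an operator. -/
def transposeOp (A : Module.End ℝ V) : Module.End ℝ V :=
  Matrix.toLin e e (LinearMap.toMatrix e e A).transpose

/-- The inner product `⟨A, B⟩ = tr (A Bᵗ)` of operators. -/
def innerOp (A B : Module.End ℝ V) : ℝ :=
  LinearMap.trace ℝ V (A * transposeOp e B)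

/-- The inner product `⟨λ, λ'⟩ = ∑ ⟨λ(e_i, e_j), λ'(e_i, e_j)⟩` of bilinear maps. -/
def innerProd (l l' : V →ₗ[ℝ] V →ₗ[ℝ] V) : ℝ :=
  ∑ i, ∑ j, ∑ k, e.coord k (l (e i) (e j)) * e.coord k (l' (e i) (e j))

/-- The operator `C` with `⟨C, A⟩ = f A` for all operators `A`, for a linear functional `f`
(the matrix units of `e` are an orthonormal basis of the space of operators). -/
def rieszOp (f : Module.End ℝ V → ℝ) : Module.End ℝ V :=
  Matrix.toLin e e (Matrix.of fun i j => f (Matrix.toLin e e (Matrix.single i j 1)))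

/-- The moment map: `⟨M_λ, A⟩ = (1/4) ⟨θ(A)λ, λ⟩` for all `A`. -/
def momentMap (l : V →ₗ[ℝ] V →ₗ[ℝ] V) : Module.End ℝ V :=
  rieszOp e fun A => (1 / 4 : ℝ) * innerProd e (theta A l) l

/-- `δ_λ(A) = -θ(A)λ`. -/
def deltaOp (l : V →ₗ[ℝ] V →ₗ[ℝ] V) (A : Module.End ℝ V) : V →ₗ[ℝ] V →ₗ[ℝ] V :=
  -theta A l

/-- The transpose of `δ_λ`: `⟨δ_λᵗ(κ), A⟩ = ⟨κ, δ_λ(A)⟩` for all `A`. -/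
def deltaTransposeOp (l : V →ₗ[ℝ] V →ₗ[ℝ] V) (l' : V →ₗ[ℝ] V →ₗ[ℝ] V) : Module.End ℝ V :=
  rieszOp e fun A => innerProd e l' (deltaOp l A)

/-- The symmetric part of an operator. -/
def symmPart (A : Module.End ℝ V) : Module.End ℝ V :=
  (1 / 2 : ℝ) • (A + transposeOp e A)

/-- The operator `L A = (1/2) S(δᵗ δ(A)) + A M + M A`, where `δ = δ_λ`, `M = M_λ` and `S` is the
symmetric part. -/
def lichOp (l : V →ₗ[ℝ] V →ₗ[ℝ] V) (A : Module.End ℝ V) : Module.End ℝ V :=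
  (1 / 2 : ℝ) • symmPart e (deltaTransposeOp e l (deltaOp l A))
    + A * momentMap e l + momentMap e l * A

end Algebra

end

/-! The scalar curvature of an invariant metric depends only on its Gram matrix `P` in a fixed basis
of `𝔭`. For unimodular `G` it equals `-(1/4)|μ_𝔭|² - (1/2) tr B`, norm and trace being taken in the
metric `P` (`scalarCurvature_eq_algScal`). This is rational in `P`, so the second variation is a
computation with 2-jets of matrices.

To reach this formula from curvature in a chart, note that the fundamental fields of the action are
Killing, and that a Killing field preserves the Christoffel symbols. Hence on two such fields the
curvature is `[∇ξ, ∇η] - ∇ζ` with `ζ = -[ξ, η]` (`localRiemann_killing`), without derivatives of the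
connection. The fundamental fields span the tangent space at `o`, so the curvature there is
determined by the Nomizu map `X ↦ ∇X*`. Its values are skew and it is torsion free; with `tr ad = 0`
these facts give the Ricci curvature on `𝔭` (`nomizu_ricci`), and a further trace gives the scalar
curvature.

Polarized and paired with a matrix `S`, the Einstein equation reads `(1/4)⟨θ(S)μ_𝔭, μ_𝔭⟩ - (1/2)
tr(B_μ S) = ρ tr S` (`einstein_identity`). Along a curve with `P(0) = 1`, `P' = B`, `P'' = P₂`, the
second derivative of the scalar curvature consists of `-(1/4)|θ(B)μ_𝔭|² - (1/2) tr(B_μ B²)` and of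
the left side of this equation at `S = B² - P₂`, that is, `ρ (tr B² - tr P₂)` (`hasJet_algScal`).

For the line `g + tT` one has `B = A` and `P₂ = 0`, which leaves `ρ tr A²`. For `P = h²` one has `B
= 2A` and `P₂ = 2h'' + 2A²`; the determinant condition forces `tr h'' = tr A²`
(`trace_second_deriv_of_det_eq_exp`), and the `ρ` term vanishes. Finally `⟨L A, A⟩ = (1/2)|θ(A)μ_𝔭|²
+ 2⟨M, A²⟩` (`innerOp_lichOp`), and the Einstein equation at `S = A²` trades `2⟨M, A²⟩` for `2ρ tr
A² + tr(B_μ A²)`, so the expressions for the second variation agree. -/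

noncomputable section

/-! ### Killing fields and curvature in a chart. -/

section LocalGeometry

set_option maxSynthPendingDepth 3

variable {E : Type*} [NormedAddCommGroup E] [NormedSpace ℝ E]

/-- `Q` is a smooth field of symmetric bilinear forms near `y₀`, nondegenerate at `y₀`. -/
structure IsLocalMetric (Q : E → E →L[ℝ] E →L[ℝ] ℝ) (y₀ : E) : Prop where
  smooth : ContDiffAt ℝ ∞ Q y₀
  symm : ∀ᶠ y in 𝓝 y₀, ∀ v w, Q y v w = Q y w v
  invertible : (Q y₀).IsInvertible

/-- The Killing equation `L_ξ Q = 0` near `y₀`, for a smooth vector field `ξ`. -/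
structure IsLocalKilling (Q : E → E →L[ℝ] E →L[ℝ] ℝ) (y₀ : E) (ξ : E → E) : Prop where
  smooth : ContDiffAt ℝ ∞ ξ y₀
  killing : ∀ᶠ y in 𝓝 y₀, ∀ v w,
    fderiv ℝ Q y (ξ y) v w + Q y (fderiv ℝ ξ y v) w + Q y v (fderiv ℝ ξ y w) = 0

/-- The Christoffel symbols as a bilinear map. -/
def christoffelBilin (Q : E → E →L[ℝ] E →L[ℝ] ℝ) (y : E) : E →ₗ[ℝ] E →ₗ[ℝ] E :=
  LinearMap.mk₂ ℝ (localChristoffel Q y)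
    (fun v v' w => by
      simp only [localChristoffel, ← map_add]
      congr 1; ext u; simp; ring)
    (fun c v w => by
      simp only [localChristoffel, ← map_smul]
      congr 1; ext u; simp; ring)
    (fun v w w' => by
      simp only [localChristoffel, ← map_add]
      congr 1; ext u; simp; ring)
    (fun c v w => by
      simp only [localChristoffel, ← map_smul]
      congr 1; ext u; simp; ring)

@[simp] lemma christoffelBilin_apply (Q : E → E →L[ℝ] E →L[ℝ] ℝ) (y v w : E) :
    christoffelBilin Q y v w = localChristoffel Q y v w := rfl

/-- The covariant derivative `v ↦ ∇_v ξ` of the vector field `ξ` at `y`. -/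
def covDeriv (Q : E → E →L[ℝ] E →L[ℝ] ℝ) (y : E) (ξ : E → E) : Module.End ℝ E :=
  (fderiv ℝ ξ y).toLinearMap + (christoffelBilin Q y).flip (ξ y)

lemma covDeriv_apply (Q : E → E →L[ℝ] E →L[ℝ] ℝ) (y : E) (ξ : E → E) (v : E) :
    covDeriv Q y ξ v = fderiv ℝ ξ y v + localChristoffel Q y v (ξ y) := rfl

/-- The Koszul formula for constant fields. Identities for the symbols are tested through it, so the
derivative of the inverse metric never has to be computed. -/
lemma metric_localChristoffel {Q : E → E →L[ℝ] E →L[ℝ] ℝ} {y : E} (h : (Q y).IsInvertible)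
    (v w u : E) : Q y (localChristoffel Q y v w) u
      = (1 / 2 : ℝ) * (fderiv ℝ Q y v w u + fderiv ℝ Q y w v u - fderiv ℝ Q y u v w) := by
  rw [localChristoffel, h.self_apply_inverse]
  simp

variable {Q : E → E →L[ℝ] E →L[ℝ] ℝ} {y₀ : E}

lemma ContDiffAt.hasFDerivAt_fderiv {F' : Type*} [NormedAddCommGroup F'] [NormedSpace ℝ F']
    {f : E → F'} {x : E} (hf : ContDiffAt ℝ ∞ f x) :
    HasFDerivAt (fderiv ℝ f) (fderiv ℝ (fderiv ℝ f) x) x :=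
  ((hf.fderiv_right (m := 1) (by norm_cast)).differentiableAt (by norm_num)).hasFDerivAt

lemma ContDiffAt.hasFDerivAt_of_infty {F' : Type*} [NormedAddCommGroup F'] [NormedSpace ℝ F']
    {f : E → F'} {x : E} (hf : ContDiffAt ℝ ∞ f x) : HasFDerivAt f (fderiv ℝ f x) x :=
  (hf.differentiableAt (by simp)).hasFDerivAt

lemma ContDiffAt.fderiv_fderiv_comm {F' : Type*} [NormedAddCommGroup F'] [NormedSpace ℝ F']
    {f : E → F'} {x : E} (hf : ContDiffAt ℝ ∞ f x) (v w : E) :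
    fderiv ℝ (fderiv ℝ f) x v w = fderiv ℝ (fderiv ℝ f) x w v :=
  (hf.isSymmSndFDerivAt (by
    rw [minSmoothness_of_isRCLikeNormedField];
    exact WithTop.coe_le_coe.2 (le_top : (2 : ℕ∞) ≤ ⊤))).eq v w

lemma IsLocalMetric.fderiv_symm (hQ : IsLocalMetric Q y₀) (u v w : E) :
    fderiv ℝ Q y₀ u v w = fderiv ℝ Q y₀ u w v := by
  have h0 := hQ.smooth.hasFDerivAt_of_infty
  have h1 := ((h0.clm_apply (hasFDerivAt_const v y₀)).clm_apply (hasFDerivAt_const w y₀))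
  have h2 := ((h0.clm_apply (hasFDerivAt_const w y₀)).clm_apply (hasFDerivAt_const v y₀))
  have h3 := h2.congr_of_eventuallyEq (hQ.symm.mono fun y hy => hy v w)
  simpa using congrArg (fun L => L u) (h1.unique h3)

lemma IsLocalMetric.localChristoffel_comm (hQ : IsLocalMetric Q y₀) (v w : E) :
    localChristoffel Q y₀ v w = localChristoffel Q y₀ w v := by
  apply hQ.invertible.injective
  ext u
  rw [metric_localChristoffel hQ.invertible, metric_localChristoffel hQ.invertible,
    hQ.fderiv_symm u v w]
  ring

lemma IsLocalMetric.eventually_invertible [CompleteSpace E] (hQ : IsLocalMetric Q y₀) :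
    ∀ᶠ y in 𝓝 y₀, (Q y).IsInvertible := by
  obtain ⟨e, he⟩ := hQ.invertible
  have := ContinuousLinearEquiv.nhds e
  rw [he] at this
  exact hQ.smooth.continuousAt.eventually this

lemma IsLocalMetric.contDiffAt_localChristoffel [CompleteSpace E] (hQ : IsLocalMetric Q y₀)
    (v w : E) : ContDiffAt ℝ ∞ (fun z => localChristoffel Q z v w) y₀ := by
  have h1 : ContDiffAt ℝ ∞ (fderiv ℝ Q) y₀ := hQ.smooth.fderiv_right (by simp)
  have h2 : ContDiffAt ℝ ∞ (fun z => (Q z).inverse) y₀ :=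
    (ContinuousLinearMap.IsInvertible.contDiffAt_map_inverse hQ.invertible).comp y₀ hQ.smooth
  have h3 : ∀ v w, ContDiffAt ℝ ∞ (fun z => fderiv ℝ Q z v w) y₀ := fun v w =>
    (h1.clm_apply contDiffAt_const).clm_apply contDiffAt_const
  have h4 : ContDiffAt ℝ ∞ (fun z => ((fderiv ℝ Q z).flip v).flip w) y₀ := by
    let Fl : (E →L[ℝ] E →L[ℝ] E →L[ℝ] ℝ) →L[ℝ] (E →L[ℝ] E →L[ℝ] E →L[ℝ] ℝ) :=
      (ContinuousLinearMap.flipₗᵢ ℝ E E (E →L[ℝ] ℝ)).toContinuousLinearEquiv.toContinuousLinearMap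
    let Fl' : (E →L[ℝ] E →L[ℝ] ℝ) →L[ℝ] (E →L[ℝ] E →L[ℝ] ℝ) :=
      (ContinuousLinearMap.flipₗᵢ ℝ E E ℝ).toContinuousLinearEquiv.toContinuousLinearMap
    exact ((Fl'.contDiff.contDiffAt.comp y₀ ((Fl.contDiff.contDiffAt.comp y₀ h1).clm_apply
      contDiffAt_const)).clm_apply contDiffAt_const)
  exact h2.clm_apply ((((h3 v w).add (h3 w v)).sub h4).const_smul (1 / 2 : ℝ))

lemma IsLocalKilling.eq_at {ξ : E → E} (hξ : IsLocalKilling Q y₀ ξ) (v w : E) :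
    fderiv ℝ Q y₀ (ξ y₀) v w + Q y₀ (fderiv ℝ ξ y₀ v) w + Q y₀ v (fderiv ℝ ξ y₀ w) = 0 :=
  hξ.killing.self_of_nhds v w

/-- The derivative of the Killing equation. -/
lemma IsLocalKilling.fderiv_eq {ξ : E → E} (hQ : IsLocalMetric Q y₀)
    (hξ : IsLocalKilling Q y₀ ξ) (u a b : E) :
    fderiv ℝ (fderiv ℝ Q) y₀ u (ξ y₀) a b + fderiv ℝ Q y₀ (fderiv ℝ ξ y₀ u) a b
      + (fderiv ℝ Q y₀ u (fderiv ℝ ξ y₀ a) b + Q y₀ (fderiv ℝ (fderiv ℝ ξ) y₀ u a) b)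
      + (fderiv ℝ Q y₀ u a (fderiv ℝ ξ y₀ b) + Q y₀ a (fderiv ℝ (fderiv ℝ ξ) y₀ u b)) = 0 := by
  have q0 := hQ.smooth.hasFDerivAt_of_infty
  have q1 := hQ.smooth.hasFDerivAt_fderiv
  have x0 := hξ.smooth.hasFDerivAt_of_infty
  have x1 := hξ.smooth.hasFDerivAt_fderiv
  have ca := hasFDerivAt_const (𝕜 := ℝ) a y₀
  have cb := hasFDerivAt_const (𝕜 := ℝ) b y₀
  have h := ((((q1.clm_apply x0).clm_apply ca).clm_apply cb).add
    ((q0.clm_apply (x1.clm_apply ca)).clm_apply cb)).add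
    ((q0.clm_apply ca).clm_apply (x1.clm_apply cb))
  have h' := h.unique ((hasFDerivAt_const (0 : ℝ) y₀).congr_of_eventuallyEq
    (hξ.killing.mono fun y hy => hy a b))
  have := congrArg (fun L => L u) h'
  simp at this
  linarith

/-- A Killing field is affine: `L_ξ Γ = 0`. -/
lemma IsLocalKilling.fderiv_localChristoffel [CompleteSpace E] {ξ : E → E}
    (hQ : IsLocalMetric Q y₀) (hξ : IsLocalKilling Q y₀ ξ) (v w : E) :
    fderiv ℝ (fun z => localChristoffel Q z v w) y₀ (ξ y₀)
      = fderiv ℝ ξ y₀ (localChristoffel Q y₀ v w) - fderiv ℝ (fderiv ℝ ξ) y₀ v w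
        - localChristoffel Q y₀ (fderiv ℝ ξ y₀ v) w
        - localChristoffel Q y₀ v (fderiv ℝ ξ y₀ w) := by
  apply hQ.invertible.injective
  ext u
  have q0 := hQ.smooth.hasFDerivAt_of_infty
  have q1 := hQ.smooth.hasFDerivAt_fderiv
  have g0 := (hQ.contDiffAt_localChristoffel v w).hasFDerivAt_of_infty
  have c : ∀ a : E, HasFDerivAt (fun _ : E => a) (0 : E →L[ℝ] E) y₀ :=
    fun a => hasFDerivAt_const a y₀
  have hL := (q0.clm_apply g0).clm_apply (c u)
  have hR := (((((q1.clm_apply (c v)).clm_apply (c w)).clm_apply (c u)).add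
    (((q1.clm_apply (c w)).clm_apply (c v)).clm_apply (c u))).sub
    (((q1.clm_apply (c u)).clm_apply (c v)).clm_apply (c w))).const_mul (1 / 2 : ℝ)
  have h := hL.unique (hR.congr_of_eventuallyEq
    (hQ.eventually_invertible.mono fun y hy => metric_localChristoffel hy v w u))
  have h1 := congrArg (fun L => L (ξ y₀)) h
  simp at h1
  -- The derivatives of the Killing equation matching the three terms of the Koszul formula. In `k1
  -- + k2 - k3` the terms with `D²ξ(v, u)` and `D²ξ(w, u)` cancel, and `D²ξ(v, w)` survives twice.
  have k1 := hξ.fderiv_eq hQ v w u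
  have k2 := hξ.fderiv_eq hQ w v u
  have k3 := hξ.fderiv_eq hQ u v w
  have e1 := hξ.eq_at (localChristoffel Q y₀ v w) u
  have m := metric_localChristoffel hQ.invertible
  have s := hQ.smooth.fderiv_fderiv_comm
  have t := hξ.smooth.fderiv_fderiv_comm
  have m1 := m v w (fderiv ℝ ξ y₀ u)
  simp only [map_sub, _root_.sub_apply, m]
  rw [s v, t v u] at k1
  rw [s w, t w v, t w u] at k2
  rw [s u] at k3
  have z1 := hQ.symm.self_of_nhds (fderiv ℝ (fderiv ℝ ξ) y₀ u v) w
  rw [hQ.fderiv_symm u (fderiv ℝ ξ y₀ v) w] at k3 ⊢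
  have z2 := hQ.fderiv_symm u w (fderiv ℝ ξ y₀ v)
  linarith

/-- By the Koszul formula the Christoffel terms on the two sides add up to the derivative of `Q`
along `ξ`, so the claim is the Killing equation itself. -/
lemma IsLocalKilling.metric_covDeriv {ξ : E → E} (hQ : IsLocalMetric Q y₀)
    (hξ : IsLocalKilling Q y₀ ξ) (v w : E) :
    Q y₀ (covDeriv Q y₀ ξ v) w = - Q y₀ v (covDeriv Q y₀ ξ w) := by
  have h1 := hξ.eq_at v w
  have m := metric_localChristoffel hQ.invertible
  rw [hQ.symm.self_of_nhds v, covDeriv_apply, covDeriv_apply, map_add, map_add,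
    _root_.add_apply, _root_.add_apply, m, m,
    hQ.fderiv_symm w (ξ y₀) v, hQ.fderiv_symm v (ξ y₀) w, hQ.fderiv_symm (ξ y₀) w v,
    hQ.symm.self_of_nhds _ v]
  linarith

/-- Vanishing torsion: the Christoffel terms cancel by symmetry. The right side is `-[ξ, η]`, the
sign that suits fundamental fields of a left action. -/
lemma covDeriv_sub_covDeriv (hQ : IsLocalMetric Q y₀) (ξ η : E → E) :
    covDeriv Q y₀ ξ (η y₀) - covDeriv Q y₀ η (ξ y₀)
      = fderiv ℝ ξ y₀ (η y₀) - fderiv ℝ η y₀ (ξ y₀) := by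
  rw [covDeriv_apply, covDeriv_apply, hQ.localChristoffel_comm (η y₀)]
  abel

/-- The curvature of a metric evaluated on two Killing fields `ξ`, `η` whose (negative) bracket is
`ζ`. -/
theorem localRiemann_killing [CompleteSpace E] {ξ η ζ : E → E} (hQ : IsLocalMetric Q y₀)
    (hξ : IsLocalKilling Q y₀ ξ) (hη : IsLocalKilling Q y₀ η)
    (hζ : ∀ᶠ y in 𝓝 y₀, ζ y = fderiv ℝ ξ y (η y) - fderiv ℝ η y (ξ y)) (w : E) :
    localRiemann Q y₀ (ξ y₀) (η y₀) w
      = covDeriv Q y₀ ξ (covDeriv Q y₀ η w) - covDeriv Q y₀ η (covDeriv Q y₀ ξ w)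
        - covDeriv Q y₀ ζ w := by
  have x0 := hξ.smooth.hasFDerivAt_of_infty
  have x1 := hξ.smooth.hasFDerivAt_fderiv
  have n0 := hη.smooth.hasFDerivAt_of_infty
  have n1 := hη.smooth.hasFDerivAt_fderiv
  have hz := (((x1.clm_apply n0).sub (n1.clm_apply x0)).congr_of_eventuallyEq hζ).fderiv
  have c := hQ.localChristoffel_comm
  -- The symbols are differentiated only along `ξ` and `η`, so `L_ξ Γ = L_η Γ = 0` eliminates these
  -- derivatives. The second derivatives of the fields that appear are those in the derivative of
  -- `ζ`.
  rw [localRiemann, hξ.fderiv_localChristoffel hQ, hη.fderiv_localChristoffel hQ]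
  simp only [covDeriv_apply, hz, hζ.self_of_nhds, ← christoffelBilin_apply] at c ⊢
  simp only [_root_.sub_apply, _root_.add_apply,
    ContinuousLinearMap.comp_apply, ContinuousLinearMap.flip_apply, map_add, map_sub,
    LinearMap.add_apply]
  rw [hξ.smooth.fderiv_fderiv_comm w, hη.smooth.fderiv_fderiv_comm w]
  rw [c (christoffelBilin Q y₀ w (η y₀)) (ξ y₀), c (christoffelBilin Q y₀ w (ξ y₀)) (η y₀),
    c w (ξ y₀), c w (η y₀), c (η y₀) (fderiv ℝ ξ y₀ w), c (ξ y₀) (fderiv ℝ η y₀ w),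
    c w (fderiv ℝ ξ y₀ (η y₀)), c w (fderiv ℝ η y₀ (ξ y₀))]
  abel

end LocalGeometry

/-! ### Fundamental fields of a local action. -/

section LocalAction

set_option maxSynthPendingDepth 3

variable {E : Type*} [NormedAddCommGroup E] [NormedSpace ℝ E]
  {F : Type*} [NormedAddCommGroup F] [NormedSpace ℝ F]

/-- The fundamental vector field of a local action `Φ` with neutral element `c`. -/
def fundamentalField (Φ : F × E → E) (c X : F) (y : E) : E := fderiv ℝ Φ (c, y) (X, 0)

/-- The bilinear part of a local multiplication `m` with neutral element `c`. -/
def mixedDeriv (m : F × F → F) (c X Y : F) : F := fderiv ℝ (fderiv ℝ m) (c, c) (X, 0) (0, Y)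

variable {Φ : F × E → E} {m : F × F → F} {c : F} {y₀ : E}

lemma fundamentalField_eq_of_hasFDerivAt {y : E} {L : F →L[ℝ] E}
    (hΦ : DifferentiableAt ℝ Φ (c, y)) (hL : HasFDerivAt (fun α => Φ (α, y)) L c) (X : F) :
    fundamentalField Φ c X y = L X := by
  have h : HasFDerivAt (fun α => Φ (α, y)) _ c :=
    hΦ.hasFDerivAt.comp c (hasFDerivAt_prodMk_left c y)
  simpa [fundamentalField] using congrArg (fun L => L X) (h.unique hL)

lemma hasFDerivAt_fundamentalField {y : E} (hΦ : ContDiffAt ℝ 2 Φ (c, y)) (X : F) :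
    HasFDerivAt (fundamentalField Φ c X)
      (((fderiv ℝ (fderiv ℝ Φ) (c, y)).flip (X, 0)).comp (ContinuousLinearMap.inr ℝ F E)) y := by
  have h1 : HasFDerivAt (fderiv ℝ Φ) (fderiv ℝ (fderiv ℝ Φ) (c, y)) (c, y) :=
    ((hΦ.fderiv_right (m := 1) (by norm_num)).differentiableAt (by norm_num)).hasFDerivAt
  have h2 : HasFDerivAt (fun z : E => (c, z)) (ContinuousLinearMap.inr ℝ F E) y :=
    hasFDerivAt_prodMk_right c y
  have h3 := (h1.comp y h2).clm_apply (hasFDerivAt_const ((X, 0) : F × E) y)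
  refine h3.congr_fderiv ?_
  ext v
  simp

/-- The covariant derivatives of the fundamental vector fields. -/
def fundamentalCovDeriv (Φ : F × E → E) (c : F) (Q : E → E →L[ℝ] E →L[ℝ] ℝ) (y : E) :
    F →ₗ[ℝ] Module.End ℝ E :=
  LinearMap.mk₂ ℝ (fun (X : F) (v : E) => fderiv ℝ (fderiv ℝ Φ) (c, y) (0, v) (X, 0)
      + christoffelBilin Q y v (fderiv ℝ Φ (c, y) (X, 0)))
    (fun X X' v => by
      have e : ((X + X', 0) : F × E) = (X, 0) + (X', 0) := by simp
      rw [e]; simp only [map_add]; abel)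
    (fun a X v => by
      have e : ((a • X, 0) : F × E) = a • (X, 0) := by simp
      rw [e]; simp only [map_smul, smul_add])
    (fun X v v' => by
      have e : ((0, v + v') : F × E) = (0, v) + (0, v') := by simp
      rw [e]; simp only [map_add, _root_.add_apply, LinearMap.add_apply]; abel)
    (fun a X v => by
      have e : ((0, a • v) : F × E) = a • (0, v) := by simp
      rw [e]; simp only [map_smul, _root_.smul_apply, LinearMap.smul_apply, smul_add])

/-- Linearity in `X` is visible in the expression through the second derivative of `Φ`; this
identifies it with a covariant derivative. -/
lemma fundamentalCovDeriv_apply {y : E} (hΦ : ContDiffAt ℝ 2 Φ (c, y))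
    (Q : E → E →L[ℝ] E →L[ℝ] ℝ) (X : F) :
    fundamentalCovDeriv Φ c Q y X = covDeriv Q y (fundamentalField Φ c X) := by
  ext v
  rw [covDeriv_apply, (hasFDerivAt_fundamentalField hΦ X).fderiv]
  simp [fundamentalCovDeriv, fundamentalField]

lemma contDiffAt_fundamentalField (hΦ : ContDiffAt ℝ ∞ Φ (c, y₀)) (X : F) :
    ContDiffAt ℝ ∞ (fundamentalField Φ c X) y₀ := by
  have h1 : ContDiffAt ℝ ∞ (fderiv ℝ Φ) (c, y₀) := hΦ.fderiv_right (by simp)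
  exact (h1.comp y₀ (contDiffAt_const.prodMk contDiffAt_id)).clm_apply contDiffAt_const

/-- Differentiating `Φ (m (α, β)) y = Φ α (Φ β y)` in both variables at the neutral element. -/
lemma fundamentalField_mixedDeriv {y : E} (hΦ : ContDiffAt ℝ 2 Φ (c, y))
    (hm : ContDiffAt ℝ 2 m (c, c)) (hΦ1 : Φ (c, y) = y) (hm1 : ∀ᶠ α in 𝓝 c, m (α, c) = α)
    (hm2 : ∀ᶠ β in 𝓝 c, m (c, β) = β)
    (hass : ∀ᶠ q in 𝓝 (c, c), Φ (m q, y) = Φ (q.1, Φ (q.2, y))) (X Y : F) :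
    fderiv ℝ (fderiv ℝ Φ) (c, y) (X, 0) (Y, 0) + fundamentalField Φ c (mixedDeriv m c X Y) y
      = fderiv ℝ (fundamentalField Φ c X) y (fundamentalField Φ c Y y) := by
  have hc1 : Filter.Tendsto (fun α : F => (α, c)) (𝓝 c) (𝓝 (c, c)) := by
    have : Continuous (fun α : F => (α, c)) := by fun_prop
    exact this.tendsto c
  have hc2 : Filter.Tendsto (fun α : F => (α, y)) (𝓝 c) (𝓝 (c, y)) := by
    have : Continuous (fun α : F => (α, y)) := by fun_prop
    exact this.tendsto c
  -- The associativity law differentiated in the second factor at the neutral element, for all `α`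
  -- near `c`. Differentiating once more in `α` gives the claim.
  have key : ∀ᶠ α in 𝓝 c, fderiv ℝ Φ (α, y) (fderiv ℝ m (α, c) (0, Y), 0)
      = fderiv ℝ Φ (α, y) (0, fderiv ℝ Φ (c, y) (Y, 0)) := by
    filter_upwards [hc1.eventually (hm.eventually (by simp)),
      hc2.eventually (hΦ.eventually (by simp)), hm1, hc1.eventually hass.eventually_nhds]
      with α h1 h2 h3 h4
    have d1 : HasFDerivAt m (fderiv ℝ m (α, c)) (α, c) :=
      (h1.differentiableAt (by norm_num)).hasFDerivAt
    have d2 : HasFDerivAt Φ (fderiv ℝ Φ (α, y)) (α, y) :=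
      (h2.differentiableAt (by norm_num)).hasFDerivAt
    have d3 : HasFDerivAt Φ (fderiv ℝ Φ (c, y)) (c, y) :=
      (hΦ.differentiableAt (by norm_num)).hasFDerivAt
    have l1 : HasFDerivAt (fun β => m (α, β)) _ c := d1.comp c (hasFDerivAt_prodMk_right α c)
    have l2 : HasFDerivAt (fun β => (m (α, β), y)) _ c := l1.prodMk (hasFDerivAt_const y c)
    have d2' : HasFDerivAt Φ (fderiv ℝ Φ (α, y)) (m (α, c), y) := by rw [h3]; exact d2
    have l3 : HasFDerivAt (fun β => Φ (m (α, β), y)) _ c :=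
      HasFDerivAt.comp (g := Φ) (f := fun β => (m (α, β), y)) c d2' l2
    have r1 : HasFDerivAt (fun β => Φ (β, y)) _ c := d3.comp c (hasFDerivAt_prodMk_left c y)
    have r2 : HasFDerivAt (fun β => (α, Φ (β, y))) _ c := (hasFDerivAt_const α c).prodMk r1
    have d2'' : HasFDerivAt Φ (fderiv ℝ Φ (α, y)) (α, Φ (c, y)) := by rw [hΦ1]; exact d2
    have r3 : HasFDerivAt (fun β => Φ (α, Φ (β, y))) _ c :=
      HasFDerivAt.comp (g := Φ) (f := fun β => (α, Φ (β, y))) c d2'' r2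
    have hc3 : Filter.Tendsto (fun β : F => (α, β)) (𝓝 c) (𝓝 (α, c)) := by
      have : Continuous (fun β : F => (α, β)) := by fun_prop
      exact this.tendsto c
    have h5 := l3.unique (r3.congr_of_eventuallyEq (hc3.eventually h4))
    simpa using congrArg (fun L => L Y) h5
  have m1 : HasFDerivAt (fderiv ℝ m) (fderiv ℝ (fderiv ℝ m) (c, c)) (c, c) :=
    ((hm.fderiv_right (m := 1) (by norm_num)).differentiableAt (by norm_num)).hasFDerivAt
  have p1 : HasFDerivAt (fderiv ℝ Φ) (fderiv ℝ (fderiv ℝ Φ) (c, y)) (c, y) :=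
    ((hΦ.fderiv_right (m := 1) (by norm_num)).differentiableAt (by norm_num)).hasFDerivAt
  have m2 : HasFDerivAt (fun α => fderiv ℝ m (α, c) (0, Y)) _ c :=
    (HasFDerivAt.comp (g := fderiv ℝ m) (f := fun α => (α, c)) c m1
      (hasFDerivAt_prodMk_left c c)).clm_apply (hasFDerivAt_const ((0, Y) : F × F) c)
  have p2 : HasFDerivAt (fun α => fderiv ℝ Φ (α, y)) _ c :=
    p1.comp c (hasFDerivAt_prodMk_left c y)
  have l := p2.clm_apply (m2.prodMk (hasFDerivAt_const (0 : E) c))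
  have r := p2.clm_apply (hasFDerivAt_const ((0, fderiv ℝ Φ (c, y) (Y, 0)) : F × E) c)
  have h := congrArg (fun L => L X) (l.unique (r.congr_of_eventuallyEq key))
  have hY : fderiv ℝ m (c, c) (0, Y) = Y := by
    have d1 : HasFDerivAt m (fderiv ℝ m (c, c)) (c, c) :=
      (hm.differentiableAt (by norm_num)).hasFDerivAt
    have l1 : HasFDerivAt (fun β => m (c, β)) _ c := d1.comp c (hasFDerivAt_prodMk_right c c)
    simpa using congrArg (fun L => L Y) (l1.unique ((hasFDerivAt_id c).congr_of_eventuallyEq hm2))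
  simp [hY] at h
  have s : IsSymmSndFDerivAt ℝ Φ (c, y) := hΦ.isSymmSndFDerivAt (by simp)
  rw [(hasFDerivAt_fundamentalField hΦ X).fderiv]
  simp only [fundamentalField, mixedDeriv, ContinuousLinearMap.comp_apply,
    ContinuousLinearMap.inr_apply, ContinuousLinearMap.flip_apply]
  rw [s.eq (0, fderiv ℝ Φ (c, y) (Y, 0)), ← h]
  abel

/-- Fundamental vector fields of a left action form an anti-representation of the Lie algebra. -/
theorem fundamentalField_bracket (hΦ : ContDiffAt ℝ ∞ Φ (c, y₀))
    (hm : ContDiffAt ℝ ∞ m (c, c)) (hΦ1 : ∀ᶠ y in 𝓝 y₀, Φ (c, y) = y)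
    (hm1 : ∀ᶠ α in 𝓝 c, m (α, c) = α) (hm2 : ∀ᶠ β in 𝓝 c, m (c, β) = β)
    (hass : ∀ᶠ q in 𝓝 ((c, c), y₀), Φ (m q.1, q.2) = Φ (q.1.1, Φ (q.1.2, q.2))) (X Y : F) :
    ∀ᶠ y in 𝓝 y₀, fundamentalField Φ c (mixedDeriv m c X Y - mixedDeriv m c Y X) y
      = fderiv ℝ (fundamentalField Φ c X) y (fundamentalField Φ c Y y)
        - fderiv ℝ (fundamentalField Φ c Y) y (fundamentalField Φ c X y) := by
  have h2 : (2 : ℕ∞ω) ≤ ∞ := WithTop.coe_le_coe.2 (le_top : (2 : ℕ∞) ≤ ⊤)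
  have hc : Filter.Tendsto (fun y : E => (c, y)) (𝓝 y₀) (𝓝 (c, y₀)) := by
    have : Continuous (fun y : E => (c, y)) := by fun_prop
    exact this.tendsto y₀
  have hc' : Filter.Tendsto (fun y : E => ((c, c), y)) (𝓝 y₀) (𝓝 ((c, c), y₀)) := by
    have : Continuous (fun y : E => ((c, c), y)) := by fun_prop
    exact this.tendsto y₀
  filter_upwards [hc.eventually ((hΦ.of_le h2).eventually (by simp)), hΦ1,
    hc'.eventually hass.eventually_nhds] with y p1 p2 p3
  have hc3 : Filter.Tendsto (fun q : F × F => (q, y)) (𝓝 (c, c)) (𝓝 ((c, c), y)) := by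
    have : Continuous (fun q : F × F => (q, y)) := by fun_prop
    exact this.tendsto _
  have k := fundamentalField_mixedDeriv p1 (hm.of_le h2) p2 hm1 hm2 (hc3.eventually p3)
  have s : IsSymmSndFDerivAt ℝ Φ (c, y) := p1.isSymmSndFDerivAt (by simp)
  -- The pure group second derivatives of `Φ` cancel by symmetry, leaving only the antisymmetrized
  -- mixed derivative of `m`.
  rw [← k X Y, ← k Y X, s.eq (X, 0)]
  have : ((mixedDeriv m c X Y - mixedDeriv m c Y X, 0) : F × E)
      = (mixedDeriv m c X Y, 0) - (mixedDeriv m c Y X, 0) := by simp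
  simp only [fundamentalField, this, map_sub]
  abel

/-- Fundamental vector fields of an isometric action are Killing fields. -/
theorem isLocalKilling_fundamentalField {Q : E → E →L[ℝ] E →L[ℝ] ℝ}
    (hQ : ContDiffAt ℝ ∞ Q y₀) (hΦ : ContDiffAt ℝ ∞ Φ (c, y₀))
    (hΦ1 : ∀ᶠ y in 𝓝 y₀, Φ (c, y) = y)
    (hinv : ∀ᶠ q in 𝓝 (c, y₀), ∀ v w,
      Q (Φ q) (fderiv ℝ Φ q (0, v)) (fderiv ℝ Φ q (0, w)) = Q q.2 v w) (X : F) :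
    IsLocalKilling Q y₀ (fundamentalField Φ c X) := by
  refine ⟨contDiffAt_fundamentalField hΦ X, ?_⟩
  have h2 : (2 : ℕ∞ω) ≤ ∞ := WithTop.coe_le_coe.2 (le_top : (2 : ℕ∞) ≤ ⊤)
  have hc : Filter.Tendsto (fun y : E => (c, y)) (𝓝 y₀) (𝓝 (c, y₀)) := by
    have : Continuous (fun y : E => (c, y)) := by fun_prop
    exact this.tendsto y₀
  filter_upwards [hc.eventually ((hΦ.of_le h2).eventually (by simp)), hΦ1.eventually_nhds,
    hc.eventually hinv.eventually_nhds, (hQ.of_le h2).eventually (by simp)]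
    with y p1 p2 p3 p4 v w
  have hy := p2.self_of_nhds
  have hD : ∀ v, fderiv ℝ Φ (c, y) (0, v) = v := fun v => by
    have d : HasFDerivAt Φ (fderiv ℝ Φ (c, y)) (c, y) :=
      (p1.differentiableAt (by norm_num)).hasFDerivAt
    have l : HasFDerivAt (fun z => Φ (c, z)) _ y := d.comp y (hasFDerivAt_prodMk_right c y)
    simpa using congrArg (fun L => L v) (l.unique ((hasFDerivAt_id y).congr_of_eventuallyEq p2))
  have hc2 : Filter.Tendsto (fun α : F => (α, y)) (𝓝 c) (𝓝 (c, y)) := by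
    have : Continuous (fun α : F => (α, y)) := by fun_prop
    exact this.tendsto c
  have f1 : HasFDerivAt (fderiv ℝ Φ) (fderiv ℝ (fderiv ℝ Φ) (c, y)) (c, y) :=
    ((p1.fderiv_right (m := 1) (by norm_num)).differentiableAt (by norm_num)).hasFDerivAt
  have f0 : HasFDerivAt Φ (fderiv ℝ Φ (c, y)) (c, y) :=
    (p1.differentiableAt (by norm_num)).hasFDerivAt
  have q0 : HasFDerivAt Q (fderiv ℝ Q y) (Φ (c, y)) := by
    rw [hy]; exact (p4.differentiableAt (by norm_num)).hasFDerivAt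
  have g0 : HasFDerivAt (fun α => Φ (α, y)) _ c := f0.comp c (hasFDerivAt_prodMk_left c y)
  have g1 : ∀ v, HasFDerivAt (fun α => fderiv ℝ Φ (α, y) (0, v)) _ c := fun v =>
    (f1.comp c (hasFDerivAt_prodMk_left c y)).clm_apply (hasFDerivAt_const ((0, v) : F × E) c)
  have g2 : HasFDerivAt (fun α => Q (Φ (α, y))) _ c :=
    HasFDerivAt.comp (g := Q) (f := fun α => Φ (α, y)) c q0 g0
  -- The pull-back of `Q` by `Φ(α, ·)`, evaluated at `y` on `v` and `w`, does not depend on `α`; its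
  -- derivative at `c` is the Killing equation.
  have l := (g2.clm_apply (g1 v)).clm_apply (g1 w)
  have h := l.unique ((hasFDerivAt_const (Q y v w) c).congr_of_eventuallyEq
    ((hc2.eventually p3).mono fun α hα => hα v w))
  have h' := congrArg (fun L => L X) h
  have s : IsSymmSndFDerivAt ℝ Φ (c, y) := p1.isSymmSndFDerivAt (by simp)
  simp [hy, hD] at h'
  rw [(hasFDerivAt_fundamentalField p1 X).fderiv]
  simp only [fundamentalField, ContinuousLinearMap.comp_apply,
    ContinuousLinearMap.inr_apply, ContinuousLinearMap.flip_apply]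
  rw [s.eq, s.eq (0, w)]
  linarith

end LocalAction

/-! ### Tensor fields and maps read in a preferred chart. -/

section ChartExpressions
set_option maxSynthPendingDepth 3

variable {E : Type*} [NormedAddCommGroup E] [NormedSpace ℝ E]
  {M : Type*} [TopologicalSpace M] [ChartedSpace E M] [IsManifold 𝓘(ℝ, E) ∞ M]

lemma contMDiffAt_extChartAt_symm_of_mem {x : M} {y : E}
    (hy : y ∈ (extChartAt 𝓘(ℝ, E) x).target) :
    ContMDiffAt 𝓘(ℝ, E) 𝓘(ℝ, E) ∞ (extChartAt 𝓘(ℝ, E) x).symm y :=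
  (contMDiffOn_extChartAt_symm x).contMDiffAt (extChartAt_target_mem_nhds' hy)

/-- Smoothness of a section is smoothness in the trivialization at `o`. The inverse of the tangent
trivialization is the derivative of the inverse chart, so that expression is `inChart` in
coordinates. -/
lemma TwoTensorField.contDiffAt_inChart {γ : TwoTensorField E M} {o : M}
    (hγ : ContMDiffAt 𝓘(ℝ, E) (𝓘(ℝ, E).prod 𝓘(ℝ, E →L[ℝ] E →L[ℝ] ℝ)) ∞
    (fun x : M => Bundle.TotalSpace.mk' (E →L[ℝ] E →L[ℝ] ℝ)
      (E := fun x : M => TangentSpace 𝓘(ℝ, E) x →L[ℝ] TangentSpace 𝓘(ℝ, E) x →L[ℝ] ℝ)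
      x (γ x)) o) :
    ContDiffAt ℝ ∞ (γ.inChart o) (extChartAt 𝓘(ℝ, E) o o) := by
  rw [Bundle.contMDiffAt_section] at hγ
  have h1 : ContMDiffAt 𝓘(ℝ, E) 𝓘(ℝ, E) ∞ (extChartAt 𝓘(ℝ, E) o).symm (extChartAt 𝓘(ℝ, E) o o) :=
    contMDiffAt_extChartAt_symm_of_mem (mem_extChartAt_target o)
  have h2 := (ContMDiffAt.comp_of_eq (f := (extChartAt 𝓘(ℝ, E) o).symm) hγ h1
    (extChartAt_to_inv o)).contDiffAt
  refine h2.congr_of_eventuallyEq ?_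
  filter_upwards [extChartAt_target_mem_nhds (I := 𝓘(ℝ, E)) o] with y hy
  have hs : (extChartAt 𝓘(ℝ, E) o).symm y ∈ (chartAt E o).source := by
    rw [← extChartAt_source 𝓘(ℝ, E)]; exact (extChartAt 𝓘(ℝ, E) o).map_target hy
  ext v w
  have hb : (extChartAt 𝓘(ℝ, E) o).symm y ∈
      (trivializationAt (E →L[ℝ] ℝ) (fun x => TangentSpace 𝓘(ℝ, E) x →L[ℝ] ℝ) o).baseSet := by
    simpa using hs
  have h3 := TangentBundle.symmL_trivializationAt (I := 𝓘(ℝ, E)) hs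
  rw [(extChartAt 𝓘(ℝ, E) o).right_inv hy, modelWithCornersSelf_coe, Set.range_id,
    mfderivWithin_univ] at h3
  simp only [Function.comp_apply, hom_trivializationAt_apply, ContinuousLinearMap.inCoordinates,
    ContinuousLinearMap.comp_apply, Bundle.Trivialization.continuousLinearMapAt_apply,
    Bundle.Trivialization.linearMapAt_apply, if_pos hb, h3]
  rw [if_pos (by exact trivial)]
  rfl

/-- The tangent space at `o` is identified with `E` by this very chart. Hence values of tensors at
`o` need no change of coordinates. -/
lemma mfderiv_extChartAt_symm_self (o : M) :
   mfderiv 𝓘(ℝ, E) 𝓘(ℝ, E) (extChartAt 𝓘(ℝ, E) o).symm (extChartAt 𝓘(ℝ, E) o o)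
     = ContinuousLinearMap.id ℝ E := by
  have := mfderivWithin_range_extChartAt_symm (I := 𝓘(ℝ, E)) (x := o)
  rw [← mfderivWithin_univ]
  simpa using! this

-- Tangent spaces at all points are definitionally `E`, so the same vectors can be inserted at two
-- equal points.
omit [IsManifold 𝓘(ℝ, E) ∞ M] in
lemma TwoTensorField.congr_point (γ : TwoTensorField E M) {x x' : M} (h : x = x') (v w : E) :
    γ x v w = γ x' v w := by
  subst h; rfl

lemma TwoTensorField.inChart_self (γ : TwoTensorField E M) (o : M) (v w : E) :
    γ.inChart o (extChartAt 𝓘(ℝ, E) o o) v w = γ o v w := by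
  simp only [inChart, mfderiv_extChartAt_symm_self]
  have : (extChartAt 𝓘(ℝ, E) o).symm (extChartAt 𝓘(ℝ, E) o o) = o := extChartAt_to_inv o
  exact γ.congr_point this v w

variable {E' : Type*} [NormedAddCommGroup E'] [NormedSpace ℝ E']

lemma hasFDerivAt_comp_extChartAt_symm {f : M → E'} {o : M} {y : E}
    (hy : y ∈ (extChartAt 𝓘(ℝ, E) o).target)
    (hf : MDifferentiableAt 𝓘(ℝ, E) 𝓘(ℝ, E') f ((extChartAt 𝓘(ℝ, E) o).symm y)) :
    HasFDerivAt (f ∘ (extChartAt 𝓘(ℝ, E) o).symm)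
      ((mfderiv 𝓘(ℝ, E) 𝓘(ℝ, E') f ((extChartAt 𝓘(ℝ, E) o).symm y)).comp
        (mfderiv 𝓘(ℝ, E) 𝓘(ℝ, E) (extChartAt 𝓘(ℝ, E) o).symm y)) y := by
  have h := hf.hasMFDerivAt.comp y
    ((contMDiffAt_extChartAt_symm_of_mem hy).mdifferentiableAt (by simp)).hasMFDerivAt
  exact h.hasFDerivAt


lemma mfderiv_extChartAt_of_eq {o x : M} (h : x = o) (v : E) :
    mfderiv 𝓘(ℝ, E) 𝓘(ℝ, E) (extChartAt 𝓘(ℝ, E) o) x v = v := by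
  subst h
  rw [mfderiv_extChartAt_self]
  rfl

omit [IsManifold 𝓘(ℝ, E) ∞ M] in
lemma mfderiv_congr_point' {f : M → E'} {x x' : M} (h : x = x') (v : E) :
    (mfderiv 𝓘(ℝ, E) 𝓘(ℝ, E') f x v : E') = mfderiv 𝓘(ℝ, E) 𝓘(ℝ, E') f x' v := by
  subst h; rfl

lemma mfderiv_extChartAt_symm_apply_self (o : M) (v : E) :
    mfderiv 𝓘(ℝ, E) 𝓘(ℝ, E) (extChartAt 𝓘(ℝ, E) o).symm (extChartAt 𝓘(ℝ, E) o o) v = v := by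
  rw [mfderiv_extChartAt_symm_self]; rfl

/-- The derivative of a map in the preferred chart of the base point. -/
lemma hasFDerivAt_comp_extChartAt_symm_self {f : M → E'} {o : M}
    (hf : MDifferentiableAt 𝓘(ℝ, E) 𝓘(ℝ, E') f o) :
    HasFDerivAt (f ∘ (extChartAt 𝓘(ℝ, E) o).symm)
      (mfderiv 𝓘(ℝ, E) 𝓘(ℝ, E') f o : E →L[ℝ] E') (extChartAt 𝓘(ℝ, E) o o) := by
  have h := hasFDerivAt_comp_extChartAt_symm (f := f) (mem_extChartAt_target (I := 𝓘(ℝ, E)) o)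
    (by rwa [extChartAt_to_inv])
  refine h.congr_fderiv ?_
  ext v
  exact (congrArg (mfderiv 𝓘(ℝ, E) 𝓘(ℝ, E') f
    ((extChartAt 𝓘(ℝ, E) o).symm (extChartAt 𝓘(ℝ, E) o o)) : E →L[ℝ] E')
    (mfderiv_extChartAt_symm_apply_self o v)).trans
    (mfderiv_congr_point' (extChartAt_to_inv o) v)

end ChartExpressions

/-! ### The group law, the action and the Lie bracket in charts. -/

section ChartAction
set_option maxSynthPendingDepth 3

variable {F : Type*} [NormedAddCommGroup F] [NormedSpace ℝ F]
  {G : Type*} [TopologicalSpace G] [ChartedSpace F G] [Group G] [LieGroup 𝓘(ℝ, F) ∞ G]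
  {E : Type*} [NormedAddCommGroup E] [NormedSpace ℝ E]
  {M : Type*} [TopologicalSpace M] [ChartedSpace E M]
  [IsManifold 𝓘(ℝ, E) ∞ M]
  [MulAction G M] [ContMDiffSMul 𝓘(ℝ, F) 𝓘(ℝ, E) ∞ G M]

variable (F G) in
/-- The multiplication of `G` in the preferred chart at `1`. -/
def chartMul (q : F × F) : F :=
  extChartAt 𝓘(ℝ, F) (1 : G)
    ((extChartAt 𝓘(ℝ, F) (1 : G)).symm q.1 * (extChartAt 𝓘(ℝ, F) (1 : G)).symm q.2)

variable (F G) in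
/-- The coordinates of the neutral element. -/
def chartOne : F := extChartAt 𝓘(ℝ, F) (1 : G) 1

variable (F G E) in
/-- The action of `G` on `M` in the preferred charts at `1` and `o`. -/
def chartAct (o : M) (q : F × E) : E :=
  extChartAt 𝓘(ℝ, E) o
    ((extChartAt 𝓘(ℝ, F) (1 : G)).symm q.1 • (extChartAt 𝓘(ℝ, E) o).symm q.2)

omit [LieGroup 𝓘(ℝ, F) ∞ G] in
lemma extChartAt_symm_chartOne : (extChartAt 𝓘(ℝ, F) (1 : G)).symm (chartOne F G) = 1 :=
  extChartAt_to_inv 1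

lemma contMDiffAt_symm_mul_symm : ContMDiffAt 𝓘(ℝ, F × F) 𝓘(ℝ, F) ∞
    (fun q : F × F => (extChartAt 𝓘(ℝ, F) (1 : G)).symm q.1 *
      (extChartAt 𝓘(ℝ, F) (1 : G)).symm q.2) (chartOne F G, chartOne F G) := by
  have h : ContMDiffAt 𝓘(ℝ, F) 𝓘(ℝ, F) ∞ (extChartAt 𝓘(ℝ, F) (1 : G)).symm (chartOne F G) :=
    contMDiffAt_extChartAt_symm_of_mem (mem_extChartAt_target 1)
  exact (h.comp (chartOne F G, chartOne F G) (contDiff_fst.contMDiff.contMDiffAt)).mul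
    (h.comp (chartOne F G, chartOne F G) (contDiff_snd.contMDiff.contMDiffAt))

lemma contMDiffAt_symm_smul_symm (o : M) : ContMDiffAt 𝓘(ℝ, F × E) 𝓘(ℝ, E) ∞
    (fun q : F × E => (extChartAt 𝓘(ℝ, F) (1 : G)).symm q.1 •
      (extChartAt 𝓘(ℝ, E) o).symm q.2) (chartOne F G, extChartAt 𝓘(ℝ, E) o o) := by
  have h : ContMDiffAt 𝓘(ℝ, F) 𝓘(ℝ, F) ∞ (extChartAt 𝓘(ℝ, F) (1 : G)).symm (chartOne F G) :=
    contMDiffAt_extChartAt_symm_of_mem (mem_extChartAt_target 1)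
  have h' : ContMDiffAt 𝓘(ℝ, E) 𝓘(ℝ, E) ∞ (extChartAt 𝓘(ℝ, E) o).symm (extChartAt 𝓘(ℝ, E) o o) :=
    contMDiffAt_extChartAt_symm_of_mem (mem_extChartAt_target o)
  exact (h.comp (chartOne F G, extChartAt 𝓘(ℝ, E) o o) (contDiff_fst.contMDiff.contMDiffAt)).smul
    (h'.comp (chartOne F G, extChartAt 𝓘(ℝ, E) o o) (contDiff_snd.contMDiff.contMDiffAt))

lemma contDiffAt_chartMul : ContDiffAt ℝ ∞ (chartMul F G) (chartOne F G, chartOne F G) := by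
  have h := ContMDiffAt.comp_of_eq (contMDiffAt_extChartAt (x := (1 : G)) (I := 𝓘(ℝ, F)) (n := ∞))
    (contMDiffAt_symm_mul_symm (F := F) (G := G)) (by simp only [extChartAt_symm_chartOne, mul_one])
  exact h.contDiffAt

lemma contDiffAt_chartAct (o : M) :
    ContDiffAt ℝ ∞ (chartAct F G E o) (chartOne F G, extChartAt 𝓘(ℝ, E) o o) := by
  have h := ContMDiffAt.comp_of_eq (contMDiffAt_extChartAt (x := o) (I := 𝓘(ℝ, E)) (n := ∞))
    (contMDiffAt_symm_smul_symm (F := F) (G := G) o)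
    (by simp only [extChartAt_symm_chartOne, one_smul, extChartAt_to_inv])
  exact h.contDiffAt

lemma eventually_mul_mem_source : ∀ᶠ q in 𝓝 (chartOne F G, chartOne F G),
    (extChartAt 𝓘(ℝ, F) (1 : G)).symm q.1 * (extChartAt 𝓘(ℝ, F) (1 : G)).symm q.2
      ∈ (extChartAt 𝓘(ℝ, F) (1 : G)).source := by
  have h := (contMDiffAt_symm_mul_symm (F := F) (G := G)).continuousAt
  refine h.eventually_mem ?_
  simp only [extChartAt_symm_chartOne, one_mul]
  exact extChartAt_source_mem_nhds 1

lemma eventually_smul_mem_source (o : M) :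
    ∀ᶠ q in 𝓝 (chartOne F G, extChartAt 𝓘(ℝ, E) o o),
    (extChartAt 𝓘(ℝ, F) (1 : G)).symm q.1 • (extChartAt 𝓘(ℝ, E) o).symm q.2
      ∈ (extChartAt 𝓘(ℝ, E) o).source := by
  have h := (contMDiffAt_symm_smul_symm (F := F) (G := G) (E := E) o).continuousAt
  refine h.eventually_mem ?_
  simp only [extChartAt_symm_chartOne, one_smul, extChartAt_to_inv]
  exact extChartAt_source_mem_nhds o

omit [LieGroup 𝓘(ℝ, F) ∞ G] in
lemma eventually_chartMul_one : ∀ᶠ α in 𝓝 (chartOne F G),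
    chartMul F G (α, chartOne F G) = α := by
  filter_upwards [extChartAt_target_mem_nhds (I := 𝓘(ℝ, F)) (1 : G)] with α hα
  simp only [chartMul, extChartAt_symm_chartOne, mul_one]
  exact (extChartAt 𝓘(ℝ, F) (1 : G)).right_inv hα

omit [LieGroup 𝓘(ℝ, F) ∞ G] in
lemma eventually_one_chartMul : ∀ᶠ α in 𝓝 (chartOne F G),
    chartMul F G (chartOne F G, α) = α := by
  filter_upwards [extChartAt_target_mem_nhds (I := 𝓘(ℝ, F)) (1 : G)] with α hα
  simp only [chartMul, extChartAt_symm_chartOne, one_mul]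
  exact (extChartAt 𝓘(ℝ, F) (1 : G)).right_inv hα

omit [LieGroup 𝓘(ℝ, F) ∞ G] [IsManifold 𝓘(ℝ, E) ∞ M] [ContMDiffSMul 𝓘(ℝ, F) 𝓘(ℝ, E) ∞ G M] in
lemma eventually_chartAct_one (o : M) : ∀ᶠ y in 𝓝 (extChartAt 𝓘(ℝ, E) o o),
    chartAct F G E o (chartOne F G, y) = y := by
  filter_upwards [extChartAt_target_mem_nhds (I := 𝓘(ℝ, E)) o] with α hα
  simp only [chartAct, extChartAt_symm_chartOne, one_smul]
  exact (extChartAt 𝓘(ℝ, E) o).right_inv hα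

/-- Close to the base point the intermediate products stay in the chart domains, so charts and their
inverses cancel and `mul_smul` remains. -/
lemma eventually_chartAct_assoc (o : M) :
    ∀ᶠ q in 𝓝 ((chartOne F G, chartOne F G), extChartAt 𝓘(ℝ, E) o o),
      chartAct F G E o (chartMul F G q.1, q.2)
        = chartAct F G E o (q.1.1, chartAct F G E o (q.1.2, q.2)) := by
  have h1 : Filter.Tendsto (fun q : (F × F) × E => q.1)
      (𝓝 ((chartOne F G, chartOne F G), extChartAt 𝓘(ℝ, E) o o))
      (𝓝 (chartOne F G, chartOne F G)) := continuous_fst.tendsto _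
  have h2 : Filter.Tendsto (fun q : (F × F) × E => (q.1.2, q.2))
      (𝓝 ((chartOne F G, chartOne F G), extChartAt 𝓘(ℝ, E) o o))
      (𝓝 (chartOne F G, extChartAt 𝓘(ℝ, E) o o)) := by
    have : Continuous (fun q : (F × F) × E => (q.1.2, q.2)) := by fun_prop
    exact this.tendsto _
  filter_upwards [h1.eventually (eventually_mul_mem_source (F := F) (G := G)),
    h2.eventually (eventually_smul_mem_source o)] with q q1 q2
  simp only [chartAct, chartMul]
  rw [(extChartAt 𝓘(ℝ, F) (1 : G)).left_inv q1, (extChartAt 𝓘(ℝ, E) o).left_inv q2, mul_smul]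

/-- The derivative of the orbit map is given by the fundamental vector fields. -/
lemma orbitDeriv_eq_fundamentalField (o : M) (X : GroupLieAlgebra 𝓘(ℝ, F) G) :
    orbitDeriv F G E o X
      = fundamentalField (chartAct F G E o) (chartOne F G) X (extChartAt 𝓘(ℝ, E) o o) := by
  have h1 : ContMDiffAt 𝓘(ℝ, F) 𝓘(ℝ, E) ∞ (fun a : G => a • o) 1 :=
    ContMDiffAt.smul (I := 𝓘(ℝ, F)) (I' := 𝓘(ℝ, E)) contMDiffAt_id contMDiffAt_const
  let L₀ : F →L[ℝ] E := mfderiv 𝓘(ℝ, F) 𝓘(ℝ, E) (fun a : G => a • o) (1 : G)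
  have h2 : HasFDerivAt (writtenInExtChartAt 𝓘(ℝ, F) 𝓘(ℝ, E) (1 : G) (fun a : G => a • o))
      L₀ (chartOne F G) := by
    rw [← hasFDerivWithinAt_univ, ← Set.range_id]
    exact (h1.mdifferentiableAt (by simp)).hasMFDerivAt.2
  have h3 : writtenInExtChartAt 𝓘(ℝ, F) 𝓘(ℝ, E) (1 : G) (fun a : G => a • o)
      = fun α => chartAct F G E o (α, extChartAt 𝓘(ℝ, E) o o) := by
    ext α
    simp only [writtenInExtChartAt, Function.comp_apply, chartAct, extChartAt_to_inv, one_smul]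
  rw [h3] at h2
  exact (fundamentalField_eq_of_hasFDerivAt
    ((contDiffAt_chartAct (F := F) (G := G) o).differentiableAt (by simp)) h2 X).symm

/-- Invariance of a metric in the preferred chart. -/
lemma TwoTensorField.inChart_invariant {γ : TwoTensorField E M}
    (hγ : ∀ (a : G) (x : M) (v w : TangentSpace 𝓘(ℝ, E) x),
    γ (a • x) (mfderiv 𝓘(ℝ, E) 𝓘(ℝ, E) (fun z : M => a • z) x v)
      (mfderiv 𝓘(ℝ, E) 𝓘(ℝ, E) (fun z : M => a • z) x w) = γ x v w) (o : M) :
    ∀ᶠ q in 𝓝 (chartOne F G, extChartAt 𝓘(ℝ, E) o o), ∀ v w,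
      γ.inChart o (chartAct F G E o q) (fderiv ℝ (chartAct F G E o) q (0, v))
        (fderiv ℝ (chartAct F G E o) q (0, w)) = γ.inChart o q.2 v w := by
  have ht : ∀ᶠ q : F × E in 𝓝 (chartOne F G, extChartAt 𝓘(ℝ, E) o o),
      q.2 ∈ (extChartAt 𝓘(ℝ, E) o).target :=
    continuous_snd.continuousAt.eventually_mem (extChartAt_target_mem_nhds (I := 𝓘(ℝ, E)) o)
  have h2 : (2 : ℕ∞ω) ≤ ∞ := WithTop.coe_le_coe.2 (le_top : (2 : ℕ∞) ≤ ⊤)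
  filter_upwards [(eventually_smul_mem_source (F := F) (G := G) o).eventually_nhds, ht,
    ((contDiffAt_chartAct (F := F) (G := G) o).of_le h2).eventually (by simp)]
  rintro ⟨α, y⟩ q1 q2 q3
  have hs := q1.self_of_nhds
  simp only at hs q2 ⊢
  set a := (extChartAt 𝓘(ℝ, F) (1 : G)).symm α with ha
  set x := (extChartAt 𝓘(ℝ, E) o).symm y with hx
  have hu : HasFDerivAt (fun z => chartAct F G E o (α, z))
      ((fderiv ℝ (chartAct F G E o) (α, y)).comp (ContinuousLinearMap.inr ℝ F E)) y :=
    (q3.differentiableAt (by simp)).hasFDerivAt.comp y (hasFDerivAt_prodMk_right α y)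
  have hsy : (extChartAt 𝓘(ℝ, E) o).symm (chartAct F G E o (α, y)) = a • x :=
    (extChartAt 𝓘(ℝ, E) o).left_inv hs
  have hty : chartAct F G E o (α, y) ∈ (extChartAt 𝓘(ℝ, E) o).target :=
    (extChartAt 𝓘(ℝ, E) o).map_source hs
  have e1 :=
    ((contMDiffAt_extChartAt_symm_of_mem hty).mdifferentiableAt (by simp)).hasMFDerivAt.comp
    y hu.hasMFDerivAt
  have ax : ContMDiffAt 𝓘(ℝ, E) 𝓘(ℝ, E) ∞ (fun z : M => a • z) x :=
    ContMDiffAt.smul (I := 𝓘(ℝ, F)) (I' := 𝓘(ℝ, E)) contMDiffAt_const contMDiffAt_id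
  have e2 := (ax.mdifferentiableAt (by simp)).hasMFDerivAt.comp y
    ((contMDiffAt_extChartAt_symm_of_mem q2).mdifferentiableAt (by simp)).hasMFDerivAt
  have hc : Filter.Tendsto (fun z : E => (α, z)) (𝓝 y) (𝓝 (α, y)) := by
    have : Continuous (fun z : E => (α, z)) := by fun_prop
    exact this.tendsto y
  -- The inverse chart after the coordinate action and the action by `a` after the inverse chart
  -- agree near `y`, hence so do their derivatives.
  have e3 := e1.congr_of_eventuallyEq (f₁ := (fun z : M => a • z) ∘ (extChartAt 𝓘(ℝ, E) o).symm) (by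
    filter_upwards [hc.eventually q1] with z hz
    exact ((extChartAt 𝓘(ℝ, E) o).left_inv hz).symm)
  have e4 := hasMFDerivAt_unique e3 e2
  intro v w
  have k : ∀ v : E, (mfderiv 𝓘(ℝ, E) 𝓘(ℝ, E) (extChartAt 𝓘(ℝ, E) o).symm
      (chartAct F G E o (α, y)) (fderiv ℝ (chartAct F G E o) (α, y) (0, v)) : E)
      = mfderiv 𝓘(ℝ, E) 𝓘(ℝ, E) (fun z : M => a • z) x
        (mfderiv 𝓘(ℝ, E) 𝓘(ℝ, E) (extChartAt 𝓘(ℝ, E) o).symm y v) := fun v => by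
    exact congrArg (fun L : E →L[ℝ] E => L v) e4
  refine Eq.trans ?_ (hγ a x (mfderiv 𝓘(ℝ, E) 𝓘(ℝ, E) (extChartAt 𝓘(ℝ, E) o).symm y v)
    (mfderiv 𝓘(ℝ, E) 𝓘(ℝ, E) (extChartAt 𝓘(ℝ, E) o).symm y w))
  refine Eq.trans ?_ (γ.congr_point hsy _ _)
  rw [← k v, ← k w]
  rfl

lemma hasFDerivAt_fderiv_chartMul (Y : F) :
    HasFDerivAt (fun α => fderiv ℝ (chartMul F G) (α, chartOne F G) (0, Y))
      (((fderiv ℝ (fderiv ℝ (chartMul F G)) (chartOne F G, chartOne F G)).comp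
        (ContinuousLinearMap.inl ℝ F F)).flip (0, Y)) (chartOne F G) := by
  have m1 := (contDiffAt_chartMul (F := F) (G := G)).hasFDerivAt_fderiv
  have m2 := (HasFDerivAt.comp (g := fderiv ℝ (chartMul F G)) (f := fun α => (α, chartOne F G))
      (chartOne F G) m1 (hasFDerivAt_prodMk_left (chartOne F G) (chartOne F G))).clm_apply
      (hasFDerivAt_const ((0, Y) : F × F) (chartOne F G))
  refine m2.congr_fderiv ?_
  ext v
  simp

/-- Left invariant vector fields in the preferred chart at `1`. -/
lemma eventually_mpullbackWithin_mulInvariantVectorField (X : GroupLieAlgebra 𝓘(ℝ, F) G) :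
    ∀ᶠ α in 𝓝 (chartOne F G),
      VectorField.mpullbackWithin 𝓘(ℝ, F) 𝓘(ℝ, F) (extChartAt 𝓘(ℝ, F) (1 : G)).symm
        (mulInvariantVectorField X) (Set.range 𝓘(ℝ, F)) α
        = fderiv ℝ (chartMul F G) (α, chartOne F G) (0, X) := by
  have h2 : (2 : ℕ∞ω) ≤ ∞ := WithTop.coe_le_coe.2 (le_top : (2 : ℕ∞) ≤ ⊤)
  have hc1 : Filter.Tendsto (fun α : F => (α, chartOne F G)) (𝓝 (chartOne F G))
      (𝓝 (chartOne F G, chartOne F G)) := by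
    have : Continuous (fun α : F => (α, chartOne F G)) := by fun_prop
    exact this.tendsto _
  filter_upwards [extChartAt_target_mem_nhds (I := 𝓘(ℝ, F)) (1 : G),
    hc1.eventually (((contDiffAt_chartMul (F := F) (G := G)).of_le h2).eventually (by simp))]
    with α hα h3
  set a := (extChartAt 𝓘(ℝ, F) (1 : G)).symm α with ha
  have has : a ∈ (extChartAt 𝓘(ℝ, F) (1 : G)).source := (extChartAt 𝓘(ℝ, F) (1 : G)).map_target hα
  have inv := ContinuousLinearMap.inverse_eq
    (mfderivWithin_extChartAt_symm_comp_mfderiv_extChartAt (I := 𝓘(ℝ, F)) hα)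
    (mfderiv_extChartAt_comp_mfderivWithin_extChartAt_symm (I := 𝓘(ℝ, F)) hα)
  rw [VectorField.mpullbackWithin_apply, inv]
  have l1 : ContMDiffAt 𝓘(ℝ, F) 𝓘(ℝ, F) ∞ (fun b : G => a * b) 1 := contMDiff_mul_left.contMDiffAt
  have l2 : ContMDiffAt 𝓘(ℝ, F) 𝓘(ℝ, F) ∞ (extChartAt 𝓘(ℝ, F) (1 : G)) (a * 1) := by
    rw [mul_one]
    exact contMDiffAt_extChartAt' (by rwa [← extChartAt_source 𝓘(ℝ, F)])
  have l3 := mfderiv_comp (1 : G) (l2.mdifferentiableAt (by simp)) (l1.mdifferentiableAt (by simp))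
  have l4 := hasFDerivAt_comp_extChartAt_symm_self
    ((l2.comp (1 : G) l1).mdifferentiableAt (by simp))
  have l5 : HasFDerivAt (fun β => chartMul F G (α, β)) _ (chartOne F G) := l4
  have l6 : HasFDerivAt (fun β => chartMul F G (α, β)) _ (chartOne F G) :=
    HasFDerivAt.comp (g := chartMul F G) (f := fun β => (α, β)) (chartOne F G)
      (h3.differentiableAt (by simp)).hasFDerivAt (hasFDerivAt_prodMk_right α (chartOne F G))
  have l7 := congrArg (fun L : F →L[ℝ] F => L X) (l6.unique l5)
  refine Eq.trans ?_ l7.symm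
  have l8 := congrArg (fun L : F →L[ℝ] F => L X) l3
  refine Eq.trans ?_ l8.symm
  exact (mfderiv_congr_point' (f := extChartAt 𝓘(ℝ, F) (1 : G)) (mul_one a) _).symm

/-- The Lie bracket in terms of the second derivative of the multiplication. -/
lemma bracket_eq_mixedDeriv (X Y : GroupLieAlgebra 𝓘(ℝ, F) G) :
    (⁅X, Y⁆ : GroupLieAlgebra 𝓘(ℝ, F) G)
      = mixedDeriv (chartMul F G) (chartOne F G) X Y
        - mixedDeriv (chartMul F G) (chartOne F G) Y X := by
  have hV := eventually_mpullbackWithin_mulInvariantVectorField X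
  have hW := eventually_mpullbackWithin_mulInvariantVectorField Y
  have e : ∀ X : F, fderiv ℝ (chartMul F G) (chartOne F G, chartOne F G) (0, X) = X := by
    intro X
    have l6 : HasFDerivAt (fun β => chartMul F G (chartOne F G, β)) _ (chartOne F G) :=
      HasFDerivAt.comp (g := chartMul F G) (f := fun β => (chartOne F G, β)) (chartOne F G)
      (contDiffAt_chartMul (F := F) (G := G)).hasFDerivAt_of_infty
      (hasFDerivAt_prodMk_right (chartOne F G) (chartOne F G))
    simpa using congrArg (fun L => L X) (l6.unique ((hasFDerivAt_id _).congr_of_eventuallyEq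
      (eventually_one_chartMul (F := F) (G := G))))
  rw [GroupLieAlgebra.bracket_def, ← VectorField.mlieBracketWithin_univ,
    VectorField.mlieBracketWithin_apply, mfderiv_extChartAt_self]
  -- The bracket depends only on germs of vector fields, so the pulled back invariant fields may be
  -- replaced by their coordinate formula.
  have key : ∀ (X Y : F) (V W : F → F), V =ᶠ[𝓝 (chartOne F G)]
        (fun α => fderiv ℝ (chartMul F G) (α, chartOne F G) (0, X)) →
      W =ᶠ[𝓝 (chartOne F G)] (fun α => fderiv ℝ (chartMul F G) (α, chartOne F G) (0, Y)) →
      VectorField.lieBracketWithin ℝ V W ((extChartAt 𝓘(ℝ, F) (1 : G)).symm ⁻¹' Set.univ ∩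
        Set.range 𝓘(ℝ, F)) (chartOne F G) = mixedDeriv (chartMul F G) (chartOne F G) X Y
        - mixedDeriv (chartMul F G) (chartOne F G) Y X := by
    intro X Y V W hV hW
    have hV0 : V (chartOne F G) = X := hV.self_of_nhds.trans (e X)
    have hW0 : W (chartOne F G) = Y := hW.self_of_nhds.trans (e Y)
    rw [Set.preimage_univ, Set.univ_inter, modelWithCornersSelf_coe, Set.range_id,
      VectorField.lieBracketWithin_univ, VectorField.lieBracket_eq]
    simp only
    rw [hV.fderiv_eq, hW.fderiv_eq, hV0, hW0,
      (hasFDerivAt_fderiv_chartMul Y).fderiv, (hasFDerivAt_fderiv_chartMul X).fderiv]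
    simp [mixedDeriv]
  have hid : ∀ w : F, (ContinuousLinearMap.id ℝ F).inverse w = w := fun w => by simp
  exact (hid _).trans (key X Y _ _ hV hW)

end ChartAction

/-! ### Ricci curvature from the Nomizu map of a unimodular Lie algebra. -/

section Nomizu

variable {L : Type*} [LieRing L] [LieAlgebra ℝ L] {V : Type*} [AddCommGroup V] [Module ℝ V]

/-- `N` is the Nomizu map of a metric, torsion free connection on a homogeneous space with
infinitesimal action `φ` at the base point. -/
structure IsNomizuMap (β : LinearMap.BilinForm ℝ V) (φ : L →ₗ[ℝ] V)
    (N : L →ₗ[ℝ] Module.End ℝ V) : Prop where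
  skew : ∀ X u v, β (N X u) v = -β u (N X v)
  lie : ∀ X Y, φ ⁅X, Y⁆ = N X (φ Y) - N Y (φ X)

/-- The curvature in terms of the Nomizu map. -/
def nomizuCurv (N : L →ₗ[ℝ] Module.End ℝ V) (X Y : L) : Module.End ℝ V :=
  N X * N Y - N Y * N X - N ⁅X, Y⁆

/-- The curvature as a bilinear map. -/
def nomizuCurvBilin (N : L →ₗ[ℝ] Module.End ℝ V) : L →ₗ[ℝ] L →ₗ[ℝ] Module.End ℝ V :=
  LinearMap.mk₂ ℝ (nomizuCurv N)
    (fun X X' Y => by simp only [nomizuCurv, map_add, add_lie, add_mul, mul_add]; abel)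
    (fun c X Y => by
      simp only [nomizuCurv, map_smul, smul_lie, smul_mul_assoc, mul_smul_comm, smul_sub])
    (fun X Y Y' => by simp only [nomizuCurv, map_add, lie_add, add_mul, mul_add]; abel)
    (fun c X Y => by
      simp only [nomizuCurv, map_smul, lie_smul, smul_mul_assoc, mul_smul_comm, smul_sub])

variable {β : LinearMap.BilinForm ℝ V} {φ : L →ₗ[ℝ] V} {N : L →ₗ[ℝ] Module.End ℝ V}
  {p : Submodule ℝ L} {ι : Type*} [Fintype ι] [DecidableEq ι] (f : Module.Basis ι ℝ p)

omit [Fintype ι] [DecidableEq ι] in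
lemma image_projectionOnto (hc : IsCompl p (LinearMap.ker φ)) (v : L) :
    φ (p.projectionOnto _ hc v : L) = φ v := by
  have h := Submodule.projection_add_projection_eq_self hc v
  have h0 : φ ((LinearMap.ker φ).projection p hc.symm v) = 0 := by
    rw [← Submodule.coe_projectionOnto_apply]
    exact ((LinearMap.ker φ).projectionOnto p hc.symm v).2
  conv_rhs => rw [← h, map_add, h0, add_zero]
  rw [Submodule.coe_projectionOnto_apply]

lemma Module.Basis.coe_sum_repr {κ : Type*} [Fintype κ] {s : Submodule ℝ L}
    (b : Module.Basis κ ℝ s) (y : s) : (y : L) = ∑ i, b.repr y i • (b i : L) := by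
  have := congrArg (Submodule.subtype s) (b.sum_repr y)
  rw [map_sum] at this
  simpa only [map_smul, Submodule.subtype_apply] using this.symm

lemma repr_projectionOnto (hc : IsCompl p (LinearMap.ker φ))
    (hf : ∀ i j, β (φ (f i)) (φ (f j)) = if i = j then 1 else 0) (v : L) (i : ι) :
    f.repr (p.projectionOnto _ hc v) i = β (φ (f i)) (φ v) := by
  rw [← image_projectionOnto hc v, f.coe_sum_repr (p.projectionOnto _ hc v)]
  simp [hf]

lemma basis_image_expand (hc : IsCompl p (LinearMap.ker φ))
    (hf : ∀ i j, β (φ (f i)) (φ (f j)) = if i = j then 1 else 0) (v : L) :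
    φ v = ∑ i, β (φ (f i)) (φ v) • φ (f i) := by
  conv_lhs => rw [← image_projectionOnto hc v, f.coe_sum_repr (p.projectionOnto _ hc v)]
  simp only [map_sum, map_smul, repr_projectionOnto f hc hf]

/-- Traces of `ad x` and `(ad x)²` for `x ∈ 𝔭`. -/
lemma trace_ad_complement [FiniteDimensional ℝ L] (hc : IsCompl p (LinearMap.ker φ))
    (hred : ∀ Z ∈ LinearMap.ker φ, ∀ X ∈ p, ⁅Z, X⁆ ∈ p)
    (hf : ∀ i j, β (φ (f i)) (φ (f j)) = if i = j then 1 else 0) (x : p) :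
    LinearMap.trace ℝ L (LieAlgebra.ad ℝ L x) = ∑ i, β (φ (f i)) (φ ⁅(x : L), (f i : L)⁆) ∧
    killingForm ℝ L x x
      = ∑ i, ∑ j, β (φ (f i)) (φ ⁅(x : L), (f j : L)⁆) * β (φ (f j)) (φ ⁅(x : L), (f i : L)⁆)
        + 2 * ∑ i, β (φ (f i)) (φ ⁅(x : L),
          ((LinearMap.ker φ).projectionOnto p hc.symm ⁅(x : L), (f i : L)⁆ : L)⁆) := by
  let k := LinearMap.ker φ
  let b' := Module.finBasis ℝ k
  let e := Submodule.prodEquivOfIsCompl p k hc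
  let b := (f.prod b').map e
  have hbl : ∀ i, b (Sum.inl i) = f i := fun i => by simp [b, e]
  have hbr : ∀ i, b (Sum.inr i) = b' i := fun i => by simp [b, e]
  have hcl : ∀ v i, b.repr v (Sum.inl i) = β (φ (f i)) (φ v) := fun v i => by
    rw [← repr_projectionOnto f hc hf]
    simp [b, e, Submodule.prodEquivOfIsCompl_symm_apply, k]
  have hcr : ∀ v i, b.repr v (Sum.inr i) = b'.repr (k.projectionOnto _ hc.symm v) i := fun v i => by
    simp [b, e, Submodule.prodEquivOfIsCompl_symm_apply, k]
  -- By reductivity `ad x` maps `𝔨` into `𝔭`, so its `𝔨`-`𝔨` block vanishes. The two mixed products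
  -- of blocks have equal trace, whence the factor 2 in the Killing form.
  have hD : ∀ i j, b.repr ⁅(x : L), (b' j : L)⁆ (Sum.inr i) = 0 := fun i j => by
    have : ⁅(x : L), (b' j : L)⁆ ∈ p := by
      rw [← lie_skew]
      exact p.neg_mem (hred _ (b' j).2 _ x.2)
    rw [hcr, (Submodule.projectionOnto_apply_eq_zero_iff hc.symm).2 this]
    simp
  have hmul : ∀ (i : ι), ∑ l, b.repr ⁅(x : L), (b' l : L)⁆ (Sum.inl i)
      * b.repr ⁅(x : L), (f i : L)⁆ (Sum.inr l)
      = β (φ (f i)) (φ ⁅(x : L), (k.projectionOnto p hc.symm ⁅(x : L), (f i : L)⁆ : L)⁆) :=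
      fun i => by
    rw [b'.coe_sum_repr (k.projectionOnto p hc.symm ⁅(x : L), (f i : L)⁆)]
    simp only [lie_sum, lie_smul, map_sum, map_smul, hcl, hcr, smul_eq_mul]
    exact Finset.sum_congr rfl fun l _ => mul_comm _ _
  constructor
  · rw [LinearMap.trace_eq_matrix_trace ℝ b, Matrix.trace]
    simp only [Fintype.sum_sum_type, Matrix.diag_apply, LinearMap.toMatrix_apply, hbl, hbr,
      LieAlgebra.ad_apply, hD, hcl]
    simp
  · rw [killingForm_apply_apply, LinearMap.trace_eq_matrix_trace ℝ b, LinearMap.toMatrix_comp b b b,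
      Matrix.trace]
    simp only [Fintype.sum_sum_type, Matrix.diag_apply, LinearMap.toMatrix_apply, hbl, hbr,
      LieAlgebra.ad_apply, hD, Matrix.mul_apply]
    rw [Finset.sum_add_distrib, two_mul]
    simp only [hmul, mul_zero, Finset.sum_const_zero, add_zero]
    rw [add_assoc]
    congr 1
    · simp only [hcl]
    · congr 1
      rw [Finset.sum_comm]
      refine Finset.sum_congr rfl fun i _ => ?_
      rw [← hmul]
      exact Finset.sum_congr rfl fun l _ => mul_comm _ _

-- The matrix content of the Ricci formula: `n` will be the skew matrix of `N x` and `ε` that of `f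
-- ↦ N f (φ x)`. Then `n - ε` is `ad x` compressed to `𝔭`, and `ε - εᵗ` has entries `⟨[f i, f j],
-- x⟩`.
omit [DecidableEq ι] in
lemma trace_skew_identity (n ε : Matrix ι ι ℝ) (hn : n.transpose = -n) :
    -(n * ε).trace + (ε * (n - ε)).trace
      = -(1 / 2 : ℝ) * ((n - ε) * (n - ε)).trace
        - (1 / 2 : ℝ) * ((n - ε) * (n - ε).transpose).trace
        + (1 / 4 : ℝ) * ((ε - ε.transpose) * (ε - ε.transpose).transpose).trace := by
  have h1 : (n * ε.transpose).trace = -(n * ε).trace := by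
    rw [← Matrix.trace_transpose, Matrix.transpose_mul, Matrix.transpose_transpose, hn,
      mul_neg, Matrix.trace_neg, Matrix.trace_mul_comm]
  have h2 : (ε.transpose * ε.transpose).trace = (ε * ε).trace := by
    rw [← Matrix.transpose_mul, Matrix.trace_transpose]
  simp only [Matrix.transpose_sub, Matrix.transpose_transpose, hn, mul_sub, sub_mul, mul_neg,
    neg_mul, Matrix.trace_sub, Matrix.trace_neg, h1, h2, Matrix.trace_mul_comm ε n,
    Matrix.trace_mul_comm ε.transpose ε]
  ring

/-- The Ricci curvature of an invariant metric on a homogeneous space of a unimodular Lie group. -/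
theorem nomizu_ricci [FiniteDimensional ℝ L] (hN : IsNomizuMap β φ N) (hβ : ∀ u v, β u v = β v u)
    (hφ : Function.Surjective φ)
    (hunim : ∀ X : L, LinearMap.trace ℝ L (LieAlgebra.ad ℝ L X) = 0)
    (hc : IsCompl p (LinearMap.ker φ))
    (hred : ∀ Z ∈ LinearMap.ker φ, ∀ X ∈ p, ⁅Z, X⁆ ∈ p)
    (hf : ∀ i j, β (φ (f i)) (φ (f j)) = if i = j then 1 else 0) (x : p) :
    ∑ i, β (φ (f i)) (nomizuCurv N (f i) x (φ x))
      = -(1 / 2 : ℝ) * killingForm ℝ L x x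
        - (1 / 2 : ℝ) * ∑ i, ∑ j, β (φ (f i)) (φ ⁅(x : L), (f j : L)⁆) ^ 2
        + (1 / 4 : ℝ) * ∑ i, ∑ j, β (φ ⁅(f i : L), (f j : L)⁆) (φ x) ^ 2 := by
  have hexp : ∀ u : V, u = ∑ i, β (φ (f i)) u • φ (f i) := fun u => by
    obtain ⟨v, rfl⟩ := hφ u
    exact basis_image_expand f hc hf v
  let n : Matrix ι ι ℝ := Matrix.of fun i j => β (φ (f i)) (N x (φ (f j)))
  let ε : Matrix ι ι ℝ := Matrix.of fun i j => β (φ (f i)) (N (f j) (φ x))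
  have hn : n.transpose = -n := by
    ext i j
    simp only [n, Matrix.transpose_apply, Matrix.of_apply, Matrix.neg_apply]
    rw [hβ, hN.skew]
  have ha : ∀ i j, β (φ (f i)) (φ ⁅(x : L), (f j : L)⁆) = (n - ε) i j := fun i j => by
    rw [hN.lie]; simp [n, ε]
  have hJ : ∀ i j, β (φ ⁅(f i : L), (f j : L)⁆) (φ x) = (ε - ε.transpose) i j := fun i j => by
    rw [hN.lie, map_sub, LinearMap.sub_apply, hN.skew, hN.skew]
    simp [ε]; ring
  -- Here unimodularity enters: writing `u = φ z`, the sum is `-tr(ad z)`, because the skew operator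
  -- `N z` contributes no trace.
  have hdiv : ∀ u : V, ∑ i, β (φ (f i)) (N (f i) u) = 0 := fun u => by
    let z : p := ∑ i, β (φ (f i)) u • f i
    have hz : u = φ z := by
      conv_lhs => rw [hexp u]
      simp [z]
    have hskew : ∀ i, β (φ (f i)) (N z (φ (f i))) = 0 := fun i => by
      have h1 := hN.skew z (φ (f i)) (φ (f i))
      rw [hβ] at h1
      linarith
    have ht := (trace_ad_complement f hc hred hf z).1
    rw [hunim] at ht
    rw [hz, ← neg_eq_zero, ht, ← Finset.sum_neg_distrib]
    refine Finset.sum_congr rfl fun i _ => ?_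
    rw [hN.lie, map_sub, hskew]
    ring
  -- The `𝔨`-component of `[x, f i]`. Its contribution to the Ricci curvature is the isotropy term
  -- of `-(1/2) * killingForm`.
  let κ : ι → L := fun i => (LinearMap.ker φ).projectionOnto p hc.symm ⁅(x : L), (f i : L)⁆
  have hκ : ∀ i, ⁅(f i : L), (x : L)⁆ = -(∑ j, (n - ε) j i • (f j : L) + κ i) := fun i => by
    have h1 := Submodule.projection_add_projection_eq_self hc ⁅(x : L), (f i : L)⁆
    rw [← Submodule.coe_projectionOnto_apply, ← Submodule.coe_projectionOnto_apply,
      f.coe_sum_repr] at h1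
    simp only [repr_projectionOnto f hc hf, ha] at h1
    rw [← lie_skew, ← h1]
  have hκx : ∀ i, N (κ i) (φ x) = -φ ⁅(x : L), κ i⁆ := fun i => by
    have h1 := hN.lie x (κ i)
    have h2 : φ (κ i) = 0 :=
      ((LinearMap.ker φ).projectionOnto p hc.symm ⁅(x : L), (f i : L)⁆).2
    rw [h1, h2, map_zero, zero_sub, neg_neg]
  have hK := (trace_ad_complement f hc hred hf x).2
  have hterm : ∀ i, β (φ (f i)) (nomizuCurv N (f i) x (φ x))
      = β (φ (f i)) (N (f i) (N x (φ x))) - ∑ j, n i j * ε j i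
        + ∑ j, ε i j * (n - ε) j i - β (φ (f i)) (φ ⁅(x : L), κ i⁆) := fun i => by
    have h1 : β (φ (f i)) (N x (N (f i) (φ x))) = ∑ j, n i j * ε j i := by
      conv_lhs => rw [hexp (N (f i) (φ x))]
      simp only [map_sum, map_smul, smul_eq_mul, n, ε, Matrix.of_apply]
      exact Finset.sum_congr rfl fun j _ => mul_comm _ _
    have h2 : β (φ (f i)) (N (∑ j, (n - ε) j i • (f j : L)) (φ x)) = ∑ j, ε i j * (n - ε) j i := by
      simp only [map_sum, map_smul, LinearMap.sum_apply, LinearMap.smul_apply, smul_eq_mul]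
      exact Finset.sum_congr rfl fun j _ => mul_comm _ _
    simp only [nomizuCurv, LinearMap.sub_apply, Module.End.mul_apply, hκ, map_neg, map_add,
      LinearMap.neg_apply, LinearMap.add_apply, map_sub, hκx, h1, h2]
    ring
  simp only [hterm, Finset.sum_sub_distrib, Finset.sum_add_distrib, hdiv, hK, ha, hJ]
  have e1 : ∀ a b : Matrix ι ι ℝ, ∑ i, ∑ j, a i j * b j i = (a * b).trace := fun a b => by
    simp [Matrix.trace, Matrix.mul_apply]
  have e2 : ∀ a : Matrix ι ι ℝ, ∑ i, ∑ j, a i j ^ 2 = (a * a.transpose).trace := fun a => by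
    simp [Matrix.trace, Matrix.mul_apply, sq]
  rw [e1, e1, e1, e2, e2]
  have := trace_skew_identity n ε hn
  simp only [κ]
  linarith

end Nomizu

/-! ### Ricci and scalar curvature as basis-free traces. -/

section LocalTraces

set_option maxSynthPendingDepth 3

variable {E : Type*} [NormedAddCommGroup E] [NormedSpace ℝ E] [FiniteDimensional ℝ E]
  {Q : E → E →L[ℝ] E →L[ℝ] ℝ} {y : E} {ι : Type*} [Fintype ι] {g : ι → E}

lemma trace_eq_sum_of_expand {β : LinearMap.BilinForm ℝ E}
    (hexp : ∀ u, u = ∑ i, β (g i) u • g i) (T : Module.End ℝ E) :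
    LinearMap.trace ℝ E T = ∑ i, β (g i) (T (g i)) := by
  have h : T = ∑ i, (β (g i)).smulRight (T (g i)) := by
    ext u
    conv_lhs => rw [hexp u]
    simp
  conv_lhs => rw [h]
  rw [map_sum]
  exact Finset.sum_congr rfl fun i _ => LinearMap.trace_smulRight _ _

variable {R : E →ₗ[ℝ] E →ₗ[ℝ] E →ₗ[ℝ] E}

/-- Multilinearity of the curvature is not visible in its definition by derivatives, so it enters
through a trilinear `R`; the sum over a basis is then a trace. -/
lemma localRicci_eq_trace (hR : ∀ u v w, localRiemann Q y u v w = R u v w) (v w : E) :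
    localRicci Q y v w = LinearMap.trace ℝ E ((R.flip v).flip w) := by
  rw [LinearMap.trace_eq_matrix_trace ℝ (Module.finBasis ℝ E), Matrix.trace]
  simp [localRicci, hR, LinearMap.toMatrix_apply]

lemma localScal_eq_sum (hR : ∀ u v w, localRiemann Q y u v w = R u v w)
    (hQ : (Q y).IsInvertible) (hexp : ∀ u, u = ∑ i, Q y (g i) u • g i) :
    localScal Q y = ∑ i, localRicci Q y (g i) (g i) := by
  have h1 : ∀ l, (Q y).inverse (LinearMap.toContinuousLinearMap ((Module.finBasis ℝ E).coord l))
      = ∑ j, (Module.finBasis ℝ E).coord l (g j) • g j := fun l => by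
    apply hQ.injective
    rw [hQ.self_apply_inverse]
    ext u
    conv_lhs => rw [hexp u]
    simp [mul_comm]
  simp only [localScal, localRicci_eq_trace hR, h1, map_sum, map_smul]
  rw [Finset.sum_comm]
  refine Finset.sum_congr rfl fun j _ => ?_
  have h2 : g j = ∑ l, (Module.finBasis ℝ E).coord l (g j) • Module.finBasis ℝ E l :=
    ((Module.finBasis ℝ E).sum_repr (g j)).symm
  have h3 : (R.flip (g j)).flip (g j)
      = ∑ l, (Module.finBasis ℝ E).coord l (g j) • (R.flip (Module.finBasis ℝ E l)).flip (g j) := by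
    ext u
    have h4 := congrArg (fun v => R u v (g j)) h2
    simp only [map_sum, map_smul, LinearMap.sum_apply, LinearMap.smul_apply] at h4
    simpa using h4
  rw [h3, map_sum]
  simp

end LocalTraces

/-! ### Curvature of an invariant metric at the base point. -/

section HomogeneousCurvature

set_option maxSynthPendingDepth 3

variable {F : Type*} [NormedAddCommGroup F] [NormedSpace ℝ F]
  {G : Type*} [TopologicalSpace G] [ChartedSpace F G] [Group G] [LieGroup 𝓘(ℝ, F) ∞ G]
  {E : Type*} [NormedAddCommGroup E] [NormedSpace ℝ E]
  {M : Type*} [TopologicalSpace M] [ChartedSpace E M]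
  [IsManifold 𝓘(ℝ, E) ∞ M]
  [MulAction G M] [ContMDiffSMul 𝓘(ℝ, F) 𝓘(ℝ, E) ∞ G M]

variable (F G E) in
/-- The derivative of the orbit map with values in the model space. -/
def orbitMap (o : M) : GroupLieAlgebra 𝓘(ℝ, F) G →ₗ[ℝ] E := orbitDeriv F G E o

variable (F G E) in
/-- The vector field on the preferred chart at `o` generated by an element of the Lie algebra. -/
def chartField (o : M) (X : GroupLieAlgebra 𝓘(ℝ, F) G) : E → E :=
  fundamentalField (F := F) (chartAct F G E o) (chartOne F G) X

variable (F G) in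
/-- The Nomizu map of the Levi-Civita connection, computed in the preferred chart. -/
def nomizuMap (Q : E → E →L[ℝ] E →L[ℝ] ℝ) (o : M) :
    GroupLieAlgebra 𝓘(ℝ, F) G →ₗ[ℝ] Module.End ℝ E :=
  fundamentalCovDeriv (F := F) (chartAct F G E o) (chartOne F G) Q (extChartAt 𝓘(ℝ, E) o o)

lemma nomizuMap_apply (Q : E → E →L[ℝ] E →L[ℝ] ℝ) (o : M) (X : GroupLieAlgebra 𝓘(ℝ, F) G) :
    nomizuMap F G Q o X = covDeriv Q (extChartAt 𝓘(ℝ, E) o o) (chartField F G E o X) :=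
  fundamentalCovDeriv_apply ((contDiffAt_chartAct (F := F) (G := G) o).of_le
    (WithTop.coe_le_coe.2 (le_top : (2 : ℕ∞) ≤ ⊤))) Q X

/-- The value of a field of bilinear forms at a point as a bilinear form on the model space. -/
def TwoTensorField.formAt (γ : TwoTensorField E M) (o : M) : LinearMap.BilinForm ℝ E :=
  LinearMap.mk₂ ℝ (fun v w : E => (γ o v w : ℝ))
    (fun v v' w => by exact congrFun (congrArg DFunLike.coe ((γ o).map_add v v')) w)
    (fun c v w => by exact congrFun (congrArg DFunLike.coe ((γ o).map_smul c v)) w)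
    (fun v w w' => by exact (γ o v).map_add w w')
    (fun c v w => by exact (γ o v).map_smul c w)

variable {γ : TwoTensorField E M} {o : M}

lemma formAt_eq_inChart (v w : E) :
    γ.formAt o v w = γ.inChart o (extChartAt 𝓘(ℝ, E) o o) v w :=
  (γ.inChart_self o v w).symm

-- Positivity is needed only at `o`, where it gives injectivity and, by dimension, invertibility.
-- Thus `g + t T` can be treated without checking positivity on all of `M`.
omit [TopologicalSpace G] [ContMDiffSMul 𝓘(ℝ, F) 𝓘(ℝ, E) ∞ G M] in
lemma IsInvariantSymmTensor.isLocalMetric [FiniteDimensional ℝ E] (hγ : IsInvariantSymmTensor G γ)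
    (hpos : ∀ v : E, v ≠ 0 → 0 < γ.formAt o v v) :
    IsLocalMetric (γ.inChart o) (extChartAt 𝓘(ℝ, E) o o) := by
  refine ⟨TwoTensorField.contDiffAt_inChart (hγ.smooth o),
    Filter.Eventually.of_forall fun y v w => hγ.symm _ _ _, ?_⟩
  have hinj : Function.Injective (γ.inChart o (extChartAt 𝓘(ℝ, E) o o)) := by
    rw [injective_iff_map_eq_zero]
    intro v hv
    by_contra hne
    have := hpos v hne
    rw [formAt_eq_inChart, hv] at this
    simp at this
  let l : E ≃ₗ[ℝ] (E →L[ℝ] ℝ) := LinearEquiv.ofInjectiveOfFinrankEq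
    (γ.inChart o (extChartAt 𝓘(ℝ, E) o o)).toLinearMap hinj (by
      rw [← (LinearMap.toContinuousLinearMap (𝕜 := ℝ) (E := E) (F' := ℝ)).finrank_eq]
      exact (Subspace.dual_finrank_eq (K := ℝ) (V := E)).symm)
  exact ⟨l.toContinuousLinearEquiv, by ext; rfl⟩

lemma IsInvariantSymmTensor.isLocalKilling (hγ : IsInvariantSymmTensor G γ)
    (X : GroupLieAlgebra 𝓘(ℝ, F) G) :
    IsLocalKilling (γ.inChart o) (extChartAt 𝓘(ℝ, E) o o) (chartField F G E o X) :=
  isLocalKilling_fundamentalField (F := F) (TwoTensorField.contDiffAt_inChart (hγ.smooth o))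
    (contDiffAt_chartAct o) (eventually_chartAct_one o)
    (TwoTensorField.inChart_invariant hγ.invariant o) X

lemma orbitMap_eq (o : M) (X : GroupLieAlgebra 𝓘(ℝ, F) G) :
    orbitMap F G E o X = chartField F G E o X (extChartAt 𝓘(ℝ, E) o o) :=
  orbitDeriv_eq_fundamentalField o X

lemma eventually_chartField_lie (o : M) (X Y : GroupLieAlgebra 𝓘(ℝ, F) G) :
    ∀ᶠ y in 𝓝 (extChartAt 𝓘(ℝ, E) o o), chartField F G E o ⁅X, Y⁆ y
      = fderiv ℝ (chartField F G E o X) y (chartField F G E o Y y)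
        - fderiv ℝ (chartField F G E o Y) y (chartField F G E o X y) := by
  have h := fundamentalField_bracket (F := F) (contDiffAt_chartAct (G := G) (E := E) o)
    contDiffAt_chartMul (eventually_chartAct_one o)
    eventually_chartMul_one eventually_one_chartMul (eventually_chartAct_assoc (E := E) o) X Y
  rw [bracket_eq_mixedDeriv]
  exact h

variable [CompleteSpace F] [FiniteDimensional ℝ E]

/-- Skewness is the Killing equation; the bracket rule combines vanishing torsion with the
anti-homomorphism property of fundamental fields. -/
theorem isNomizuMap_nomizuMap (hγ : IsInvariantSymmTensor G γ)
    (hpos : ∀ v : E, v ≠ 0 → 0 < γ.formAt o v v) :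
    IsNomizuMap (γ.formAt o) (orbitMap F G E o) (nomizuMap F G (γ.inChart o) o) := by
  refine ⟨fun X u v => ?_, fun X Y => ?_⟩
  · rw [formAt_eq_inChart, formAt_eq_inChart, nomizuMap_apply]
    exact (hγ.isLocalKilling X).metric_covDeriv (hγ.isLocalMetric hpos) u v
  · rw [orbitMap_eq, orbitMap_eq, orbitMap_eq, nomizuMap_apply, nomizuMap_apply,
      (eventually_chartField_lie o X Y).self_of_nhds]
    exact (covDeriv_sub_covDeriv (hγ.isLocalMetric hpos) _ _).symm

theorem localRiemann_orbitMap (hγ : IsInvariantSymmTensor G γ)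
    (hpos : ∀ v : E, v ≠ 0 → 0 < γ.formAt o v v) (X Y : GroupLieAlgebra 𝓘(ℝ, F) G) (w : E) :
    localRiemann (γ.inChart o) (extChartAt 𝓘(ℝ, E) o o) (orbitMap F G E o X) (orbitMap F G E o Y) w
      = nomizuCurv (nomizuMap F G (γ.inChart o) o) X Y w := by
  rw [orbitMap_eq, orbitMap_eq, localRiemann_killing (hγ.isLocalMetric hpos) (hγ.isLocalKilling X)
    (hγ.isLocalKilling Y) (eventually_chartField_lie o X Y) w]
  simp only [nomizuCurv, LinearMap.sub_apply, Module.End.mul_apply, nomizuMap_apply]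

end HomogeneousCurvature

/-! ### Ricci and scalar curvature in an orthonormal basis of `𝔭`. -/

section HomogeneousRicci

set_option maxSynthPendingDepth 3

variable {F : Type*} [NormedAddCommGroup F] [NormedSpace ℝ F]
  {G : Type*} [TopologicalSpace G] [ChartedSpace F G] [Group G] [LieGroup 𝓘(ℝ, F) ∞ G]
  {E : Type*} [NormedAddCommGroup E] [NormedSpace ℝ E]
  {M : Type*} [TopologicalSpace M] [ChartedSpace E M]
  [IsManifold 𝓘(ℝ, E) ∞ M]
  [MulAction G M] [ContMDiffSMul 𝓘(ℝ, F) 𝓘(ℝ, E) ∞ G M] [CompleteSpace F] [FiniteDimensional ℝ E]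

variable {γ : TwoTensorField E M} {o : M} {p : Submodule ℝ (GroupLieAlgebra 𝓘(ℝ, F) G)}
  {ι : Type*} [Fintype ι] [DecidableEq ι]

omit [LieGroup 𝓘(ℝ, F) ∞ G] [IsManifold 𝓘(ℝ, E) ∞ M] [ContMDiffSMul 𝓘(ℝ, F) 𝓘(ℝ, E) ∞ G M]
  [CompleteSpace F] [FiniteDimensional ℝ E] in
lemma formOn_eq_formAt (X Y : p) :
    formOn o p γ X Y = γ.formAt o (orbitMap F G E o X) (orbitMap F G E o Y) := rfl

omit [IsManifold 𝓘(ℝ, E) ∞ M] [ContMDiffSMul 𝓘(ℝ, F) 𝓘(ℝ, E) ∞ G M] [FiniteDimensional ℝ E] in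
lemma orbitMap_bracketOn (hp : IsReductiveComplement E o p) (X Y : p) :
    orbitMap F G E o (bracketOn hp X Y : p) = orbitMap F G E o
      ⁅(X : GroupLieAlgebra 𝓘(ℝ, F) G), (Y : GroupLieAlgebra 𝓘(ℝ, F) G)⁆ :=
  image_projectionOnto (φ := orbitMap F G E o) hp.isCompl _

/-- A linear section of the orbit map writes each tangent vector as the value of a fundamental
field, and on such values the curvature is the bilinear `nomizuCurv`. -/
lemma exists_curvature_linear (hγ : IsInvariantSymmTensor G γ)
    (hpos : ∀ v : E, v ≠ 0 → 0 < γ.formAt o v v)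
    (hsub : Function.Surjective (orbitMap F G E o)) :
    ∃ R : E →ₗ[ℝ] E →ₗ[ℝ] E →ₗ[ℝ] E,
      ∀ u v w, localRiemann (γ.inChart o) (extChartAt 𝓘(ℝ, E) o o) u v w = R u v w := by
  obtain ⟨s, hs⟩ := (orbitMap F G E o).exists_rightInverse_of_surjective
    (LinearMap.range_eq_top.2 hsub)
  have hs' : ∀ u, orbitMap F G E o (s u) = u := fun u => congrArg (fun T => T u) hs
  refine ⟨(nomizuCurvBilin (nomizuMap F G (γ.inChart o) o)).compl₁₂ s s, fun u v w => ?_⟩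
  conv_lhs => rw [← hs' u, ← hs' v]
  exact localRiemann_orbitMap hγ hpos _ _ _

variable [FiniteDimensional ℝ F]

/-- The Ricci curvature of an invariant metric in terms of an orthonormal basis of `𝔭`. -/
theorem localRicci_orbitMap (hγ : IsInvariantSymmTensor G γ)
    (hpos : ∀ v : E, v ≠ 0 → 0 < γ.formAt o v v)
    (hunim : ∀ X : GroupLieAlgebra 𝓘(ℝ, F) G,
      LinearMap.trace ℝ _ (LieAlgebra.ad ℝ (GroupLieAlgebra 𝓘(ℝ, F) G) X) = 0)
    (hsub : Function.Surjective (orbitMap F G E o))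
    (hp : IsReductiveComplement E o p) (f : Module.Basis ι ℝ p)
    (hf : ∀ i j, formOn o p γ (f i) (f j) = if i = j then 1 else 0) (x : p) :
    localRicci (γ.inChart o) (extChartAt 𝓘(ℝ, E) o o) (orbitMap F G E o x) (orbitMap F G E o x)
      = -(1 / 2 : ℝ) * killingForm ℝ (GroupLieAlgebra 𝓘(ℝ, F) G) x x
        - (1 / 2 : ℝ) * ∑ i, ∑ j, formOn o p γ (f i) (bracketOn hp x (f j)) ^ 2
        + (1 / 4 : ℝ) * ∑ i, ∑ j, formOn o p γ (bracketOn hp (f i) (f j)) x ^ 2 := by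
  have : FiniteDimensional ℝ (GroupLieAlgebra 𝓘(ℝ, F) G) := inferInstanceAs (FiniteDimensional ℝ F)
  obtain ⟨R, hR⟩ := exists_curvature_linear hγ hpos hsub
  have hN := isNomizuMap_nomizuMap (F := F) (G := G) hγ hpos
  have hexp : ∀ u : E, u = ∑ i, γ.formAt o (orbitMap F G E o (f i)) u • orbitMap F G E o (f i) :=
    fun u => by
      obtain ⟨v, rfl⟩ := hsub u
      exact basis_image_expand (φ := orbitMap F G E o) f hp.isCompl hf v
  have h := nomizu_ricci f hN (hγ.symm o) hsub hunim hp.isCompl hp.bracket_mem hf x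
  simp only [formOn_eq_formAt, orbitMap_bracketOn]
  rw [← h, localRicci_eq_trace hR, trace_eq_sum_of_expand hexp]
  refine Finset.sum_congr rfl fun i _ => ?_
  rw [LinearMap.flip_apply, LinearMap.flip_apply, ← hR, localRiemann_orbitMap hγ hpos]

/-- The scalar curvature of an invariant metric in terms of an orthonormal basis of `𝔭`. -/
theorem scalarCurvature_eq_sum (hγ : IsInvariantSymmTensor G γ)
    (hpos : ∀ v : E, v ≠ 0 → 0 < γ.formAt o v v)
    (hunim : ∀ X : GroupLieAlgebra 𝓘(ℝ, F) G,
      LinearMap.trace ℝ _ (LieAlgebra.ad ℝ (GroupLieAlgebra 𝓘(ℝ, F) G) X) = 0)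
    (hsub : Function.Surjective (orbitMap F G E o))
    (hp : IsReductiveComplement E o p) (f : Module.Basis ι ℝ p)
    (hf : ∀ i j, formOn o p γ (f i) (f j) = if i = j then 1 else 0) :
    scalarCurvature γ o
      = -(1 / 4 : ℝ) * ∑ i, ∑ j, formOn o p γ (bracketOn hp (f i) (f j)) (bracketOn hp (f i) (f j))
        - (1 / 2 : ℝ) * ∑ i, killingForm ℝ (GroupLieAlgebra 𝓘(ℝ, F) G) (f i) (f i) := by
  obtain ⟨R, hR⟩ := exists_curvature_linear hγ hpos hsub
  have hexp : ∀ u : E, u = ∑ i, γ.formAt o (orbitMap F G E o (f i)) u • orbitMap F G E o (f i) :=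
    fun u => by
      obtain ⟨v, rfl⟩ := hsub u
      exact basis_image_expand (φ := orbitMap F G E o) f hp.isCompl hf v
  have hsymm : ∀ u v, γ.formAt o u v = γ.formAt o v u := hγ.symm o
  have hnorm : ∀ u : E, γ.formAt o u u =
      ∑ l, γ.formAt o (orbitMap F G E o (f l)) u ^ 2 := fun u => by
    conv_lhs => enter [2]; rw [hexp u]
    simp [sq, hsymm u]
  rw [scalarCurvature, localScal_eq_sum hR (hγ.isLocalMetric hpos).invertible
    (by simpa only [formAt_eq_inChart] using hexp)]
  simp only [localRicci_orbitMap hγ hpos hunim hsub hp f hf, Finset.sum_add_distrib,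
    Finset.sum_sub_distrib, ← Finset.mul_sum]
  -- Both quadratic terms of the Ricci formula trace to the squared norm of the bracket, with total
  -- coefficient `-1/2 + 1/4 = -1/4`.
  have h1 : ∑ x, ∑ i, ∑ j, formOn o p γ (f i) (bracketOn hp (f x) (f j)) ^ 2
      = ∑ i, ∑ j, formOn o p γ (bracketOn hp (f i) (f j)) (bracketOn hp (f i) (f j)) := by
    refine Finset.sum_congr rfl fun x _ => ?_
    rw [Finset.sum_comm]
    refine Finset.sum_congr rfl fun j _ => ?_
    rw [formOn_eq_formAt, hnorm]
    rfl
  have h2 : ∑ x, ∑ i, ∑ j, formOn o p γ (bracketOn hp (f i) (f j)) (f x) ^ 2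
      = ∑ i, ∑ j, formOn o p γ (bracketOn hp (f i) (f j)) (bracketOn hp (f i) (f j)) := by
    rw [Finset.sum_comm]
    refine Finset.sum_congr rfl fun i _ => ?_
    rw [Finset.sum_comm]
    refine Finset.sum_congr rfl fun j _ => ?_
    rw [formOn_eq_formAt, hnorm]
    refine Finset.sum_congr rfl fun x _ => ?_
    rw [formOn_eq_formAt, hsymm]
  rw [h1, h2]
  ring

end HomogeneousRicci

/-! ### Matrices acting on the three slots of structure constants. -/

section TensorAlgebra

variable {ι : Type*} [Fintype ι]

/-- Multiplication of the first index of a tensor by a matrix. -/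
def act₁ : Matrix ι ι ℝ →ₗ[ℝ] (ι → ι → ι → ℝ) →ₗ[ℝ] (ι → ι → ι → ℝ) :=
  LinearMap.mk₂ ℝ (fun U t a b k => ∑ c, U a c * t c b k)
    (fun U U' t => by ext; simp [add_mul, Finset.sum_add_distrib])
    (fun r U t => by ext; simp [mul_assoc, Finset.mul_sum])
    (fun U t t' => by ext; simp [mul_add, Finset.sum_add_distrib])
    (fun r U t => by ext; simp [mul_left_comm, Finset.mul_sum])

/-- Multiplication of the second index of a tensor by a matrix. -/
def act₂ : Matrix ι ι ℝ →ₗ[ℝ] (ι → ι → ι → ℝ) →ₗ[ℝ] (ι → ι → ι → ℝ) :=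
  LinearMap.mk₂ ℝ (fun U t a b k => ∑ c, U b c * t a c k)
    (fun U U' t => by ext; simp [add_mul, Finset.sum_add_distrib])
    (fun r U t => by ext; simp [mul_assoc, Finset.mul_sum])
    (fun U t t' => by ext; simp [mul_add, Finset.sum_add_distrib])
    (fun r U t => by ext; simp [mul_left_comm, Finset.mul_sum])

/-- Multiplication of the third index of a tensor by a matrix. -/
def act₃ : Matrix ι ι ℝ →ₗ[ℝ] (ι → ι → ι → ℝ) →ₗ[ℝ] (ι → ι → ι → ℝ) :=
  LinearMap.mk₂ ℝ (fun U t a b k => ∑ c, U k c * t a b c)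
    (fun U U' t => by ext; simp [add_mul, Finset.sum_add_distrib])
    (fun r U t => by ext; simp [mul_assoc, Finset.mul_sum])
    (fun U t t' => by ext; simp [mul_add, Finset.sum_add_distrib])
    (fun r U t => by ext; simp [mul_left_comm, Finset.mul_sum])

/-- The standard inner product of tensors. -/
def tensorInner : (ι → ι → ι → ℝ) →ₗ[ℝ] (ι → ι → ι → ℝ) →ₗ[ℝ] ℝ :=
  LinearMap.mk₂ ℝ (fun s t => ∑ a, ∑ b, ∑ k, s a b k * t a b k)
    (fun s s' t => by simp [add_mul, Finset.sum_add_distrib])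
    (fun r s t => by simp [mul_assoc, Finset.mul_sum])
    (fun s t t' => by simp [mul_add, Finset.sum_add_distrib])
    (fun r s t => by simp [mul_left_comm, Finset.mul_sum])

lemma act₁_apply (U : Matrix ι ι ℝ) (t : ι → ι → ι → ℝ) (a b k : ι) :
    act₁ U t a b k = ∑ c, U a c * t c b k := rfl

lemma act₂_apply (U : Matrix ι ι ℝ) (t : ι → ι → ι → ℝ) (a b k : ι) :
    act₂ U t a b k = ∑ c, U b c * t a c k := rfl

lemma act₃_apply (U : Matrix ι ι ℝ) (t : ι → ι → ι → ℝ) (a b k : ι) :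
    act₃ U t a b k = ∑ c, U k c * t a b c := rfl

lemma tensorInner_apply (s t : ι → ι → ι → ℝ) :
    tensorInner s t = ∑ a, ∑ b, ∑ k, s a b k * t a b k := rfl

lemma act₁_mul (U W : Matrix ι ι ℝ) (t : ι → ι → ι → ℝ) :
    act₁ (U * W) t = act₁ U (act₁ W t) := by
  ext a b k
  simp only [act₁_apply, Matrix.mul_apply, Finset.sum_mul, Finset.mul_sum]
  rw [Finset.sum_comm]
  simp only [mul_assoc]

lemma act₂_mul (U W : Matrix ι ι ℝ) (t : ι → ι → ι → ℝ) :
    act₂ (U * W) t = act₂ U (act₂ W t) := by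
  ext a b k
  simp only [act₂_apply, Matrix.mul_apply, Finset.sum_mul, Finset.mul_sum]
  rw [Finset.sum_comm]
  simp only [mul_assoc]

lemma act₃_mul (U W : Matrix ι ι ℝ) (t : ι → ι → ι → ℝ) :
    act₃ (U * W) t = act₃ U (act₃ W t) := by
  ext a b k
  simp only [act₃_apply, Matrix.mul_apply, Finset.sum_mul, Finset.mul_sum]
  rw [Finset.sum_comm]
  simp only [mul_assoc]

lemma act₁_act₂ (U W : Matrix ι ι ℝ) (t : ι → ι → ι → ℝ) :
    act₁ U (act₂ W t) = act₂ W (act₁ U t) := by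
  ext a b k
  simp only [act₁_apply, act₂_apply, Finset.mul_sum]
  rw [Finset.sum_comm]
  simp only [mul_left_comm]

lemma act₁_act₃ (U W : Matrix ι ι ℝ) (t : ι → ι → ι → ℝ) :
    act₁ U (act₃ W t) = act₃ W (act₁ U t) := by
  ext a b k
  simp only [act₁_apply, act₃_apply, Finset.mul_sum]
  rw [Finset.sum_comm]
  simp only [mul_left_comm]

lemma act₂_act₃ (U W : Matrix ι ι ℝ) (t : ι → ι → ι → ℝ) :
    act₂ U (act₃ W t) = act₃ W (act₂ U t) := by
  ext a b k
  simp only [act₂_apply, act₃_apply, Finset.mul_sum]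
  rw [Finset.sum_comm]
  simp only [mul_left_comm]

lemma tensorInner_act₁ (U : Matrix ι ι ℝ) (s t : ι → ι → ι → ℝ) :
    tensorInner (act₁ U s) t = tensorInner s (act₁ U.transpose t) := by
  simp only [tensorInner_apply, act₁_apply, Finset.mul_sum, Finset.sum_mul, Matrix.transpose_apply]
  have h1 : ∀ F : ι → ι → ι → ι → ℝ, ∑ a, ∑ b, ∑ k, ∑ c, F a b k c
      = ∑ a, ∑ b, ∑ k, ∑ c, F c b k a := fun F => by
    simp only [← Finset.sum_product']
    refine Finset.sum_bij' (fun q _ => (q.2.2.2, q.2.1, q.2.2.1, q.1))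
      (fun q _ => (q.2.2.2, q.2.1, q.2.2.1, q.1)) ?_ ?_ ?_ ?_ ?_ <;> simp
  rw [h1]
  refine Finset.sum_congr rfl fun a _ => Finset.sum_congr rfl fun b _ =>
    Finset.sum_congr rfl fun k _ => Finset.sum_congr rfl fun c _ => by ring

lemma tensorInner_act₂ (U : Matrix ι ι ℝ) (s t : ι → ι → ι → ℝ) :
    tensorInner (act₂ U s) t = tensorInner s (act₂ U.transpose t) := by
  simp only [tensorInner_apply, act₂_apply, Finset.mul_sum, Finset.sum_mul, Matrix.transpose_apply]
  refine Finset.sum_congr rfl fun a _ => ?_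
  have h1 : ∀ F : ι → ι → ι → ℝ, ∑ b, ∑ k, ∑ c, F b k c = ∑ b, ∑ k, ∑ c, F c k b := fun F => by
    simp only [← Finset.sum_product']
    refine Finset.sum_bij' (fun q _ => (q.2.2, q.2.1, q.1))
      (fun q _ => (q.2.2, q.2.1, q.1)) ?_ ?_ ?_ ?_ ?_ <;> simp
  rw [h1]
  refine Finset.sum_congr rfl fun b _ =>
    Finset.sum_congr rfl fun k _ => Finset.sum_congr rfl fun c _ => by ring

lemma tensorInner_act₃ (U : Matrix ι ι ℝ) (s t : ι → ι → ι → ℝ) :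
    tensorInner (act₃ U s) t = tensorInner s (act₃ U.transpose t) := by
  simp only [tensorInner_apply, act₃_apply, Finset.mul_sum, Finset.sum_mul, Matrix.transpose_apply]
  refine Finset.sum_congr rfl fun a _ => Finset.sum_congr rfl fun b _ => ?_
  rw [Finset.sum_comm]
  refine Finset.sum_congr rfl fun k _ => Finset.sum_congr rfl fun c _ => by ring

variable [DecidableEq ι]

lemma act₁_one (t : ι → ι → ι → ℝ) : act₁ 1 t = t := by
  ext a b k
  simp [act₁_apply, Matrix.one_apply]

lemma act₂_one (t : ι → ι → ι → ℝ) : act₂ 1 t = t := by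
  ext a b k
  simp [act₂_apply, Matrix.one_apply]

lemma act₃_one (t : ι → ι → ι → ℝ) : act₃ 1 t = t := by
  ext a b k
  simp [act₃_apply, Matrix.one_apply]

omit [DecidableEq ι] in
variable (ι) in
/-- The action of a symmetric matrix by derivations on the products `t`. -/
def tensorTheta : Matrix ι ι ℝ →ₗ[ℝ] (ι → ι → ι → ℝ) →ₗ[ℝ] (ι → ι → ι → ℝ) :=
  act₃ - act₁ - act₂

omit [DecidableEq ι] in
lemma tensorTheta_apply (U : Matrix ι ι ℝ) (t : ι → ι → ι → ℝ) :
    tensorTheta ι U t = act₃ U t - act₁ U t - act₂ U t := rfl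

-- For symmetric `U` the three slot actions are self-adjoint, so the left side is `⟨θ(U)θ(U)t, t⟩`;
-- the actions commute, which allows expanding the square.
omit [DecidableEq ι] in
lemma tensorInner_theta_theta {U : Matrix ι ι ℝ} (hU : U.transpose = U) (t : ι → ι → ι → ℝ) :
    tensorInner (tensorTheta ι U t) (tensorTheta ι U t)
      = tensorInner (act₃ (U * U) t + act₁ (U * U) t + act₂ (U * U) t
        + (2 : ℝ) • act₁ U (act₂ U t) - (2 : ℝ) • act₁ U (act₃ U t)
        - (2 : ℝ) • act₂ U (act₃ U t)) t := by
  have h : tensorInner (tensorTheta ι U t) (tensorTheta ι U t)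
      = tensorInner (tensorTheta ι U (tensorTheta ι U t)) t := by
    rw [tensorTheta_apply U (tensorTheta ι U t)]
    simp only [map_sub, LinearMap.sub_apply, tensorInner_act₁ U (tensorTheta ι U t),
      tensorInner_act₂ U (tensorTheta ι U t), tensorInner_act₃ U (tensorTheta ι U t), hU]
    rw [tensorTheta_apply U t]
    simp only [map_sub, LinearMap.sub_apply]
  rw [h]
  congr 2
  simp only [tensorTheta_apply, map_sub, act₁_mul, act₂_mul, act₃_mul, act₁_act₂, act₁_act₃,
    act₂_act₃]
  module

end TensorAlgebra

/-! ### Calculus of 2-jets at zero. -/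

section Jets

/-- `f` is `C²` at `0` with `f 0 = a`, `f' 0 = b` and `f'' 0 = c`. -/
structure HasJet (f : ℝ → ℝ) (a b c : ℝ) : Prop where
  contDiffAt : ContDiffAt ℝ 2 f 0
  val : f 0 = a
  deriv_eq : deriv f 0 = b
  deriv2_eq : iteratedDeriv 2 f 0 = c

lemma HasJet.unique {f : ℝ → ℝ} {a b c a' b' c' : ℝ} (h : HasJet f a b c)
    (h' : HasJet f a' b' c') : a = a' ∧ b = b' ∧ c = c' :=
  ⟨h.val.symm.trans h'.val, h.deriv_eq.symm.trans h'.deriv_eq,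
    h.deriv2_eq.symm.trans h'.deriv2_eq⟩

lemma HasJet.of_contDiffAt {f : ℝ → ℝ} (h : ContDiffAt ℝ 2 f 0) :
    HasJet f (f 0) (deriv f 0) (iteratedDeriv 2 f 0) := ⟨h, rfl, rfl, rfl⟩

lemma HasJet.congr {f g : ℝ → ℝ} {a b c : ℝ} (h : HasJet f a b c) (hg : g =ᶠ[𝓝 0] f) :
    HasJet g a b c :=
  ⟨h.contDiffAt.congr_of_eventuallyEq hg, hg.self_of_nhds.trans h.val,
    hg.deriv_eq.trans h.deriv_eq, (hg.iteratedDeriv_eq 2).trans h.deriv2_eq⟩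

lemma HasJet.const (a : ℝ) : HasJet (fun _ => a) a 0 0 :=
  ⟨contDiffAt_const, rfl, by simp, by simp [iteratedDeriv_const]⟩

lemma HasJet.add {f g : ℝ → ℝ} {a b c a' b' c' : ℝ} (hf : HasJet f a b c)
    (hg : HasJet g a' b' c') : HasJet (fun t => f t + g t) (a + a') (b + b') (c + c') := by
  refine ⟨hf.contDiffAt.add hg.contDiffAt, by rw [hf.val, hg.val], ?_, ?_⟩
  · rw [deriv_fun_add (hf.contDiffAt.differentiableAt (by simp))
      (hg.contDiffAt.differentiableAt (by simp)), hf.deriv_eq, hg.deriv_eq]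
  · rw [iteratedDeriv_fun_add hf.contDiffAt hg.contDiffAt, hf.deriv2_eq, hg.deriv2_eq]

lemma HasJet.mul {f g : ℝ → ℝ} {a b c a' b' c' : ℝ} (hf : HasJet f a b c)
    (hg : HasJet g a' b' c') :
    HasJet (fun t => f t * g t) (a * a') (b * a' + a * b') (c * a' + 2 * (b * b') + a * c') := by
  refine ⟨hf.contDiffAt.mul hg.contDiffAt, by rw [hf.val, hg.val], ?_, ?_⟩
  · rw [deriv_fun_mul (hf.contDiffAt.differentiableAt (by simp))
      (hg.contDiffAt.differentiableAt (by simp)), hf.deriv_eq, hg.deriv_eq, hf.val, hg.val]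
  · rw [iteratedDeriv_fun_mul hf.contDiffAt hg.contDiffAt]
    simp [Finset.sum_range_succ, hf.val, hg.val, hf.deriv_eq, hg.deriv_eq, hf.deriv2_eq,
      hg.deriv2_eq]
    ring

lemma HasJet.sum {κ : Type*} (s : Finset κ) {f : κ → ℝ → ℝ} {a b c : κ → ℝ}
    (h : ∀ i, HasJet (f i) (a i) (b i) (c i)) :
    HasJet (fun t => ∑ i ∈ s, f i t) (∑ i ∈ s, a i) (∑ i ∈ s, b i) (∑ i ∈ s, c i) := by
  classical
  induction s using Finset.induction_on with
  | empty => simpa using HasJet.const 0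
  | insert i s hi ih => simpa only [Finset.sum_insert hi] using (h i).add ih

variable {ι : Type*} [Fintype ι]

/-- Entrywise jets of a curve of matrices. -/
def MatrixHasJet (P : ℝ → Matrix ι ι ℝ) (P₀ P₁ P₂ : Matrix ι ι ℝ) : Prop :=
  ∀ i j, HasJet (fun t => P t i j) (P₀ i j) (P₁ i j) (P₂ i j)

/-- Entrywise jets of a curve of tensors. -/
def TensorHasJet (x : ℝ → ι → ι → ι → ℝ) (x₀ x₁ x₂ : ι → ι → ι → ℝ) : Prop :=
  ∀ i j k, HasJet (fun t => x t i j k) (x₀ i j k) (x₁ i j k) (x₂ i j k)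

lemma HasJet.congr_jet {f : ℝ → ℝ} {a b c a' b' c' : ℝ} (h : HasJet f a b c) (ha : a = a')
    (hb : b = b') (hc : c = c') : HasJet f a' b' c' := by
  subst ha hb hc; exact h

lemma TensorHasJet.act₁ {P : ℝ → Matrix ι ι ℝ} {P₀ P₁ P₂ : Matrix ι ι ℝ}
    {x : ℝ → ι → ι → ι → ℝ} {x₀ x₁ x₂ : ι → ι → ι → ℝ} (hx : TensorHasJet x x₀ x₁ x₂)
    (hP : MatrixHasJet P P₀ P₁ P₂) :
    TensorHasJet (fun t => act₁ (P t) (x t)) (act₁ P₀ x₀) (act₁ P₁ x₀ + act₁ P₀ x₁)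
      (act₁ P₂ x₀ + (2 : ℝ) • act₁ P₁ x₁ + act₁ P₀ x₂) := fun a b k =>
  (HasJet.sum Finset.univ fun c => (hP a c).mul (hx c b k)).congr_jet rfl
    (by simp [act₁_apply, Finset.sum_add_distrib])
    (by simp [act₁_apply, Finset.sum_add_distrib, Finset.mul_sum])

lemma TensorHasJet.act₂ {P : ℝ → Matrix ι ι ℝ} {P₀ P₁ P₂ : Matrix ι ι ℝ}
    {x : ℝ → ι → ι → ι → ℝ} {x₀ x₁ x₂ : ι → ι → ι → ℝ} (hx : TensorHasJet x x₀ x₁ x₂)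
    (hP : MatrixHasJet P P₀ P₁ P₂) :
    TensorHasJet (fun t => act₂ (P t) (x t)) (act₂ P₀ x₀) (act₂ P₁ x₀ + act₂ P₀ x₁)
      (act₂ P₂ x₀ + (2 : ℝ) • act₂ P₁ x₁ + act₂ P₀ x₂) := fun a b k =>
  (HasJet.sum Finset.univ fun c => (hP b c).mul (hx a c k)).congr_jet rfl
    (by simp [act₂_apply, Finset.sum_add_distrib])
    (by simp [act₂_apply, Finset.sum_add_distrib, Finset.mul_sum])

lemma TensorHasJet.act₃ {P : ℝ → Matrix ι ι ℝ} {P₀ P₁ P₂ : Matrix ι ι ℝ}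
    {x : ℝ → ι → ι → ι → ℝ} {x₀ x₁ x₂ : ι → ι → ι → ℝ} (hx : TensorHasJet x x₀ x₁ x₂)
    (hP : MatrixHasJet P P₀ P₁ P₂) :
    TensorHasJet (fun t => act₃ (P t) (x t)) (act₃ P₀ x₀) (act₃ P₁ x₀ + act₃ P₀ x₁)
      (act₃ P₂ x₀ + (2 : ℝ) • act₃ P₁ x₁ + act₃ P₀ x₂) := fun a b k =>
  (HasJet.sum Finset.univ fun c => (hP k c).mul (hx a b c)).congr_jet rfl
    (by simp [act₃_apply, Finset.sum_add_distrib])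
    (by simp [act₃_apply, Finset.sum_add_distrib, Finset.mul_sum])

lemma TensorHasJet.inner {x : ℝ → ι → ι → ι → ℝ} {x₀ x₁ x₂ : ι → ι → ι → ℝ}
    (hx : TensorHasJet x x₀ x₁ x₂) (s : ι → ι → ι → ℝ) :
    HasJet (fun t => tensorInner (x t) s) (tensorInner x₀ s) (tensorInner x₁ s)
      (tensorInner x₂ s) :=
  (HasJet.sum Finset.univ fun a => HasJet.sum Finset.univ fun b => HasJet.sum Finset.univ fun k =>
    (hx a b k).mul (HasJet.const (s a b k))).congr_jet rfl
    (by simp [tensorInner_apply]) (by simp [tensorInner_apply])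

lemma MatrixHasJet.mul {P R : ℝ → Matrix ι ι ℝ} {P₀ P₁ P₂ R₀ R₁ R₂ : Matrix ι ι ℝ}
    (hP : MatrixHasJet P P₀ P₁ P₂) (hR : MatrixHasJet R R₀ R₁ R₂) :
    MatrixHasJet (fun t => P t * R t) (P₀ * R₀) (P₁ * R₀ + P₀ * R₁)
      (P₂ * R₀ + (2 : ℝ) • (P₁ * R₁) + P₀ * R₂) := fun i j =>
  ((HasJet.sum Finset.univ fun k => (hP i k).mul (hR k j)).congr_jet rfl
    (by simp [Matrix.mul_apply, Finset.sum_add_distrib])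
    (by simp [Matrix.mul_apply, Finset.sum_add_distrib, Finset.mul_sum])).congr
    (Filter.Eventually.of_forall fun t => Matrix.mul_apply)

omit [Fintype ι] in
lemma MatrixHasJet.unique {P : ℝ → Matrix ι ι ℝ} {P₀ P₁ P₂ R₀ R₁ R₂ : Matrix ι ι ℝ}
    (hP : MatrixHasJet P P₀ P₁ P₂) (hR : MatrixHasJet P R₀ R₁ R₂) :
    P₀ = R₀ ∧ P₁ = R₁ ∧ P₂ = R₂ :=
  ⟨by ext i j; exact ((hP i j).unique (hR i j)).1, by ext i j; exact ((hP i j).unique (hR i j)).2.1,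
    by ext i j; exact ((hP i j).unique (hR i j)).2.2⟩

variable [DecidableEq ι]

lemma contDiffAt_matrix_det {P : ℝ → Matrix ι ι ℝ} {x : ℝ} {n : ℕ∞ω}
    (hP : ∀ i j, ContDiffAt ℝ n (fun t => P t i j) x) :
    ContDiffAt ℝ n (fun t => (P t).det) x := by
  simp only [Matrix.det_apply]
  exact ContDiffAt.sum fun σ _ => (contDiffAt_prod fun i _ => hP _ _).const_smul _

lemma contDiffAt_matrix_inv {P : ℝ → Matrix ι ι ℝ} {x : ℝ} {n : ℕ∞ω}
    (hP : ∀ i j, ContDiffAt ℝ n (fun t => P t i j) x) (hx : (P x).det ≠ 0) (i j : ι) :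
    ContDiffAt ℝ n (fun t => (P t)⁻¹ i j) x := by
  simp only [Matrix.inv_def, Ring.inverse_eq_inv', Matrix.smul_apply, Matrix.adjugate_apply,
    smul_eq_mul]
  refine ((contDiffAt_matrix_det hP).inv hx).mul (contDiffAt_matrix_det fun a b => ?_)
  by_cases h : a = j
  · subst h
    simpa using contDiffAt_const
  · simpa [Matrix.updateRow_ne h] using hP a b

/-- Cramer's rule shows that the inverse is `C²`; the Leibniz rule for `P⁻¹ * P = 1` then forces its
coefficients. -/
lemma MatrixHasJet.inv {P : ℝ → Matrix ι ι ℝ} {P₁ P₂ : Matrix ι ι ℝ}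
    (hP : MatrixHasJet P 1 P₁ P₂) :
    MatrixHasJet (fun t => (P t)⁻¹) 1 (-P₁) ((2 : ℝ) • (P₁ * P₁) - P₂) := by
  have h0 : P 0 = 1 := by ext i j; exact (hP i j).val
  have hd : (P 0).det ≠ 0 := by simp [h0]
  have hc := fun i j => HasJet.of_contDiffAt
    (contDiffAt_matrix_inv (fun i j => (hP i j).contDiffAt) hd i j)
  obtain ⟨V₀, V₁, V₂, hV⟩ : ∃ V₀ V₁ V₂, MatrixHasJet (fun t => (P t)⁻¹) V₀ V₁ V₂ :=
    ⟨Matrix.of fun i j => _, Matrix.of fun i j => _, Matrix.of fun i j => _, hc⟩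
  have hone : MatrixHasJet (fun t => (P t)⁻¹ * P t) 1 0 0 := fun i j => by
    refine (HasJet.const ((1 : Matrix ι ι ℝ) i j)).congr ?_
    have hcont : ContinuousAt (fun t => (P t).det) 0 :=
      (contDiffAt_matrix_det fun i j => (hP i j).contDiffAt).continuousAt
    filter_upwards [hcont.eventually_ne hd] with t ht
    rw [Matrix.nonsing_inv_mul _ (isUnit_iff_ne_zero.2 ht)]
  obtain ⟨e0, e1, e2⟩ := (hV.mul hP).unique hone
  rw [mul_one] at e0
  subst e0
  rw [mul_one, one_mul] at e1
  have e1' : V₁ = -P₁ := eq_neg_of_add_eq_zero_left e1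
  subst e1'
  have e2' : V₂ = (2 : ℝ) • (P₁ * P₁) - P₂ := by
    rw [mul_one, one_mul] at e2
    have := eq_neg_of_add_eq_zero_left e2
    have e3 : V₂ = -P₂ - (2 : ℝ) • (-P₁ * P₁) := by rw [← this]; abel
    rw [e3, neg_mul, smul_neg]
    abel
  subst e2'
  exact hV

end Jets

/-! ### Second derivative of the algebraic scalar curvature. -/

section SecondVariation

variable {ι : Type*} [Fintype ι] [DecidableEq ι]

/-- The scalar curvature of the invariant metric with Gram matrix `P`, for the product `t` and the
Killing form `K`. -/
def algScal (t : ι → ι → ι → ℝ) (K P : Matrix ι ι ℝ) : ℝ :=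
  -(1 / 4 : ℝ) * tensorInner (act₁ P⁻¹ (act₂ P⁻¹ (act₃ P t))) t
    - (1 / 2 : ℝ) * ∑ a, ∑ b, P⁻¹ a b * K a b

/-- The second derivative of the scalar curvature at an Einstein metric. -/
theorem hasJet_algScal {t : ι → ι → ι → ℝ} {K : Matrix ι ι ℝ} {ρ : ℝ}
    (hE : ∀ S : Matrix ι ι ℝ, S.transpose = S →
      (1 / 4 : ℝ) * tensorInner (tensorTheta ι S t) t - (1 / 2 : ℝ) * ∑ a, ∑ b, S a b * K a b
        = ρ * S.trace)
    {P : ℝ → Matrix ι ι ℝ} {B P₂ : Matrix ι ι ℝ} (hP : MatrixHasJet P 1 B P₂)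
    (hB : B.transpose = B) (hP₂ : P₂.transpose = P₂) :
    ∃ a b, HasJet (fun s => algScal t K (P s)) a b
      (-(1 / 4 : ℝ) * tensorInner (tensorTheta ι B t) (tensorTheta ι B t)
        - (1 / 2 : ℝ) * (∑ a, ∑ b, (B * B) a b * K a b) + ρ * ((B * B).trace - P₂.trace)) := by
  have hV := hP.inv
  have ht : TensorHasJet (fun _ => t) t 0 0 := fun a b k => HasJet.const _
  have h1 := (((ht.act₃ hP).act₂ hV).act₁ hV).inner t
  have h2 := HasJet.sum Finset.univ fun a => HasJet.sum Finset.univ fun b =>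
    (hV a b).mul (HasJet.const (K a b))
  have h3 := ((HasJet.const (-(1 / 4 : ℝ))).mul h1).add ((HasJet.const (-(1 / 2 : ℝ))).mul h2)
  refine ⟨_, _, (h3.congr (g := fun s => algScal t K (P s)) (Filter.Eventually.of_forall fun s => by
    simp only [algScal]; ring)).congr_jet rfl rfl ?_⟩
  have hS := hE (B * B - P₂) (by rw [Matrix.transpose_sub, Matrix.transpose_mul, hB, hP₂])
  -- The second-order coefficient of `P⁻¹`, `P⁻¹`, `P` acting on the three slots, regrouped as the
  -- square of `θ(B)` minus a term linear in `B² - P₂`. The Einstein identity `hS` evaluates the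
  -- latter together with the matching Killing term.
  have key : act₁ ((2 : ℝ) • (B * B) - P₂) (act₂ 1 (act₃ 1 t))
      + (2 : ℝ) • act₁ (-B) (act₂ (-B) (act₃ 1 t) + act₂ 1 (act₃ B t + act₃ 1 0))
      + act₁ 1 (act₂ ((2 : ℝ) • (B * B) - P₂) (act₃ 1 t)
        + (2 : ℝ) • act₂ (-B) (act₃ B t + act₃ 1 0)
        + act₂ 1 (act₃ P₂ t + (2 : ℝ) • act₃ B 0 + act₃ 1 0))
      = (act₃ (B * B) t + act₁ (B * B) t + act₂ (B * B) t
        + (2 : ℝ) • act₁ B (act₂ B t) - (2 : ℝ) • act₁ B (act₃ B t)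
        - (2 : ℝ) • act₂ B (act₃ B t)) - tensorTheta ι (B * B - P₂) t := by
    simp only [tensorTheta_apply, act₁_one, act₂_one, act₃_one, map_zero, map_neg, map_sub,
      map_add, map_smul, LinearMap.sub_apply, LinearMap.neg_apply, LinearMap.smul_apply]
    module
  have hK : ∑ a, ∑ b, (((2 : ℝ) • (B * B) - P₂) a b * K a b + 2 * ((-B) a b * 0)
      + (1 : Matrix ι ι ℝ) a b * 0)
      = ∑ a, ∑ b, (B * B) a b * K a b + ∑ a, ∑ b, (B * B - P₂) a b * K a b := by
    simp only [← Finset.sum_add_distrib]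
    refine Finset.sum_congr rfl fun a _ => Finset.sum_congr rfl fun b _ => ?_
    simp only [Matrix.sub_apply, Matrix.smul_apply, smul_eq_mul]
    ring
  rw [key, hK, LinearMap.map_sub, LinearMap.sub_apply, ← tensorInner_theta_theta hB]
  rw [Matrix.trace_sub] at hS
  linarith

end SecondVariation

/-! ### Gram matrices, orthonormal bases and the Einstein equation. -/

section GramMatrix

variable {ι : Type*} [Fintype ι] [DecidableEq ι]

open scoped MatrixOrder in
lemma Matrix.PosDef.exists_eq_mul_self {P : Matrix ι ι ℝ}
    (hP : P.PosDef) : ∃ b : Matrix ι ι ℝ, IsUnit b ∧ b.transpose = b ∧ P = b * b := by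
  obtain ⟨b, h1, h2, h3⟩ :=
    CStarAlgebra.isStrictlyPositive_iff_exists_isUnit_and_isSelfAdjoint_and_eq_mul_self.1
      hP.isStrictlyPositive
  exact ⟨b, h1, h2, h3⟩

variable {V : Type*} [AddCommGroup V] [Module ℝ V]

/-- The Gram matrix of a family of vectors. -/
def gramMatrix (β : LinearMap.BilinForm ℝ V) (e : ι → V) : Matrix ι ι ℝ :=
  Matrix.of fun i j => β (e i) (e j)

/-- The structure constants of a product with respect to a basis. -/
def structureConst (e : Module.Basis ι ℝ V) (μ : V →ₗ[ℝ] V →ₗ[ℝ] V) : ι → ι → ι → ℝ :=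
  fun a b k => e.repr (μ (e a) (e b)) k

omit [Fintype ι] [DecidableEq ι] in
lemma gramMatrix_apply (β : LinearMap.BilinForm ℝ V) (e : ι → V) (i j : ι) :
    gramMatrix β e i j = β (e i) (e j) := rfl

omit [DecidableEq ι] in
lemma form_eq_sum_gramMatrix (β : LinearMap.BilinForm ℝ V) (e : Module.Basis ι ℝ V) (x y : V) :
    β x y = ∑ i, ∑ j, e.repr x i * (e.repr y j * gramMatrix β e i j) := by
  conv_lhs => rw [← e.sum_repr x, ← e.sum_repr y]
  simp only [map_sum, map_smul, LinearMap.sum_apply, LinearMap.smul_apply, smul_eq_mul,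
    gramMatrix_apply, Finset.mul_sum]
  rw [Finset.sum_comm]
  exact Finset.sum_congr rfl fun _ _ => Finset.sum_congr rfl fun _ _ => mul_left_comm _ _ _

omit [DecidableEq ι] in
lemma posDef_gramMatrix {β : LinearMap.BilinForm ℝ V} (e : Module.Basis ι ℝ V)
    (hsymm : ∀ x y, β x y = β y x) (hpos : ∀ x, x ≠ 0 → 0 < β x x) :
    (gramMatrix β e).PosDef := by
  refine Matrix.PosDef.of_dotProduct_mulVec_pos ?_ fun x hx => ?_
  · ext i j
    simp [gramMatrix_apply, hsymm (e j)]
  · have h : e.equivFun.symm x ≠ 0 := e.equivFun.symm.map_ne_zero_iff.2 hx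
    have h2 := hpos _ h
    rw [form_eq_sum_gramMatrix β e] at h2
    have h3 : ∀ i, e.repr (e.equivFun.symm x) i = x i := fun i =>
      congrFun (e.equivFun.apply_symm_apply x) i
    simp only [h3] at h2
    simpa only [dotProduct, Matrix.mulVec, Finset.mul_sum, star_trivial, mul_comm (x _),
      Finset.sum_mul] using h2

/-- If `P = b²` with `b` symmetric, the columns of `b⁻¹` are orthonormal for `P`. Since `b⁻¹ (b⁻¹)ᵗ
= P⁻¹`, traces in the new basis are contractions with `P⁻¹`. -/
lemma exists_orthonormal_basis_of_posDef {β : LinearMap.BilinForm ℝ V} (e : Module.Basis ι ℝ V)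
    (hP : (gramMatrix β e).PosDef) :
    ∃ f : Module.Basis ι ℝ V, (∀ i j, β (f i) (f j) = if i = j then 1 else 0) ∧
      ∀ B : LinearMap.BilinForm ℝ V,
        ∑ i, B (f i) (f i) = ∑ a, ∑ b, (gramMatrix β e)⁻¹ a b * B (e a) (e b) := by
  obtain ⟨b, hu, hb, hPb⟩ := hP.exists_eq_mul_self
  have hdet : IsUnit b.det := (Matrix.isUnit_iff_isUnit_det b).1 hu
  have hC : (b⁻¹).transpose = b⁻¹ := by rw [Matrix.transpose_nonsing_inv, hb]
  have hCC : (gramMatrix β e)⁻¹ = b⁻¹ * (b⁻¹).transpose := by rw [hPb, Matrix.mul_inv_rev, hC]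
  have hCPC : (b⁻¹).transpose * (gramMatrix β e * b⁻¹) = 1 := by
    rw [hC, hPb, Matrix.mul_nonsing_inv_cancel_right _ _ hdet, Matrix.nonsing_inv_mul _ hdet]
  let f := e.map (Matrix.toLinearEquiv e b⁻¹ (by simpa using hdet))
  have hf : ∀ i, f i = ∑ a, b⁻¹ a i • e a := fun i => Matrix.toLin_self e e b⁻¹ i
  have hB : ∀ (B : LinearMap.BilinForm ℝ V) i j,
      B (f i) (f j) = ∑ a, ∑ c, b⁻¹ a i * (b⁻¹ c j * B (e a) (e c)) := fun B i j => by
    rw [hf, hf]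
    simp only [map_sum, map_smul, LinearMap.sum_apply, LinearMap.smul_apply, smul_eq_mul,
      Finset.mul_sum]
    rw [Finset.sum_comm]
    exact Finset.sum_congr rfl fun _ _ => Finset.sum_congr rfl fun _ _ => by ring
  refine ⟨f, fun i j => ?_, fun B => ?_⟩
  · rw [hB, ← Matrix.one_apply, ← hCPC, Matrix.mul_apply]
    simp only [Matrix.mul_apply, Finset.mul_sum, Matrix.transpose_apply, gramMatrix_apply,
      mul_comm]
  · simp only [hB, hCC, Matrix.mul_apply, Finset.sum_mul, Matrix.transpose_apply]
    rw [Finset.sum_comm]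
    refine Finset.sum_congr rfl fun a _ => ?_
    rw [Finset.sum_comm]
    simp only [mul_assoc]

-- The trace hypothesis is applied once for each input of `μ`, giving two factors `P`; expanding the
-- norm of the output gives the Gram matrix in the third slot.
omit [DecidableEq ι] in
lemma sum_norm_product_eq {β : LinearMap.BilinForm ℝ V} {P : Matrix ι ι ℝ}
    {e f : Module.Basis ι ℝ V}
    (hf : ∀ B : LinearMap.BilinForm ℝ V, ∑ i, B (f i) (f i) = ∑ a, ∑ b, P a b * B (e a) (e b))
    (μ : V →ₗ[ℝ] V →ₗ[ℝ] V) :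
    ∑ i, ∑ j, β (μ (f i) (f j)) (μ (f i) (f j))
      = tensorInner (act₁ P (act₂ P (act₃ (gramMatrix β e) (structureConst e μ))))
        (structureConst e μ) := by
  have h1 : ∀ x, ∑ j, β (μ x (f j)) (μ x (f j))
      = ∑ c, ∑ d, P c d * β (μ x (e c)) (μ x (e d)) := fun x =>
    hf (β.compl₁₂ (μ x) (μ x))
  simp only [h1]
  have h2 : ∀ c d, ∑ i, β (μ (f i) (e c)) (μ (f i) (e d))
      = ∑ a, ∑ b, P a b * β (μ (e a) (e c)) (μ (e b) (e d)) := fun c d =>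
    hf (β.compl₁₂ (μ.flip (e c)) (μ.flip (e d)))
  rw [Finset.sum_comm]
  have h3 : ∀ c, ∑ i, ∑ d, P c d * β (μ (f i) (e c)) (μ (f i) (e d))
      = ∑ d, ∑ a, ∑ b, P c d * (P a b * β (μ (e a) (e c)) (μ (e b) (e d))) := fun c => by
    rw [Finset.sum_comm]
    refine Finset.sum_congr rfl fun d _ => ?_
    rw [← Finset.mul_sum, h2]
    simp only [Finset.mul_sum]
  simp only [h3]
  simp only [form_eq_sum_gramMatrix β e (μ _ _)]
  simp only [tensorInner_apply, act₁_apply, act₂_apply, act₃_apply, structureConst,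
    Finset.mul_sum, Finset.sum_mul]
  simp only [← Finset.sum_product']
  refine Finset.sum_bij' (fun q _ => (q.2.2.1, q.1, q.2.2.2.2.1, q.2.2.2.1, q.2.1, q.2.2.2.2.2))
    (fun q _ => (q.2.1, q.2.2.2.2.1, q.1, q.2.2.2.1, q.2.2.1, q.2.2.2.2.2)) ?_ ?_ ?_ ?_ ?_ <;>
    simp
  intros
  ring

/-- The scalar curvature functional in terms of an orthonormal basis. -/
lemma sum_eq_algScal {β κ : LinearMap.BilinForm ℝ V} {e f : Module.Basis ι ℝ V}
    (hf : ∀ B : LinearMap.BilinForm ℝ V,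
        ∑ i, B (f i) (f i) = ∑ a, ∑ b, (gramMatrix β e)⁻¹ a b * B (e a) (e b))
    (μ : V →ₗ[ℝ] V →ₗ[ℝ] V) :
    -(1 / 4 : ℝ) * ∑ i, ∑ j, β (μ (f i) (f j)) (μ (f i) (f j)) - (1 / 2 : ℝ) * ∑ i, κ (f i) (f i)
      = algScal (structureConst e μ) (gramMatrix κ e) (gramMatrix β e) := by
  rw [algScal, sum_norm_product_eq hf, hf κ]
  rfl

lemma form_basis_right {β : LinearMap.BilinForm ℝ V} {e : Module.Basis ι ℝ V}
    (he : ∀ i j, β (e i) (e j) = if i = j then 1 else 0) (x : V) (i : ι) :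
    β x (e i) = e.repr x i := by
  conv_lhs => rw [← e.sum_repr x]
  simp only [map_sum, map_smul, LinearMap.sum_apply, LinearMap.smul_apply, smul_eq_mul, he]
  simp

/-- The Einstein equation in terms of structure constants. -/
lemma einstein_structureConst {β κ : LinearMap.BilinForm ℝ V} {e : Module.Basis ι ℝ V}
    (he : ∀ i j, β (e i) (e j) = if i = j then 1 else 0) (hκ : ∀ x y, κ x y = κ y x)
    {μ : V →ₗ[ℝ] V →ₗ[ℝ] V} (hμ : ∀ x y, μ x y = -μ y x) {ρ : ℝ}
    (hE : ∀ x, ρ * β x x = -(1 / 2 : ℝ) * κ x x - (1 / 2 : ℝ) * ∑ i, ∑ j, β (e i) (μ x (e j)) ^ 2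
      + (1 / 4 : ℝ) * ∑ i, ∑ j, β (μ (e i) (e j)) x ^ 2) (S : Matrix ι ι ℝ) :
    (1 / 4 : ℝ) * tensorInner (tensorTheta ι S (structureConst e μ)) (structureConst e μ)
      - (1 / 2 : ℝ) * ∑ a, ∑ b, S a b * gramMatrix κ e a b = ρ * S.trace := by
  have hl : ∀ i x, β (e i) x = e.repr x i := fun i x => by
    conv_lhs => rw [← e.sum_repr x]
    simp only [map_sum, map_smul, smul_eq_mul, he]
    simp
  have hr : ∀ i x, β x (e i) = e.repr x i := fun i x => form_basis_right he x i
  set t := structureConst e μ with ht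
  -- Polarization of the quadratic Einstein equation, from its values at `e a`, `e b` and `e a + e
  -- b`.
  have hR : ∀ a b, ρ * (if a = b then 1 else 0) = -(1 / 2 : ℝ) * κ (e a) (e b)
      - (1 / 2 : ℝ) * ∑ i, ∑ j, t a j i * t b j i + (1 / 4 : ℝ) * ∑ i, ∑ j, t i j a * t i j b :=
    fun a b => by
      have ha := hE (e a)
      have hb := hE (e b)
      have hab := hE (e a + e b)
      simp only [map_add, LinearMap.add_apply, hl, hr, hκ (e b) (e a), add_sq,
        Finset.sum_add_distrib, mul_assoc, ← Finset.mul_sum] at ha hb hab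
      have hb' : e.repr (e b) a = if a = b then 1 else 0 := by
        rw [e.repr_self_apply]; simp only [eq_comm]
      simp only [e.repr_self_apply a b, hb', Finsupp.add_apply, add_sq, mul_assoc,
        Finset.sum_add_distrib, ← Finset.mul_sum] at hab
      simp only [ht, structureConst]
      linarith
  have h1 : tensorInner (act₁ S t) t = ∑ a, ∑ b, S a b * ∑ i, ∑ j, t a j i * t b j i := by
    simp only [tensorInner_apply, act₁_apply, Finset.sum_mul, Finset.mul_sum]
    simp only [← Finset.sum_product']
    refine Finset.sum_bij' (fun q _ => (q.1, q.2.2.2, q.2.2.1, q.2.1))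
      (fun q _ => (q.1, q.2.2.2, q.2.2.1, q.2.1)) ?_ ?_ ?_ ?_ ?_ <;> simp
    intros
    ring
  -- Skew-symmetry makes both inputs contribute equally, which accounts for the coefficient `2 *
  -- (1/4) = 1/2` of the first Ricci sum.
  have h2 : tensorInner (act₂ S t) t = tensorInner (act₁ S t) t := by
    have hskew : ∀ a b k, t a b k = -t b a k := fun a b k => by
      simp [ht, structureConst, hμ (e a) (e b)]
    simp only [tensorInner_apply, act₁_apply, act₂_apply]
    rw [Finset.sum_comm]
    refine Finset.sum_congr rfl fun a _ => Finset.sum_congr rfl fun b _ =>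
      Finset.sum_congr rfl fun k _ => ?_
    rw [hskew b a k, mul_neg, ← neg_mul, ← Finset.sum_neg_distrib]
    congr 1
    refine Finset.sum_congr rfl fun c _ => ?_
    rw [hskew b c k, mul_neg, neg_neg]
  have h3 : tensorInner (act₃ S t) t = ∑ a, ∑ b, S a b * ∑ i, ∑ j, t i j a * t i j b := by
    simp only [tensorInner_apply, act₃_apply, Finset.sum_mul, Finset.mul_sum]
    simp only [← Finset.sum_product']
    refine Finset.sum_bij' (fun q _ => (q.2.2.1, q.2.2.2, q.1, q.2.1))
      (fun q _ => (q.2.2.1, q.2.2.2, q.1, q.2.1)) ?_ ?_ ?_ ?_ ?_ <;> simp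
    intros
    ring
  have h4 : ρ * S.trace = ∑ a, ∑ b, S a b * (ρ * if a = b then 1 else 0) := by
    simp [Matrix.trace, Finset.mul_sum, mul_comm]
  rw [h4, tensorTheta_apply]
  simp only [map_sub, LinearMap.sub_apply, h2, h1, h3, hR, gramMatrix_apply, mul_add, mul_sub,
    Finset.sum_add_distrib, Finset.sum_sub_distrib, mul_left_comm (S _ _), ← Finset.mul_sum]
  ring

end GramMatrix

/-! ### Jacobi's formula and the determinant constraint. -/

section Determinant

variable {ι : Type*} [Fintype ι] [DecidableEq ι]

/-- By the chain rule the derivative depends only on `D`, so it can be read off on the line `1 + t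
D`, where the determinant is an explicit polynomial in `t`. -/
lemma hasDerivAt_det_of_eq_one {H : ℝ → Matrix ι ι ℝ} {D : Matrix ι ι ℝ} {x : ℝ}
    (hH : ∀ i j, HasDerivAt (fun t => H t i j) (D i j) x) (hx : H x = 1) :
    HasDerivAt (fun t => (H t).det) D.trace x := by
  let d : (ι → ι → ℝ) → ℝ := fun m => (Matrix.of m).det
  have hd : Differentiable ℝ d := by
    have : ContDiff ℝ 1 d := by
      simp only [d, Matrix.det_apply]
      exact ContDiff.sum fun σ _ => (contDiff_prod fun i _ =>
        (contDiff_apply_apply ℝ ℝ (σ i) i)).const_smul _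
    exact this.differentiable one_ne_zero
  have key : ∀ {K : ℝ → Matrix ι ι ℝ} {y : ℝ}, (∀ i j, HasDerivAt (fun t => K t i j) (D i j) y) →
      K y = 1 → HasDerivAt (fun t => (K t).det) (fderiv ℝ d (1 : Matrix ι ι ℝ) D) y :=
    fun {K y} hK hy => by
      have h1 : HasDerivAt (fun t => (K t : ι → ι → ℝ)) (D : ι → ι → ℝ) y :=
        hasDerivAt_pi.2 fun i => hasDerivAt_pi.2 fun j => hK i j
      have h2 := (hd (K y)).hasFDerivAt.comp_hasDerivAt y h1
      rw [hy] at h2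
      exact h2
  have h1 : HasDerivAt (fun t : ℝ => ((1 : Matrix ι ι ℝ) + t • D).det)
      (fderiv ℝ d (1 : Matrix ι ι ℝ) D) 0 := by
    refine key (fun i j => ?_) (by simp)
    simpa using ((hasDerivAt_id (0 : ℝ)).mul_const (D i j)).const_add ((1 : Matrix ι ι ℝ) i j)
  have h2 : HasDerivAt (fun t : ℝ => ((1 : Matrix ι ι ℝ) + t • D).det) D.trace 0 := by
    rw [funext fun t : ℝ => Matrix.det_one_add_smul t D]
    have h3 := (((hasDerivAt_id (0 : ℝ)).const_mul D.trace).const_add 1).add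
      ((Polynomial.hasDerivAt (Polynomial.divX (Polynomial.divX
        (1 + (Polynomial.X : Polynomial ℝ) • D.map Polynomial.C).det)) 0).mul
        (hasDerivAt_pow 2 (0 : ℝ)))
    exact h3.congr_deriv (by simp)
  rw [← h1.unique h2]
  exact key hH hx

/-- Multiplying the curve by the fixed matrix `(H x)⁻¹` reduces this to a curve through the
identity. -/
lemma hasDerivAt_det {H : ℝ → Matrix ι ι ℝ} {D : Matrix ι ι ℝ} {x : ℝ}
    (hH : ∀ i j, HasDerivAt (fun t => H t i j) (D i j) x) (hx : (H x).det ≠ 0) :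
    HasDerivAt (fun t => (H t).det) ((H x).det * ((H x)⁻¹ * D).trace) x := by
  have h1 : HasDerivAt (fun t => ((H x)⁻¹ * H t).det) ((H x)⁻¹ * D).trace x := by
    refine hasDerivAt_det_of_eq_one (fun i j => ?_)
      (Matrix.nonsing_inv_mul _ (isUnit_iff_ne_zero.2 hx))
    simp only [Matrix.mul_apply]
    exact HasDerivAt.fun_sum fun k _ => (hH k j).const_mul _
  have h2 := h1.const_mul (H x).det
  refine h2.congr_of_eventuallyEq (Filter.Eventually.of_forall fun t => ?_)
  simp only [Matrix.det_mul, Matrix.det_nonsing_inv, Ring.inverse_eq_inv']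
  field_simp

/-- The second derivative of a curve of matrices whose determinant is an exponential. -/
lemma trace_second_deriv_of_det_eq_exp {H : ℝ → Matrix ι ι ℝ} {B H₂ : Matrix ι ι ℝ}
    (hH : MatrixHasJet H 1 B H₂) (hdet : ∀ᶠ t in 𝓝 (0 : ℝ), (H t).det = Real.exp (t * B.trace)) :
    H₂.trace = (B * B).trace := by
  let D : ℝ → Matrix ι ι ℝ := fun t => Matrix.of fun i j => deriv (fun s => H s i j) t
  -- Jacobi's formula turns the determinant condition into constancy of `tr(H⁻¹ H')` near zero. Its
  -- derivative at zero is `tr H₂ - tr B²`, which must vanish.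
  have hev : ∀ᶠ t in 𝓝 (0 : ℝ), ((H t)⁻¹ * D t).trace = B.trace := by
    have hdiff : ∀ᶠ t in 𝓝 (0 : ℝ), ∀ i j, ContDiffAt ℝ 2 (fun s => H s i j) t :=
      Filter.eventually_all.2 fun i => Filter.eventually_all.2 fun j =>
        (hH i j).contDiffAt.eventually (by simp)
    filter_upwards [hdiff, hdet.eventually_nhds] with t ht hdt
    have hpos : (H t).det ≠ 0 := by rw [hdt.self_of_nhds]; exact (Real.exp_pos _).ne'
    have h1 := hasDerivAt_det (H := H) (D := D t) (x := t)
      (fun i j => ((ht i j).differentiableAt (by simp)).hasDerivAt) hpos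
    have h2 : HasDerivAt (fun s => (H s).det) (Real.exp (t * B.trace) * (1 * B.trace)) t :=
      (((hasDerivAt_id t).mul_const B.trace).exp).congr_of_eventuallyEq hdt
    have h3 := h1.unique h2
    rw [hdt.self_of_nhds, one_mul] at h3
    exact mul_left_cancel₀ (Real.exp_pos _).ne' h3
  have hV := hH.inv
  have hD : ∀ i j, HasDerivAt (fun t => D t i j) (H₂ i j) 0 := fun i j => by
    have h1 : DifferentiableAt ℝ (deriv fun s => H s i j) 0 :=
      (ContDiffAt.derivWithin (m := 1) (hH i j).contDiffAt (by norm_num)).differentiableAt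
        one_ne_zero
    have h2 := h1.hasDerivAt
    rw [← (hH i j).deriv2_eq, iteratedDeriv_succ, iteratedDeriv_one]
    exact h2
  have hW : ∀ i j, HasDerivAt (fun t => (H t)⁻¹ i j) (-B i j) 0 := fun i j => by
    have h := ((hV i j).contDiffAt.differentiableAt (by simp)).hasDerivAt
    rw [(hV i j).deriv_eq] at h
    exact h
  have hT : HasDerivAt (fun t => ((H t)⁻¹ * D t).trace)
      (∑ i, ∑ j, (-B i j * D 0 j i + (H 0)⁻¹ i j * H₂ j i)) 0 := by
    simp only [Matrix.trace, Matrix.diag_apply, Matrix.mul_apply]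
    exact HasDerivAt.fun_sum fun i _ => HasDerivAt.fun_sum fun j _ => (hW i j).mul (hD j i)
  have h0 := hT.unique ((hasDerivAt_const 0 B.trace).congr_of_eventuallyEq hev)
  have hD0 : ∀ i j, D 0 i j = B i j := fun i j => (hH i j).deriv_eq
  have hH0 : H 0 = 1 := by ext i j; exact (hH i j).val
  simp only [hD0, hH0, inv_one, Finset.sum_add_distrib, neg_mul, Finset.sum_neg_distrib] at h0
  have h1 : ∑ i, ∑ j, (1 : Matrix ι ι ℝ) i j * H₂ j i = H₂.trace := by
    simp [Matrix.one_apply, Matrix.trace]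
  have h2 : ∑ i, ∑ j, B i j * B j i = (B * B).trace := by
    simp [Matrix.mul_apply, Matrix.trace]
  rw [h1, h2] at h0
  linarith

end Determinant

/-! ### The operators `M` and `L` in terms of structure constants. -/

section Operators

variable {V : Type*} [AddCommGroup V] [Module ℝ V] {ι : Type*} [Fintype ι] [DecidableEq ι]
  (e : Module.Basis ι ℝ V)

lemma innerOp_eq_trace (X Y : Module.End ℝ V) :
    innerOp e X Y
      = (LinearMap.toMatrix e e X * (LinearMap.toMatrix e e Y).transpose).trace := by
  rw [innerOp, LinearMap.trace_eq_matrix_trace ℝ e, LinearMap.toMatrix_mul, transposeOp,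
    LinearMap.toMatrix_toLin]

lemma innerOp_add_left (X X' Y : Module.End ℝ V) :
    innerOp e (X + X') Y = innerOp e X Y + innerOp e X' Y := by
  simp [innerOp, add_mul]

lemma innerOp_sub_left (X X' Y : Module.End ℝ V) :
    innerOp e (X - X') Y = innerOp e X Y - innerOp e X' Y := by
  simp [innerOp, sub_mul]

lemma innerOp_smul_left (r : ℝ) (X Y : Module.End ℝ V) :
    innerOp e (r • X) Y = r * innerOp e X Y := by
  simp [innerOp]

lemma innerOp_comm (X Y : Module.End ℝ V) : innerOp e X Y = innerOp e Y X := by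
  rw [innerOp_eq_trace, innerOp_eq_trace, ← Matrix.trace_transpose, Matrix.transpose_mul,
    Matrix.transpose_transpose]

lemma transposeOp_eq_self {A : Module.End ℝ V}
    (hA : (LinearMap.toMatrix e e A).transpose = LinearMap.toMatrix e e A) :
    transposeOp e A = A := by
  rw [transposeOp, hA, Matrix.toLin_toMatrix]

lemma innerOp_symmPart {A : Module.End ℝ V} (hA : transposeOp e A = A) (X : Module.End ℝ V) :
    innerOp e (symmPart e X) A = innerOp e X A := by
  have h : innerOp e (transposeOp e X) A = innerOp e X A := by
    rw [innerOp_comm, innerOp, transposeOp, transposeOp, LinearMap.toMatrix_toLin,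
      Matrix.transpose_transpose, Matrix.toLin_toMatrix, innerOp, hA, LinearMap.trace_mul_comm]
  rw [symmPart, innerOp_smul_left, innerOp_add_left, h]
  ring

lemma innerOp_rieszOp (f : Module.End ℝ V →ₗ[ℝ] ℝ) (X : Module.End ℝ V) :
    innerOp e (rieszOp e f) X = f X := by
  rw [innerOp_eq_trace, rieszOp, LinearMap.toMatrix_toLin]
  conv_rhs => rw [← Matrix.toLin_toMatrix e e X,
    Matrix.matrix_eq_sum_single (LinearMap.toMatrix e e X)]
  simp only [Matrix.trace, Matrix.diag_apply, Matrix.mul_apply, Matrix.transpose_apply,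
    Matrix.of_apply, map_sum]
  refine Finset.sum_congr rfl fun i _ => Finset.sum_congr rfl fun j _ => ?_
  rw [← mul_one (LinearMap.toMatrix e e X i j), ← smul_eq_mul _ (1 : ℝ), ← Matrix.smul_single,
    map_smul, map_smul, smul_eq_mul, smul_eq_mul, mul_one, mul_comm]

omit [DecidableEq ι] in
lemma innerProd_eq_tensorInner (l l' : V →ₗ[ℝ] V →ₗ[ℝ] V) :
    innerProd e l l' = tensorInner (structureConst e l) (structureConst e l') := rfl

/-- The inputs are acted on by the transposed matrix of `C` and the output by the matrix itself;
symmetry lets one matrix serve all three slots. -/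
lemma structureConst_theta {C : Module.End ℝ V}
    (hC : (LinearMap.toMatrix e e C).transpose = LinearMap.toMatrix e e C)
    (l : V →ₗ[ℝ] V →ₗ[ℝ] V) :
    structureConst e (theta C l)
      = tensorTheta ι (LinearMap.toMatrix e e C) (structureConst e l) := by
  have h1 : ∀ a, C (e a) = ∑ c, LinearMap.toMatrix e e C a c • e c := fun a => by
    refine (e.sum_repr (C (e a))).symm.trans (Finset.sum_congr rfl fun c _ => ?_)
    rw [← hC, Matrix.transpose_apply, LinearMap.toMatrix_apply]
  have h2 : ∀ v k, e.repr (C v) k = ∑ c, LinearMap.toMatrix e e C k c * e.repr v c := fun v k => by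
    rw [← LinearMap.toMatrix_mulVec_repr e e]
    rfl
  ext a b k
  simp only [structureConst, tensorTheta_apply, Pi.sub_apply, act₁_apply, act₂_apply, act₃_apply]
  simp only [theta, LinearMap.sub_apply, LinearMap.compr₂_apply, LinearMap.comp_apply,
    LinearMap.compl₂_apply, map_sub, Finsupp.sub_apply, h2]
  simp [h1]

lemma innerOp_momentMap {C : Module.End ℝ V}
    (hC : (LinearMap.toMatrix e e C).transpose = LinearMap.toMatrix e e C)
    (l : V →ₗ[ℝ] V →ₗ[ℝ] V) :
    innerOp e (momentMap e l) C = (1 / 4 : ℝ) * tensorInner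
      (tensorTheta ι (LinearMap.toMatrix e e C) (structureConst e l)) (structureConst e l) := by
  let f : Module.End ℝ V →ₗ[ℝ] ℝ :=
    { toFun := fun A => (1 / 4 : ℝ) * innerProd e (theta A l) l
      map_add' := fun A B => by
        simp [innerProd, theta, add_mul, sub_mul, Finset.sum_add_distrib, Finset.sum_sub_distrib]
        ring
      map_smul' := fun r A => by
        simp [innerProd, theta, sub_mul, Finset.sum_sub_distrib, mul_assoc, ← Finset.mul_sum]
        ring }
  have h := innerOp_rieszOp e f C
  rw [← structureConst_theta e hC, ← innerProd_eq_tensorInner]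
  exact h

lemma innerOp_deltaTransposeOp (l l' : V →ₗ[ℝ] V →ₗ[ℝ] V) (C : Module.End ℝ V) :
    innerOp e (deltaTransposeOp e l l') C = innerProd e l' (deltaOp l C) := by
  let f : Module.End ℝ V →ₗ[ℝ] ℝ :=
    { toFun := fun A => innerProd e l' (deltaOp l A)
      map_add' := fun A B => by
        simp [innerProd, deltaOp, theta, mul_add, mul_sub,
          Finset.sum_add_distrib, Finset.sum_sub_distrib]
        ring
      map_smul' := fun r A => by
        simp [innerProd, deltaOp, theta, mul_sub, Finset.sum_sub_distrib, mul_left_comm,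
          ← Finset.mul_sum] }
  exact innerOp_rieszOp e f C

/-- Against the symmetric `A` the symmetrization drops out and `δᵗδ` gives the squared norm of
`θ(A)l`; cyclicity of the trace turns `AM + MA` into `2⟨M, A²⟩`. -/
lemma innerOp_lichOp {A : Module.End ℝ V}
    (hA : (LinearMap.toMatrix e e A).transpose = LinearMap.toMatrix e e A)
    (l : V →ₗ[ℝ] V →ₗ[ℝ] V) :
    innerOp e (lichOp e l A) A
      = (1 / 2 : ℝ) * innerProd e (theta A l) (theta A l)
        + (1 / 2 : ℝ) * tensorInner (tensorTheta ι
          (LinearMap.toMatrix e e A * LinearMap.toMatrix e e A) (structureConst e l))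
          (structureConst e l) := by
  have hA' := transposeOp_eq_self e hA
  have hAA : (LinearMap.toMatrix e e (A * A)).transpose = LinearMap.toMatrix e e (A * A) := by
    rw [LinearMap.toMatrix_mul, Matrix.transpose_mul, hA]
  have h1 : innerProd e (deltaOp l A) (deltaOp l A) = innerProd e (theta A l) (theta A l) := by
    simp [innerProd, deltaOp]
  have h2 : innerOp e (A * momentMap e l) A = innerOp e (momentMap e l) (A * A) := by
    rw [innerOp, innerOp, hA', transposeOp_eq_self e hAA, mul_assoc, LinearMap.trace_mul_comm,
      mul_assoc]
  have h3 : innerOp e (momentMap e l * A) A = innerOp e (momentMap e l) (A * A) := by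
    rw [innerOp, innerOp, hA', transposeOp_eq_self e hAA, mul_assoc]
  rw [lichOp, innerOp_add_left, innerOp_add_left, innerOp_smul_left, innerOp_symmPart e hA',
    innerOp_deltaTransposeOp, h1, h2, h3, innerOp_momentMap e hAA, LinearMap.toMatrix_mul]
  ring

end Operators

/-! ### Positivity of small perturbations. -/

section QuadraticPerturbation

variable {V : Type*} [AddCommGroup V] [Module ℝ V] {ι : Type*} [Fintype ι] [DecidableEq ι]

/-- Small symmetric perturbations of an inner product are positive definite. -/
lemma eventually_pos_add_smul {β τ : LinearMap.BilinForm ℝ V} {e : Module.Basis ι ℝ V}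
    (he : ∀ i j, β (e i) (e j) = if i = j then 1 else 0) :
    ∀ᶠ t in 𝓝 (0 : ℝ), ∀ x, x ≠ 0 → 0 < β x x + t * τ x x := by
  -- Coordinates satisfy `|x_i x_j| ≤ |x|²`, so this entrywise sum bounds `|τ x x|` by `C * β x x`,
  -- uniformly in `x`.
  set C : ℝ := ∑ i, ∑ j, |gramMatrix τ e i j| with hC
  have hC0 : 0 ≤ C := Finset.sum_nonneg fun i _ => Finset.sum_nonneg fun j _ => abs_nonneg _
  have hev : ∀ᶠ t in 𝓝 (0 : ℝ), |t| * C < 1 := by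
    have h : Filter.Tendsto (fun t : ℝ => |t| * C) (𝓝 0) (𝓝 (|0| * C)) :=
      (continuous_abs.mul continuous_const).tendsto 0
    exact h.eventually_lt_const (by simp)
  filter_upwards [hev] with t ht x hx
  have hβ : β x x = ∑ i, e.repr x i ^ 2 := by
    rw [form_eq_sum_gramMatrix β e]
    simp [gramMatrix_apply, he, sq]
  have hpos : 0 < ∑ i, e.repr x i ^ 2 := by
    refine lt_of_le_of_ne (Finset.sum_nonneg fun i _ => sq_nonneg _) fun h => hx ?_
    have h2 := (Finset.sum_eq_zero_iff_of_nonneg fun i _ => sq_nonneg (e.repr x i)).1 h.symm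
    refine e.ext_elem fun i => ?_
    simpa using h2 i (Finset.mem_univ i)
  have hle : ∀ i, e.repr x i ^ 2 ≤ ∑ i, e.repr x i ^ 2 := fun i =>
    Finset.single_le_sum (f := fun i => e.repr x i ^ 2) (fun i _ => sq_nonneg _)
      (Finset.mem_univ i)
  have hτ : |τ x x| ≤ C * ∑ i, e.repr x i ^ 2 := by
    rw [form_eq_sum_gramMatrix τ e, hC, Finset.sum_mul]
    refine (Finset.abs_sum_le_sum_abs _ _).trans (Finset.sum_le_sum fun i _ => ?_)
    rw [Finset.sum_mul]
    refine (Finset.abs_sum_le_sum_abs _ _).trans (Finset.sum_le_sum fun j _ => ?_)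
    rw [← mul_assoc, abs_mul, mul_comm]
    refine mul_le_mul_of_nonneg_left ?_ (abs_nonneg _)
    rw [abs_le]
    constructor <;> nlinarith [hle i, hle j, sq_nonneg (e.repr x i + e.repr x j),
      sq_nonneg (e.repr x i - e.repr x j)]
  have h1 : |t * τ x x| ≤ (|t| * C) * ∑ i, e.repr x i ^ 2 := by
    rw [abs_mul, mul_assoc]
    exact mul_le_mul_of_nonneg_left hτ (abs_nonneg _)
  have h2 := neg_abs_le (t * τ x x)
  rw [hβ]
  nlinarith

end QuadraticPerturbation

/-! ### Scalar curvature and the Einstein equation of invariant metrics, algebraically. -/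

section HomogeneousEinstein

set_option maxSynthPendingDepth 3

variable {F : Type*} [NormedAddCommGroup F] [NormedSpace ℝ F]
  {G : Type*} [TopologicalSpace G] [ChartedSpace F G] [Group G] [LieGroup 𝓘(ℝ, F) ∞ G]
  {E : Type*} [NormedAddCommGroup E] [NormedSpace ℝ E]
  {M : Type*} [TopologicalSpace M] [ChartedSpace E M]
  [IsManifold 𝓘(ℝ, E) ∞ M]
  [MulAction G M] [ContMDiffSMul 𝓘(ℝ, F) 𝓘(ℝ, E) ∞ G M] [CompleteSpace F] [FiniteDimensional ℝ E]

variable {γ T : TwoTensorField E M} {o : M} {p : Submodule ℝ (GroupLieAlgebra 𝓘(ℝ, F) G)}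
  {ι : Type*} [Fintype ι] [DecidableEq ι]

variable (γ o p) in
/-- The bilinear form on `𝔭` which corresponds to a field of bilinear forms. -/
def formBilin : LinearMap.BilinForm ℝ p :=
  LinearMap.compl₁₂ (γ.formAt o) (orbitMap F G E o ∘ₗ p.subtype) (orbitMap F G E o ∘ₗ p.subtype)

/-- The restriction of the Killing form to `𝔭`. -/
def killingBilin (p : Submodule ℝ (GroupLieAlgebra 𝓘(ℝ, F) G)) : LinearMap.BilinForm ℝ p :=
  LinearMap.compl₁₂ (killingForm ℝ (GroupLieAlgebra 𝓘(ℝ, F) G)) p.subtype p.subtype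

omit [IsManifold 𝓘(ℝ, E) ∞ M] [ContMDiffSMul 𝓘(ℝ, F) 𝓘(ℝ, E) ∞ G M] [FiniteDimensional ℝ E] in
lemma exists_orbitMap_eq (hp : IsReductiveComplement E o p)
    (hsub : Function.Surjective (orbitMap F G E o)) (v : E) :
    ∃ X : p, orbitMap F G E o X = v := by
  obtain ⟨X, rfl⟩ := hsub v
  exact ⟨p.projectionOnto _ hp.isCompl X,
    image_projectionOnto (φ := orbitMap F G E o) hp.isCompl X⟩

omit [IsManifold 𝓘(ℝ, E) ∞ M] [ContMDiffSMul 𝓘(ℝ, F) 𝓘(ℝ, E) ∞ G M] [FiniteDimensional ℝ E] in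
lemma formAt_pos_of_formOn_pos (hp : IsReductiveComplement E o p)
    (hsub : Function.Surjective (orbitMap F G E o))
    (hpos : ∀ X : p, X ≠ 0 → 0 < formOn o p γ X X) (v : E) (hv : v ≠ 0) :
    0 < γ.formAt o v v := by
  obtain ⟨X, rfl⟩ := exists_orbitMap_eq hp hsub v
  refine hpos X fun h => hv ?_
  rw [h, Submodule.coe_zero, map_zero]

omit [LieGroup 𝓘(ℝ, F) ∞ G] [IsManifold 𝓘(ℝ, E) ∞ M] [ContMDiffSMul 𝓘(ℝ, F) 𝓘(ℝ, E) ∞ G M]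
  [CompleteSpace F] [FiniteDimensional ℝ E] in
lemma orbitMap_ne_zero (hp : IsReductiveComplement E o p) {X : p} (hX : X ≠ 0) :
    orbitMap F G E o X ≠ 0 := fun h => hX <| Subtype.ext <|
  Submodule.disjoint_def.1 hp.isCompl.disjoint _ X.2 (LinearMap.mem_ker.2 h)

variable [FiniteDimensional ℝ F]

/-- The scalar curvature of an invariant metric in terms of its Gram matrix. -/
theorem scalarCurvature_eq_algScal (hγ : IsInvariantSymmTensor G γ)
    (hunim : ∀ X : GroupLieAlgebra 𝓘(ℝ, F) G,
      LinearMap.trace ℝ _ (LieAlgebra.ad ℝ (GroupLieAlgebra 𝓘(ℝ, F) G) X) = 0)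
    (hsub : Function.Surjective (orbitMap F G E o)) (hp : IsReductiveComplement E o p)
    (hpos : ∀ X : p, X ≠ 0 → 0 < formOn o p γ X X) (e : Module.Basis ι ℝ p) :
    scalarCurvature γ o = algScal (structureConst e (bracketOn hp)) (gramMatrix (killingBilin p) e)
      (gramMatrix (formBilin γ o p) e) := by
  have hsymm : ∀ X Y, formBilin γ o p X Y = formBilin γ o p Y X := fun X Y => hγ.symm o _ _
  obtain ⟨f, hf, hB⟩ := exists_orthonormal_basis_of_posDef e (posDef_gramMatrix e hsymm hpos)
  rw [← sum_eq_algScal hB (κ := killingBilin p) (bracketOn hp)]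
  exact scalarCurvature_eq_sum hγ (formAt_pos_of_formOn_pos hp hsub hpos) hunim hsub hp f hf

omit [FiniteDimensional ℝ F] [IsManifold 𝓘(ℝ, E) ∞ M] [ContMDiffSMul 𝓘(ℝ, F) 𝓘(ℝ, E) ∞ G M]
  [FiniteDimensional ℝ E] in
lemma bracketOn_skew (hp : IsReductiveComplement E o p) (X Y : p) :
    bracketOn hp X Y = -bracketOn hp Y X := by
  change p.projectionOnto _ hp.isCompl _ = -(p.projectionOnto _ hp.isCompl _)
  rw [← map_neg, lie_skew]

/-- The Einstein equation in terms of structure constants. -/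
theorem einstein_identity (hγ : IsInvariantMetric G γ)
    (hunim : ∀ X : GroupLieAlgebra 𝓘(ℝ, F) G,
      LinearMap.trace ℝ _ (LieAlgebra.ad ℝ (GroupLieAlgebra 𝓘(ℝ, F) G) X) = 0)
    (hsub : Function.Surjective (orbitMap F G E o)) (hp : IsReductiveComplement E o p) {ρ : ℝ}
    (hE : ∀ v w : TangentSpace 𝓘(ℝ, E) o, ricciTensor γ o v w = ρ * γ o v w)
    (e : Module.Basis ι ℝ p)
    (he : ∀ i j, formOn o p γ (e i) (e j) = if i = j then 1 else 0) (S : Matrix ι ι ℝ) :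
    (1 / 4 : ℝ) * tensorInner (tensorTheta ι S (structureConst e (bracketOn hp)))
        (structureConst e (bracketOn hp))
      - (1 / 2 : ℝ) * ∑ a, ∑ b, S a b * gramMatrix (killingBilin p) e a b = ρ * S.trace := by
  refine einstein_structureConst (β := formBilin γ o p) he
    (fun X Y => LieModule.traceForm_comm ℝ _ _ _ _) (bracketOn_skew hp) (fun X => ?_) S
  have h1 := localRicci_orbitMap hγ.toIsInvariantSymmTensor
    (fun v hv => hγ.pos o v hv) hunim hsub hp e he X
  refine Eq.trans ?_ h1
  have h2 := hE (orbitDeriv F G E o X) (orbitDeriv F G E o X)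
  refine h2.symm.trans ?_
  -- `ricciTensor` moves vectors by the derivative of the preferred chart, which at its own base
  -- point is the identity.
  have h3 : ∀ v : TangentSpace 𝓘(ℝ, E) o,
      mfderiv 𝓘(ℝ, E) 𝓘(ℝ, E) (extChartAt 𝓘(ℝ, E) o) o v = v := fun v =>
    mfderiv_extChartAt_of_eq (E := E) (M := M) rfl v
  rw [ricciTensor, h3]
  rfl

omit [FiniteDimensional ℝ F] [CompleteSpace F] [TopologicalSpace G] [ChartedSpace F G]
  [LieGroup 𝓘(ℝ, F) ∞ G] [ContMDiffSMul 𝓘(ℝ, F) 𝓘(ℝ, E) ∞ G M] [FiniteDimensional ℝ E] in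
lemma IsInvariantSymmTensor.add_smul (hγ : IsInvariantSymmTensor G γ)
    (hT : IsInvariantSymmTensor G T) (t : ℝ) : IsInvariantSymmTensor G (γ + t • T) where
  smooth := hγ.smooth.add_section (hT.smooth.const_smul_section (a := t))
  symm x v w := congrArg₂ (fun a b => a + t * b) (hγ.symm x v w) (hT.symm x v w)
  invariant a x v w := congrArg₂ (fun a b => a + t * b) (hγ.invariant a x v w)
    (hT.invariant a x v w)

end HomogeneousEinstein

/-! ### The Gram matrix of a transformed inner product. -/

section OrthonormalMatrices

variable {V : Type*} [AddCommGroup V] [Module ℝ V] {ι : Type*} [Fintype ι] [DecidableEq ι]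

lemma gramMatrix_compl₁₂ {β : LinearMap.BilinForm ℝ V} {e : Module.Basis ι ℝ V}
    (he : ∀ i j, β (e i) (e j) = if i = j then 1 else 0) (h : Module.End ℝ V) :
    gramMatrix (β.compl₁₂ h h) e
      = (LinearMap.toMatrix e e h).transpose * LinearMap.toMatrix e e h := by
  ext i j
  rw [gramMatrix_apply, LinearMap.compl₁₂_apply, form_eq_sum_gramMatrix β e]
  simp [gramMatrix_apply, he, Matrix.mul_apply, LinearMap.toMatrix_apply]

end OrthonormalMatrices

/-! ### Jets of curves of metrics `⟨h ·, h ·⟩`. -/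

section CurveJets

lemma HasJet.id : HasJet (fun t => t) 0 1 0 :=
  ⟨contDiffAt_id, rfl, by simp, by simp [iteratedDeriv_succ]⟩

variable {ι : Type*} [Fintype ι]

omit [Fintype ι] in
lemma MatrixHasJet.congr {P R : ℝ → Matrix ι ι ℝ} {P₀ P₁ P₂ : Matrix ι ι ℝ}
    (hP : MatrixHasJet P P₀ P₁ P₂) (h : R =ᶠ[𝓝 0] P) : MatrixHasJet R P₀ P₁ P₂ := fun i j =>
  (hP i j).congr (h.mono fun _ ht => congrFun (congrFun ht i) j)

omit [Fintype ι] in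
lemma MatrixHasJet.add_smul (P₀ P₁ : Matrix ι ι ℝ) :
    MatrixHasJet (fun t => P₀ + t • P₁) P₀ P₁ 0 := fun i j =>
  ((HasJet.const (P₀ i j)).add (HasJet.id.mul (HasJet.const (P₁ i j)))).congr_jet
    (by simp) (by simp) (by simp)

omit [Fintype ι] in
lemma MatrixHasJet.transpose {P : ℝ → Matrix ι ι ℝ} {P₀ P₁ P₂ : Matrix ι ι ℝ}
    (hP : MatrixHasJet P P₀ P₁ P₂) : MatrixHasJet (fun t => (P t).transpose) P₀.transpose
      P₁.transpose P₂.transpose := fun i j => hP j i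

omit [Fintype ι] in
lemma MatrixHasJet.exists_of_contDiffAt {P : ℝ → Matrix ι ι ℝ} {P₀ P₁ : Matrix ι ι ℝ}
    (hP : ∀ i j, ContDiffAt ℝ 2 (fun t => P t i j) 0) (h0 : P 0 = P₀)
    (h1 : ∀ i j, HasDerivAt (fun t => P t i j) (P₁ i j) 0) : ∃ P₂, MatrixHasJet P P₀ P₁ P₂ :=
  ⟨Matrix.of fun i j => iteratedDeriv 2 (fun t => P t i j) 0, fun i j =>
    ⟨hP i j, by rw [h0], (h1 i j).deriv, rfl⟩⟩

variable [DecidableEq ι]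

/-- The second derivative along a curve of squares of symmetric matrices with exponential
determinant. -/
theorem hasJet_algScal_sq {t : ι → ι → ι → ℝ} {K : Matrix ι ι ℝ} {ρ : ℝ}
    (hE : ∀ S : Matrix ι ι ℝ, S.transpose = S →
      (1 / 4 : ℝ) * tensorInner (tensorTheta ι S t) t - (1 / 2 : ℝ) * ∑ a, ∑ b, S a b * K a b
        = ρ * S.trace)
    {H : ℝ → Matrix ι ι ℝ} {B H₂ : Matrix ι ι ℝ} (hH : MatrixHasJet H 1 B H₂)
    (hsymm : ∀ᶠ s in 𝓝 (0 : ℝ), (H s).transpose = H s)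
    (hdet : ∀ᶠ s in 𝓝 (0 : ℝ), (H s).det = Real.exp (s * B.trace)) :
    ∃ a b, HasJet (fun s => algScal t K ((H s).transpose * H s)) a b
      (-tensorInner (tensorTheta ι B t) (tensorTheta ι B t)
        - 2 * ∑ a, ∑ b, (B * B) a b * K a b) := by
  obtain ⟨-, hB, hH₂⟩ := hH.transpose.unique (hH.congr hsymm)
  have hP := hH.transpose.mul hH
  rw [hB, hH₂, Matrix.transpose_one] at hP
  simp only [mul_one, one_mul] at hP
  obtain ⟨a, b, h⟩ := hasJet_algScal hE hP (by rw [Matrix.transpose_add, hB])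
    (by rw [Matrix.transpose_add, Matrix.transpose_add, Matrix.transpose_smul,
      Matrix.transpose_mul, hB, hH₂])
  refine ⟨a, b, h.congr_jet rfl rfl ?_⟩
  -- Here `P' = 2B` and `P'' = 2H₂ + 2B²`. With `tr H₂ = tr B²` this gives `tr P'' = 4 tr B² = tr
  -- (P')²`, so the `ρ` term drops out.
  have htr := trace_second_deriv_of_det_eq_exp hH hdet
  have hBB : (B + B) * (B + B) = (4 : ℝ) • (B * B) := by
    rw [add_mul, mul_add]; module
  rw [hBB]
  simp only [map_add, LinearMap.add_apply, Matrix.trace_add, Matrix.trace_smul, smul_eq_mul,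
    Matrix.smul_apply, mul_assoc, ← Finset.mul_sum, htr]
  ring

end CurveJets

end

/-! ### The second variation at an Einstein metric. -/

theorem lemma4p4
    {F : Type*} [NormedAddCommGroup F] [NormedSpace ℝ F] [FiniteDimensional ℝ F] [CompleteSpace F]
    {G : Type*} [TopologicalSpace G] [ChartedSpace F G] [Group G] [LieGroup 𝓘(ℝ, F) ∞ G]
    {E : Type*} [NormedAddCommGroup E] [NormedSpace ℝ E] [FiniteDimensional ℝ E]
    {M : Type*} [TopologicalSpace M] [T2Space M] [ConnectedSpace M] [ChartedSpace E M]
    [IsManifold 𝓘(ℝ, E) ∞ M]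
    [MulAction G M] [ContMDiffSMul 𝓘(ℝ, F) 𝓘(ℝ, E) ∞ G M] [MulAction.IsPretransitive G M]
    -- `G` is unimodular
    (hunim : ∀ X : GroupLieAlgebra 𝓘(ℝ, F) G,
      LinearMap.trace ℝ _ (LieAlgebra.ad ℝ (GroupLieAlgebra 𝓘(ℝ, F) G) X) = 0)
    -- `M = G/K` as a manifold: the orbit map at `o` is a submersion
    (o : M) (hsub : Function.Surjective (orbitDeriv F G E o))
    (p : Submodule ℝ (GroupLieAlgebra 𝓘(ℝ, F) G)) (hp : IsReductiveComplement E o p)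
    (g : TwoTensorField E M) (hg : IsInvariantMetric G g)
    (ρ : ℝ) (hEinstein : ∀ (x : M) (v w : TangentSpace 𝓘(ℝ, E) x),
      ricciTensor g x v w = ρ * g x v w)
    -- `e` is an orthonormal basis of `𝔭` for the inner product `⟨·, ·⟩` given by `g` at `o`
    {ι : Type*} [Fintype ι] [DecidableEq ι] (e : Module.Basis ι ℝ p)
    (he : ∀ i j, formOn o p g (e i) (e j) = if i = j then 1 else 0)
    (T : TwoTensorField E M) (hT : IsInvariantSymmTensor G T)
    -- `A` is the operator with `T = ⟨A ·, ·⟩`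
    (A : Module.End ℝ p) (hA : ∀ X Y : p, formOn o p T X Y = formOn o p g (A X) Y) :
    -- `h` is a curve of symmetric positive definite operators through the identity with velocity
    -- `A` and `det h(t) = exp (t * tr A)`; `γ t` is the invariant metric `⟨h(t) ·, h(t) ·⟩`
    (∀ (h : ℝ → Module.End ℝ p) (γ : ℝ → TwoTensorField E M),
      h 0 = 1 →
      (∀ X Y : p, ContDiffAt ℝ 2 (fun t => formOn o p g (h t X) Y) 0) →
      (∀ X Y : p, HasDerivAt (fun t => formOn o p g (h t X) Y) (formOn o p g (A X) Y) 0) →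
      (∀ᶠ t in 𝓝 (0 : ℝ),
        (∀ X Y : p, formOn o p g (h t X) Y = formOn o p g X (h t Y)) ∧
        (∀ X : p, X ≠ 0 → 0 < formOn o p g (h t X) X) ∧
        LinearMap.det (h t) = Real.exp (t * LinearMap.trace ℝ p A) ∧
        IsInvariantMetric G (γ t) ∧
        ∀ X Y : p, formOn o p (γ t) X Y = formOn o p g (h t X) (h t Y)) →
      ContDiffAt ℝ 2 (fun t => scalarCurvature (γ t) o) 0 ∧
      (1 / 2 : ℝ) * iteratedDeriv 2 (fun t => scalarCurvature (γ t) o) 0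
        = innerOp e ((2 * ρ) • A - lichOp e (bracketOn hp) A) A) ∧
    innerOp e ((2 * ρ) • A - lichOp e (bracketOn hp) A) A
      = -innerOp e (lichOp e (bracketOn hp) A) A + 2 * ρ * LinearMap.trace ℝ p (A * A) ∧
    innerOp e ((2 * ρ) • A - lichOp e (bracketOn hp) A) A
      = -(1 / 2 : ℝ) * innerProd e (theta A (bracketOn hp)) (theta A (bracketOn hp))
        - LinearMap.trace ℝ p (killingOp e * (A * A)) ∧
    -- second derivative along the line `g + t T`
    ContDiffAt ℝ 2 (fun t : ℝ => scalarCurvature (g + t • T) o) 0 ∧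
    iteratedDeriv 2 (fun t : ℝ => scalarCurvature (g + t • T) o) 0
      = (1 / 2 : ℝ) * innerOp e ((2 * ρ) • A - lichOp e (bracketOn hp) A) A
        + ρ * LinearMap.trace ℝ p (A * A) := by
  have hβ : ∀ i j, formBilin g o p (e i) (e j) = if i = j then 1 else 0 := he
  have hrepr : ∀ (X : p) i, formOn o p g X (e i) = e.repr X i := fun X i =>
    form_basis_right hβ X i
  set t := structureConst e (bracketOn hp) with ht
  set K := gramMatrix (killingBilin p) e with hK
  set a := LinearMap.toMatrix e e A with ha
  have hAij : ∀ i j, formOn o p g (A (e j)) (e i) = a i j := fun i j => by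
    rw [hrepr, ha, LinearMap.toMatrix_apply]
  have hsymm : a.transpose = a := by
    ext i j
    rw [Matrix.transpose_apply, ← hAij, ← hAij, ← hA, ← hA]
    exact hT.symm o _ _
  have hE := fun S (_ : S.transpose = S) =>
    einstein_identity hg hunim hsub hp (hEinstein o) e he S
  have htr : LinearMap.trace ℝ p (A * A) = (a * a).trace := by
    rw [LinearMap.trace_eq_matrix_trace ℝ e, LinearMap.toMatrix_mul]
  have hKtr : LinearMap.trace ℝ p (killingOp e * (A * A)) = ∑ i, ∑ j, (a * a) i j * K i j := by
    rw [LinearMap.trace_eq_matrix_trace ℝ e, LinearMap.toMatrix_mul, LinearMap.toMatrix_mul,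
      killingOp, LinearMap.toMatrix_toLin, ← ha]
    simp only [Matrix.trace, Matrix.diag_apply, Matrix.mul_apply (N := a * a)]
    rw [Finset.sum_comm]
    exact Finset.sum_congr rfl fun i _ => Finset.sum_congr rfl fun j _ => mul_comm _ _
  have hθ : innerProd e (theta A (bracketOn hp)) (theta A (bracketOn hp))
      = tensorInner (tensorTheta ι a t) (tensorTheta ι a t) := by
    rw [innerProd_eq_tensorInner, structureConst_theta e hsymm]
  have hL := innerOp_lichOp e hsymm (bracketOn hp)
  have h2 : innerOp e ((2 * ρ) • A - lichOp e (bracketOn hp) A) A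
      = -innerOp e (lichOp e (bracketOn hp) A) A + 2 * ρ * LinearMap.trace ℝ p (A * A) := by
    rw [innerOp_sub_left, innerOp_smul_left, innerOp, transposeOp_eq_self e hsymm]
    ring
  -- The Einstein equation at `S = A²` replaces `2⟨M, A²⟩` in `⟨L A, A⟩` by `2ρ tr A² + tr(B_μ A²)`.
  have hEa := hE (a * a) (by rw [Matrix.transpose_mul, hsymm])
  have h3 : innerOp e ((2 * ρ) • A - lichOp e (bracketOn hp) A) A
      = -(1 / 2 : ℝ) * innerProd e (theta A (bracketOn hp)) (theta A (bracketOn hp))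
        - LinearMap.trace ℝ p (killingOp e * (A * A)) := by
    rw [h2, hL, htr, hKtr]
    linarith
  refine ⟨fun h γ h0 hC2 hder hev => ?_, h2, h3, ?_⟩
  · obtain ⟨H₂, hH⟩ := MatrixHasJet.exists_of_contDiffAt
      (P := fun s => LinearMap.toMatrix e e (h s)) (P₀ := 1) (P₁ := a)
      (fun i j => by simpa only [LinearMap.toMatrix_apply, ← hrepr] using hC2 (e j) (e i))
      (by rw [h0]; exact LinearMap.toMatrix_one e)
      (fun i j => by
        simpa only [LinearMap.toMatrix_apply, ← hrepr, hAij] using hder (e j) (e i))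
    obtain ⟨x, y, hjet⟩ := hasJet_algScal_sq hE hH
      (hev.mono fun s hs => by
        ext i j
        rw [Matrix.transpose_apply, LinearMap.toMatrix_apply, LinearMap.toMatrix_apply, ← hrepr,
          ← hrepr, hs.1]
        exact hg.symm o _ _)
      (hev.mono fun s hs => by
        rw [LinearMap.det_toMatrix, hs.2.2.1, LinearMap.trace_eq_matrix_trace ℝ e])
    have hscal : (fun s => scalarCurvature (γ s) o) =ᶠ[𝓝 0] fun s => algScal t K
        ((LinearMap.toMatrix e e (h s)).transpose * LinearMap.toMatrix e e (h s)) := by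
      filter_upwards [hev] with s hs
      have hgram : formBilin (γ s) o p = (formBilin g o p).compl₁₂ (h s) (h s) := by
        ext X Y
        exact hs.2.2.2.2 X Y
      rw [← gramMatrix_compl₁₂ hβ, ← hgram]
      exact scalarCurvature_eq_algScal hs.2.2.2.1.toIsInvariantSymmTensor hunim hsub hp
        (fun X hX => hs.2.2.2.1.pos o _ (orbitMap_ne_zero hp hX)) e
    have hfin := hjet.congr hscal
    refine ⟨hfin.contDiffAt, ?_⟩
    rw [hfin.deriv2_eq, h3, hθ, hKtr]
    ring
  -- A line has zero second-order coefficient, so the term `ρ tr A²` is not compensated.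
  · obtain ⟨x, y, hjet⟩ := hasJet_algScal hE (MatrixHasJet.add_smul 1 a) hsymm
      Matrix.transpose_zero
    have hscal : (fun s : ℝ => scalarCurvature (g + s • T) o) =ᶠ[𝓝 0]
        fun s => algScal t K (1 + s • a) := by
      -- `g + s T` need not be positive on all of `M`; positivity on `𝔭` for small `s` is enough for
      -- the scalar curvature at `o`.
      filter_upwards [eventually_pos_add_smul (τ := formBilin T o p) hβ] with s hs
      have hgram : gramMatrix (formBilin (g + s • T) o p) e = 1 + s • a := by
        ext i j
        rw [Matrix.add_apply, Matrix.smul_apply, Matrix.one_apply, ← he, ← hsymm,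
          Matrix.transpose_apply, ← hAij, ← hA]
        rfl
      rw [← hgram]
      exact scalarCurvature_eq_algScal (E := E) (M := M)
        (IsInvariantSymmTensor.add_smul (E := E) (M := M) hg.toIsInvariantSymmTensor hT s) hunim
        hsub hp hs e
    have hfin := hjet.congr hscal
    refine ⟨hfin.contDiffAt, ?_⟩
    rw [hfin.deriv2_eq, h3, hθ, hKtr, htr, Matrix.trace_zero]
    ring
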